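/- Let $\ell>0$. On (an open part of) $I\times SU(2)$, with coordinate $x\in I$, let $\sigma_i$ be the right-invariant 1-forms on $SU(2)$, $d\sigma_i=-\tfrac12\epsilon_{ijk}\sigma_j\wedge\sigma_k$, $L_i$ the dual vector fields and $R_i$ the left-invariant fields. A timelike supersymmetric solution of five-dimensional minimal gauged supergravity consists of a Kähler structure $(h,J)$ on the four-dimensional base (oriented by $-\tfrac12 J\wedge J$), a function $f>0$ and a 1-form $\omega$ such that, with $R$, $R_{ab}$, $\mathcal R$ the scalar curvature, Ricci tensor and Ricci form of $h$ and $G^\pm=\tfrac12 f(d\omega\pm\star d\omega)$, $$f^{-1}=-\tfrac{\ell^2}{24}R,\qquad G^+=-\tfrac{\ell}{2}\big(\mathcal R-\tfrac14 RJ\big),$$ and the $J$-component of $G^-$ is $\tfrac{\ell}{2R}\lambda_3J$, $\lambda_3=\tfrac12\nabla^2R+\tfrac23R_{ab}R^{ab}-\tfrac13R^2$. The spacetime metric is $g=-f^2(dt+\omega)^2+f^{-1}h$, and the Maxwell field is $F=\tfrac{\sqrt3}{2}d(f(dt+\omega))-\tfrac1{\sqrt3}G^+-\tfrac{\sqrt3}{\ell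 f}J$. The solution is $U(1)\times SU(2)$-invariant if $g$ and $F$ are invariant under $L_3$ and the $R_i$. It has a smooth (analytic) horizon with the Gutowski–Reall near-horizon geometry if in Gaussian null coordinates, for $\lambda>0$, $$g=-\lambda^2\Delta^2dv^2+2\,dv\,d\lambda+2\lambda h_i\sigma_i\,dv+\gamma_{ij}\sigma_i\sigma_j,\qquad \partial_v=\partial_t,$$ where $\Delta,h_i,\gamma_{ij}$ are smooth (analytic) functions of $\lambda$ on a neighbourhood of $0$, $\gamma_{ij}$ is positive definite, and at $\lambda=0$, with $\Delta_0=\Delta(0)>\sqrt3/\ell$: $h_1=h_2=0$, $h_3=-\frac{3\Delta_0}{\ell(\Delta_0^2-3\ell^{-2})}$, $\gamma_{ij}$ is diagonal, $\gamma_{11}=\gamma_{22}=\frac1{\Delta_0^2-3\ell^{-2}}$, $\gamma_{33}=\frac{\Delta_0^2}{(\Delta_0^2-3\ell^{-2})^2}$. **Forward direction.** Consider a $U(1)\times SU(2)$-invariant timelike supersymmetric solution with such a horizon, and put $\alpha^2=\frac14\frac{\Delta_0^2+9\ell^{-2}}{\Delta_0^2-3\ell^{-2}}$. Then $4\alpha^2>1$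 and: 1. Near the horizon there is a change of coordinates $t=v+T(\lambda)$, $\rho=\rho(\lambda)>0$ with $\rho\to0$ as $\lambda\to0^+$, and $\psi\mapsto\psi+\chi(\lambda)$ in the Euler angle of $L_3=\partial_\psi$, after which $$h=d\rho^2+a(\rho)^2(\sigma_1^2+\sigma_2^2)+c(\rho)^2\sigma_3^2,\quad c=(a^2)',\quad J=d(a^2\sigma_3),\quad \omega=\omega_3(\rho)\sigma_3,\quad f=f(\rho).$$ In every such chart (in which $g$ has this form and $\rho\to 0$ at the horizon) the functions $a^2,c^2,f,\rho^2\omega_3$ are smooth (analytic) functions of $\rho^2$ at $\rho=0$, and as $\rho\to0^+$ $$a^2=\alpha^2\rho^2+O(\rho^4),\quad c^2=4\alpha^4\rho^2+O(\rho^4),\quad f=\tfrac{12\alpha^2}{\ell^2(4\alpha^2-1)}\rho^2+O(\rho^4),\quad \omega_3=\tfrac{\ell^3(4\alpha^2-1)^2}{48\alpha^2}\rho^{-2}+O(1);$$ so the horizon is a conical singularity of $h$. 2. Likewise there is a change of coordinates of the same kind, with $r=r(\lambda)>0$, after which $$h=\frac{dr^2}{V(r)}+\frac{r^2}4(\sigma_1^2+\sigma_2^2)+\frac{r^2V(r)}4\sigma_3^2,\quad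 J=d(\tfrac14r^2\sigma_3),\quad\omega=\omega_3(r)\sigma_3,\quad f=f(r).$$ In every chart in which $g$ has this form, $r\to0$ at the horizon, and $V$, $r^{-2}f$, $r^2\omega_3$ are smooth (analytic) functions of $r^2$ at $r=0$, with $V>0$ and $r^{-2}f>0$ near and at $r=0$, and $V(0)=4\alpha^2$. **Conversely**, a timelike supersymmetric solution of the form in 1 on $0<\rho<\rho_1$ such that $a^2,c^2,f,\rho^2\omega_3$ are smooth (analytic) functions of $\rho^2$ at $\rho=0$ with $a^2=\alpha^2\rho^2+O(\rho^4)$, $c^2=4\alpha^4\rho^2+O(\rho^4)$, $f=f_0\rho^2+O(\rho^4)$, $\omega_3=w_0\rho^{-2}+O(1)$ for some constants $\alpha>0$, $f_0>0$, $w_0$, has a smooth (analytic) horizon with the Gutowski–Reall near-horizon geometry at $\rho=0$. A timelike supersymmetric solution of the form in 2 on $0<r<r_1$ such that $V$, $r^{-2}f$, $r^2\omega_3$ are smooth (analytic) functions of $r^2$ at $r=0$, with $V>0$ and $r^{-2}f>0$ near and at $r=0$, has a smooth (analytic) horizon with the Gutowski–Reall near-horizon geometry at $r=0$. -/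

import Mathlib

open Set Filter Topology Asymptotics
open scoped ContDiff

namespace SusyHorizon

noncomputable section

/-! ### `SU(2)` in Euler angles

Points of the four-dimensional base carry coordinates `(x, θ, φ, ψ)`, where `x` is a radial coordinate
(transverse to the `SU(2)` orbits) and `(θ, φ, ψ)`, `0 < θ < π`, are Euler angles on `SU(2)`. Points
of the spacetime carry coordinates `(t, x, θ, φ, ψ)`, with `∂_t` the supersymmetric Killing field. -/

abbrev Base := Fin 4 → ℝ

abbrev Spacetime := ℝ × Base

/-- The part `0 < x < x₁` of the base. -/
def region (x₁ : ℝ) : Set Base := {p | 0 < p 0 ∧ p 0 < x₁ ∧ 0 < p 1 ∧ p 1 < Real.pi}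

/-- The coframe `(dx, σ₁, σ₂, σ₃)` at `p`, evaluated on the tangent vector `u`; the `σᵢ` are the
right-invariant forms on `SU(2)`, with `dσᵢ = -½ ε_{ijk} σⱼ ∧ σₖ`. -/
def coframe (p u : Base) : Fin 4 → ℝ :=
  ![u 0,
    Real.sin (p 3) * u 1 - Real.cos (p 3) * Real.sin (p 1) * u 2,
    Real.cos (p 3) * u 1 + Real.sin (p 3) * Real.sin (p 1) * u 2,
    u 3 + Real.cos (p 1) * u 2]

/-- The dual frame `(∂ₓ, L₁, L₂, L₃)`. -/
def frame (a : Fin 4) (p : Base) : Base :=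
  (![![1, 0, 0, 0],
    ![0, Real.sin (p 3), -(Real.cos (p 3) / Real.sin (p 1)),
      Real.cos (p 1) / Real.sin (p 1) * Real.cos (p 3)],
    ![0, Real.cos (p 3), Real.sin (p 3) / Real.sin (p 1),
      -(Real.cos (p 1) / Real.sin (p 1) * Real.sin (p 3))],
    ![0, 0, 0, 1]] : Fin 4 → Base) a

/-- The left-invariant fields `R₁, R₂, R₃`, which generate the `SU(2)` symmetry. -/
def rightGen (i : Fin 3) (p : Base) : Base :=
  (![![0, -Real.sin (p 2), -(Real.cos (p 1) / Real.sin (p 1) * Real.cos (p 2)),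
      Real.cos (p 2) / Real.sin (p 1)],
    ![0, Real.cos (p 2), -(Real.cos (p 1) / Real.sin (p 1) * Real.sin (p 2)),
      Real.sin (p 2) / Real.sin (p 1)],
    ![0, 0, 1, 0]] : Fin 3 → Base) i

/-- The structure constants of the frame: `[X_a, X_b] = ∑ c, strucConst a b c • X_c`, i.e.
`[Lᵢ, Lⱼ] = ε_{ijk} Lₖ` and `[∂ₓ, Lᵢ] = 0`. -/
def strucConst (a b c : Fin 4) : ℝ :=
  if (a, b, c) = (1, 2, 3) ∨ (a, b, c) = (2, 3, 1) ∨ (a, b, c) = (3, 1, 2) then 1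
  else if (a, b, c) = (2, 1, 3) ∨ (a, b, c) = (3, 2, 1) ∨ (a, b, c) = (1, 3, 2) then -1
  else 0

theorem coframe_frame (p : Base) (hp : Real.sin (p 1) ≠ 0) (a b : Fin 4) :
    coframe p (frame a p) b = if a = b then 1 else 0 := by
  have h := Real.sin_sq_add_cos_sq (p 3)
  fin_cases a <;> fin_cases b <;> simp [coframe, frame] <;> field_simp <;>
    nlinarith [h]

theorem lieBracket_apply (V W : Base → Base) (p : Base)
    (hV : ∀ i, DifferentiableAt ℝ (fun q => V q i) p)
    (hW : ∀ i, DifferentiableAt ℝ (fun q => W q i) p) (i : Fin 4) :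
    VectorField.lieBracket ℝ V W p i =
      fderiv ℝ (fun q => W q i) p (V p) - fderiv ℝ (fun q => V q i) p (W p) := by
  have hV' : DifferentiableAt ℝ V p := differentiableAt_pi.2 hV
  have hW' : DifferentiableAt ℝ W p := differentiableAt_pi.2 hW
  rw [fderiv_apply hV', fderiv_apply hW']
  rfl

/-- The derivative of the frame fields in the direction `u`. -/
theorem fderiv_frame (p : Base) (hp : Real.sin (p 1) ≠ 0) (a i : Fin 4) :
    DifferentiableAt ℝ (fun q => frame a q i) p ∧ ∀ u, fderiv ℝ (fun q => frame a q i) p u =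
      ((![![0, 0, 0, 0],
        ![0, Real.cos (p 3) * u 3,
          Real.sin (p 3) / Real.sin (p 1) * u 3
            + Real.cos (p 3) * Real.cos (p 1) / Real.sin (p 1) ^ 2 * u 1,
          -(Real.cos (p 1) / Real.sin (p 1) * Real.sin (p 3)) * u 3
            - Real.cos (p 3) / Real.sin (p 1) ^ 2 * u 1],
        ![0, -Real.sin (p 3) * u 3,
          Real.cos (p 3) / Real.sin (p 1) * u 3
            - Real.sin (p 3) * Real.cos (p 1) / Real.sin (p 1) ^ 2 * u 1,
          -(Real.cos (p 1) / Real.sin (p 1) * Real.cos (p 3)) * u 3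
            + Real.sin (p 3) / Real.sin (p 1) ^ 2 * u 1],
        ![0, 0, 0, 0]] : Fin 4 → Fin 4 → ℝ) a i) := by
  have e (i : Fin 4) : HasFDerivAt (fun q : Base => q i)
      (ContinuousLinearMap.proj i : Base →L[ℝ] ℝ) p :=
    (ContinuousLinearMap.proj (R := ℝ) (φ := fun _ : Fin 4 => ℝ) i).hasFDerivAt
  have s3 := (e 3).sin
  have c3 := (e 3).cos
  have c1 := (e 1).cos
  have i1 : HasFDerivAt (fun q : Base => (Real.sin (q 1))⁻¹) _ p :=
    (hasDerivAt_inv hp).comp_hasFDerivAt p (e 1).sin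
  have hc : Real.cos (p 1) ^ 2 = 1 - Real.sin (p 1) ^ 2 := by
    linarith [Real.sin_sq_add_cos_sq (p 1)]
  have key {F : Base → ℝ} {D : Base →L[ℝ] ℝ} {v : Base → ℝ} (h : HasFDerivAt F D p)
      (h' : ∀ u, D u = v u) : DifferentiableAt ℝ F p ∧ ∀ u, fderiv ℝ F p u = v u :=
    ⟨h.differentiableAt, fun u => by rw [h.fderiv, h']⟩
  fin_cases a <;> fin_cases i <;>
    simp only [frame, div_eq_mul_inv, Fin.zero_eta, Fin.mk_one, Fin.reduceFinMk,
      Matrix.cons_val_zero, Matrix.cons_val_one, Matrix.cons_val]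
  all_goals first
    | exact key (hasFDerivAt_const _ _) (fun u => rfl)
    | exact key s3 (fun u => by simp)
    | exact key c3 (fun u => by simp)
    | exact key (c3.mul i1).neg (fun u => by simp; field_simp; try ring)
    | exact key (s3.mul i1) (fun u => by simp; field_simp; try ring)
    | exact key ((c1.mul i1).mul c3) (fun u => by simp; field_simp; rw [hc]; ring)
    | exact key ((c1.mul i1).mul s3).neg (fun u => by simp; field_simp; rw [hc]; ring)

/-- The derivative of the generators `Rᵢ` in the direction `u`. -/
theorem fderiv_rightGen (p : Base) (hp : Real.sin (p 1) ≠ 0) (a : Fin 3) (i : Fin 4) :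
    DifferentiableAt ℝ (fun q => rightGen a q i) p ∧ ∀ u, fderiv ℝ (fun q => rightGen a q i) p u =
      ((![![0, -Real.cos (p 2) * u 2,
          Real.cos (p 1) / Real.sin (p 1) * Real.sin (p 2) * u 2
            + Real.cos (p 2) / Real.sin (p 1) ^ 2 * u 1,
          -(Real.sin (p 2) / Real.sin (p 1)) * u 2
            - Real.cos (p 2) * Real.cos (p 1) / Real.sin (p 1) ^ 2 * u 1],
        ![0, -Real.sin (p 2) * u 2,
          -(Real.cos (p 1) / Real.sin (p 1) * Real.cos (p 2)) * u 2
            + Real.sin (p 2) / Real.sin (p 1) ^ 2 * u 1,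
          Real.cos (p 2) / Real.sin (p 1) * u 2
            - Real.sin (p 2) * Real.cos (p 1) / Real.sin (p 1) ^ 2 * u 1],
        ![0, 0, 0, 0]] : Fin 3 → Fin 4 → ℝ) a i) := by
  have e (i : Fin 4) : HasFDerivAt (fun q : Base => q i)
      (ContinuousLinearMap.proj i : Base →L[ℝ] ℝ) p :=
    (ContinuousLinearMap.proj (R := ℝ) (φ := fun _ : Fin 4 => ℝ) i).hasFDerivAt
  have s2 := (e 2).sin
  have c2 := (e 2).cos
  have c1 := (e 1).cos
  have i1 : HasFDerivAt (fun q : Base => (Real.sin (q 1))⁻¹) _ p :=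
    (hasDerivAt_inv hp).comp_hasFDerivAt p (e 1).sin
  have hc : Real.cos (p 1) ^ 2 = 1 - Real.sin (p 1) ^ 2 := by
    linarith [Real.sin_sq_add_cos_sq (p 1)]
  have key {F : Base → ℝ} {D : Base →L[ℝ] ℝ} {v : Base → ℝ} (h : HasFDerivAt F D p)
      (h' : ∀ u, D u = v u) : DifferentiableAt ℝ F p ∧ ∀ u, fderiv ℝ F p u = v u :=
    ⟨h.differentiableAt, fun u => by rw [h.fderiv, h']⟩
  fin_cases a <;> fin_cases i <;>
    simp only [rightGen, div_eq_mul_inv, Fin.zero_eta, Fin.mk_one, Fin.reduceFinMk,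
      Matrix.cons_val_zero, Matrix.cons_val_one, Matrix.cons_val]
  all_goals first
    | exact key (hasFDerivAt_const _ _) (fun u => rfl)
    | exact key s2.neg (fun u => by simp)
    | exact key c2 (fun u => by simp)
    | exact key (c2.mul i1) (fun u => by simp; field_simp; try ring)
    | exact key (s2.mul i1) (fun u => by simp; field_simp; try ring)
    | exact key ((c1.mul i1).mul c2).neg (fun u => by simp; field_simp; rw [hc]; ring)
    | exact key ((c1.mul i1).mul s2).neg (fun u => by simp; field_simp; rw [hc]; ring)

/-- `[L₁, L₂] = L₃`, `[L₂, L₃] = L₁`, `[L₃, L₁] = L₂`; the other brackets of frame fields follow by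
antisymmetry or vanish. -/
theorem lieBracket_frame (p : Base) (hp : Real.sin (p 1) ≠ 0) :
    VectorField.lieBracket ℝ (frame 1) (frame 2) p = frame 3 p ∧
    VectorField.lieBracket ℝ (frame 2) (frame 3) p = frame 1 p ∧
    VectorField.lieBracket ℝ (frame 3) (frame 1) p = frame 2 p := by
  have h1 : Real.cos (p 1) ^ 2 = 1 - Real.sin (p 1) ^ 2 := by
    linarith [Real.sin_sq_add_cos_sq (p 1)]
  have h3 : Real.cos (p 3) ^ 2 = 1 - Real.sin (p 3) ^ 2 := by
    linarith [Real.sin_sq_add_cos_sq (p 3)]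
  refine ⟨?_, ?_, ?_⟩ <;> ext i <;>
    rw [lieBracket_apply _ _ _ (fun i => (fderiv_frame p hp _ i).1)
      (fun i => (fderiv_frame p hp _ i).1), (fderiv_frame p hp _ i).2,
      (fderiv_frame p hp _ i).2] <;>
    fin_cases i <;> simp [frame] <;> field_simp <;> ring_nf <;> simp only [h1, h3] <;> ring

/-- `[Rᵢ, X_a] = 0`. -/
theorem lieBracket_rightGen_frame (p : Base) (hp : Real.sin (p 1) ≠ 0) (i : Fin 3) (a : Fin 4) :
    VectorField.lieBracket ℝ (rightGen i) (frame a) p = 0 := by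
  ext j
  rw [lieBracket_apply _ _ _ (fun j => (fderiv_rightGen p hp i j).1)
    (fun i => (fderiv_frame p hp a i).1), (fderiv_rightGen p hp i j).2,
    (fderiv_frame p hp a j).2]
  fin_cases i <;> fin_cases a <;> fin_cases j <;>
    simp [frame, rightGen] <;> field_simp <;> ring

/-! ### Tensors in the frame

Tensor fields on the base are given by their components in the frame `(∂ₓ, L₁, L₂, L₃)`, which are
functions on the base. -/

abbrev OneForm := Base → Fin 4 → ℝ

abbrev TwoTensor := Base → Matrix (Fin 4) (Fin 4) ℝ

/-- Value of a covariant 2-tensor on two tangent vectors. -/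
def eval2 (B : TwoTensor) (p u w : Base) : ℝ :=
  ∑ a, ∑ b, B p a b * coframe p u a * coframe p w b

def eval1 (α : OneForm) (p u : Base) : ℝ := ∑ a, α p a * coframe p u a

/-- `X_a F`, for a function `F`. -/
def der (a : Fin 4) (F : Base → ℝ) (p : Base) : ℝ := fderiv ℝ F p (frame a p)

/-- Exterior derivative of a 1-form. -/
def ext1 (α : OneForm) : TwoTensor := fun p => Matrix.of fun a b =>
  der a (fun q => α q b) p - der b (fun q => α q a) p - ∑ c, strucConst a b c * α p c

/-- Exterior derivative of a 2-form. -/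
def ext2 (B : TwoTensor) (p : Base) (a b c : Fin 4) : ℝ :=
  der a (fun q => B q b c) p + der b (fun q => B q c a) p + der c (fun q => B q a b) p
    - ∑ d, (strucConst a b d * B p d c + strucConst b c d * B p d a + strucConst c a d * B p d b)

/-- Component along `X_c` of the Lie bracket `[Y, X_a]`. -/
def bracketCoeff (Y : Base → Base) (p : Base) (a c : Fin 4) : ℝ :=
  coframe p (VectorField.lieBracket ℝ Y (frame a) p) c

/-- Lie derivatives along `Y` of functions, 1-forms and covariant 2-tensors. -/
def lie0 (Y : Base → Base) (F : Base → ℝ) (p : Base) : ℝ := fderiv ℝ F p (Y p)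

def lie1 (Y : Base → Base) (α : OneForm) (p : Base) (a : Fin 4) : ℝ :=
  lie0 Y (fun q => α q a) p - ∑ c, bracketCoeff Y p a c * α p c

def lie2 (Y : Base → Base) (B : TwoTensor) (p : Base) (a b : Fin 4) : ℝ :=
  lie0 Y (fun q => B q a b) p
    - ∑ c, (bracketCoeff Y p a c * B p c b + bracketCoeff Y p b c * B p a c)

/-! ### Riemannian geometry of the base -/

/-- Koszul formula: `h(∇_{X_a} X_b, X_c)`. -/
def koszul (h : TwoTensor) (p : Base) (a b c : Fin 4) : ℝ :=
  (1 / 2) * (der a (fun q => h q b c) p + der b (fun q => h q a c) p - der c (fun q => h q a b) p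
    + ∑ d, (strucConst a b d * h p d c - strucConst a c d * h p d b - strucConst b c d * h p d a))

/-- Levi-Civita connection: `∇_{X_a} X_b = ∑ d, conn h p d a b • X_d`. -/
def conn (h : TwoTensor) (p : Base) (d a b : Fin 4) : ℝ :=
  ∑ c, (h p)⁻¹ d c * koszul h p a b c

/-- Riemann tensor: `R(X_a, X_b) X_c = ∑ d, riem h p d c a b • X_d`. -/
def riem (h : TwoTensor) (p : Base) (d c a b : Fin 4) : ℝ :=
  der a (fun q => conn h q d b c) p - der b (fun q => conn h q d a c) p
    + ∑ e, (conn h p e b c * conn h p d a e - conn h p e a c * conn h p d b e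
        - strucConst a b e * conn h p d e c)

def ricci (h : TwoTensor) : TwoTensor := fun p => Matrix.of fun a b => ∑ c, riem h p c a c b

/-- Both indices of a covariant 2-tensor raised. -/
def raise (h : TwoTensor) (B : TwoTensor) (p : Base) (a b : Fin 4) : ℝ :=
  ∑ c, ∑ d, (h p)⁻¹ a c * (h p)⁻¹ b d * B p c d

/-- Full contraction `A_{ab} B^{ab}`. -/
def contract (h A B : TwoTensor) (p : Base) : ℝ := ∑ a, ∑ b, A p a b * raise h B p a b

def scalarCurv (h : TwoTensor) (p : Base) : ℝ := ∑ a, ∑ b, (h p)⁻¹ a b * ricci h p a b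

def laplacian (h : TwoTensor) (F : Base → ℝ) (p : Base) : ℝ :=
  ∑ a, ∑ b, (h p)⁻¹ a b * (der a (der b F) p - ∑ c, conn h p c a b * der c F p)

/-- Ricci form `½ R_{abcd} J^{cd}`. -/
def ricciForm (h J : TwoTensor) : TwoTensor := fun p => Matrix.of fun a b =>
  (1 / 2) * ∑ c, ∑ d, (∑ e, h p a e * riem h p e b c d) * raise h J p c d

/-- Covariant derivative `∇_c B_{ab}`. -/
def covDer (h B : TwoTensor) (p : Base) (c a b : Fin 4) : ℝ :=
  der c (fun q => B q a b) p - ∑ d, (conn h p d c a * B p d b + conn h p d c b * B p a d)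

/-- The volume form `-½ J ∧ J`: the base is oriented so that `J` is anti-self-dual. -/
def volForm (J : TwoTensor) (p : Base) (a b c d : Fin 4) : ℝ :=
  -(J p a b * J p c d - J p a c * J p b d + J p a d * J p b c)

/-- Hodge star on 2-forms. -/
def star (h J B : TwoTensor) : TwoTensor := fun p => Matrix.of fun a b =>
  (1 / 2) * ∑ c, ∑ d, volForm J p a b c d * raise h B p c d

/-! ### Timelike supersymmetric solutions -/

/-- `(h, J)` is a smooth Kähler structure on `D`. -/
structure IsKahler (D : Set Base) (h J : TwoTensor) : Prop where
  smooth_metric : ∀ a b, ContDiffOn ℝ ∞ (fun p => h p a b) D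
  smooth_form : ∀ a b, ContDiffOn ℝ ∞ (fun p => J p a b) D
  posDef : ∀ p ∈ D, (h p).PosDef
  antisymm : ∀ p ∈ D, (J p).transpose = -J p
  almost_complex : ∀ p ∈ D, ((h p)⁻¹ * J p) * ((h p)⁻¹ * J p) = -1
  closed : ∀ p ∈ D, ∀ a b c, ext2 J p a b c = 0
  parallel : ∀ p ∈ D, ∀ c a b, covDer h J p c a b = 0

/-- `G⁺ = ½ f (dω + ⋆dω)`. -/
def Gplus (f : Base → ℝ) (om : OneForm) (h J : TwoTensor) : TwoTensor := fun p =>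
  (f p / 2) • (ext1 om p + star h J (ext1 om) p)

/-- `G⁻ = ½ f (dω - ⋆dω)`. -/
def Gminus (f : Base → ℝ) (om : OneForm) (h J : TwoTensor) : TwoTensor := fun p =>
  (f p / 2) • (ext1 om p - star h J (ext1 om) p)

/-- `λ₃ = ½ ∇²R + ⅔ R_{ab} R^{ab} - ⅓ R²`. -/
def lambda3 (h : TwoTensor) (p : Base) : ℝ :=
  (1 / 2) * laplacian h (scalarCurv h) p + (2 / 3) * contract h (ricci h) (ricci h) p
    - (1 / 3) * scalarCurv h p ^ 2

/-- Timelike supersymmetric solution `(f, ω, h, J)` of five-dimensional minimal gauged supergravity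
on `D`. The last field is the `J`-component of the expansion
`G⁻ = (ℓ / (2R)) (λ₁ Ω¹ + λ₂ Ω² + λ₃ J)` in a quaternionic basis of anti-self-dual forms (mutually
orthogonal, with `J_{ab} J^{ab} = 4`); `λ₁, λ₂` are constrained only by the existence of `ω`. -/
structure IsTimelikeSusy (ℓ : ℝ) (D : Set Base) (f : Base → ℝ) (om : OneForm) (h J : TwoTensor) :
    Prop where
  kahler : IsKahler D h J
  smooth_f : ContDiffOn ℝ ∞ f D
  smooth_omega : ∀ a, ContDiffOn ℝ ∞ (fun p => om p a) D
  f_pos : ∀ p ∈ D, 0 < f p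
  f_eq : ∀ p ∈ D, (f p)⁻¹ = -(ℓ ^ 2 / 24) * scalarCurv h p
  Gplus_eq : ∀ p ∈ D, Gplus f om h J p =
    (-(ℓ / 2)) • (ricciForm h J p - (scalarCurv h p / 4) • J p)
  Gminus_eq : ∀ p ∈ D, contract h (Gminus f om h J) J p =
    ℓ / (2 * scalarCurv h p) * lambda3 h p * 4

/-- The spacetime metric `g = -f² (dt + ω)² + f⁻¹ h`. -/
def timelikeMetric (f : Base → ℝ) (om : OneForm) (h : TwoTensor) (P U W : Spacetime) : ℝ :=
  -(f P.2) ^ 2 * (U.1 + eval1 om P.2 U.2) * (W.1 + eval1 om P.2 W.2)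
    + (f P.2)⁻¹ * eval2 h P.2 U.2 W.2

/-- The part without `dt` of the Maxwell field
`F = (√3/2) d(f(dt + ω)) - G⁺/√3 - (√3/(ℓ f)) J`. The remaining part is `(√3/2) df ∧ dt`. -/
def maxwellSpatial (ℓ : ℝ) (f : Base → ℝ) (om : OneForm) (h J : TwoTensor) : TwoTensor := fun p =>
  (Real.sqrt 3 / 2) • ext1 (fun q a => f q * om q a) p - (1 / Real.sqrt 3) • Gplus f om h J p
    - (Real.sqrt 3 / (ℓ * f p)) • J p

/-- The flow of the vector field `Y` preserves the metric `-f² (dt + ω)² + f⁻¹ h`, the Killing field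
`∂_t`, the coordinate `t` and the Maxwell field. -/
structure IsSymmetry (ℓ : ℝ) (D : Set Base) (f : Base → ℝ) (om : OneForm) (h J : TwoTensor)
    (Y : Base → Base) : Prop where
  f_inv : ∀ p ∈ D, lie0 Y f p = 0
  omega_inv : ∀ p ∈ D, ∀ a, lie1 Y om p a = 0
  h_inv : ∀ p ∈ D, ∀ a b, lie2 Y h p a b = 0
  maxwell_inv : ∀ p ∈ D, ∀ a b, lie2 Y (maxwellSpatial ℓ f om h J) p a b = 0

/-- `U(1) × SU(2)` symmetry: `SU(2)` is generated by the `Rᵢ` and `U(1)` by `L₃`. -/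
def IsU1SU2Invariant (ℓ : ℝ) (D : Set Base) (f : Base → ℝ) (om : OneForm) (h J : TwoTensor) : Prop :=
  (∀ i, IsSymmetry ℓ D f om h J (rightGen i)) ∧ IsSymmetry ℓ D f om h J (frame 3)

/-! ### The standard `U(1) × SU(2)`-invariant form -/

/-- The metric `N(x) dx² + A(x) (σ₁² + σ₂²) + C(x) σ₃²`. -/
def radialMetric (N A C : ℝ → ℝ) : TwoTensor := fun p =>
  Matrix.diagonal ![N (p 0), A (p 0), A (p 0), C (p 0)]

/-- The 1-form `w(x) σ₃`. -/
def sigma3Form (w : ℝ → ℝ) : OneForm := fun p => ![0, 0, 0, w (p 0)]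

/-! ### Horizons -/

/-- The metric
`-λ² Δ² dv² + 2 dv dλ + 2 λ hᵢ σᵢ dv + γᵢⱼ σᵢ σⱼ` in `SU(2)`-invariant Gaussian null coordinates
`(v, λ, θ, φ, ψ)`, with `Δ`, `hᵢ = k i` and `γᵢⱼ` functions of `λ`. -/
def gaussianNullMetric (Δ : ℝ → ℝ) (k : Fin 3 → ℝ → ℝ) (γ : ℝ → Matrix (Fin 3) (Fin 3) ℝ)
    (P U W : Spacetime) : ℝ :=
  -(P.2 0) ^ 2 * Δ (P.2 0) ^ 2 * U.1 * W.1 + (U.1 * W.2 0 + W.1 * U.2 0)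
    + ∑ i : Fin 3, P.2 0 * k i (P.2 0) *
        (coframe P.2 U.2 i.succ * W.1 + coframe P.2 W.2 i.succ * U.1)
    + ∑ i : Fin 3, ∑ j : Fin 3,
        γ (P.2 0) i j * coframe P.2 U.2 i.succ * coframe P.2 W.2 j.succ

/-- The Gaussian null data are `C^n` across the horizon `λ = 0`, for `|λ| < ε`, and the sections of
constant `v` and `λ` are Riemannian. -/
structure IsRegularHorizon (n : WithTop ℕ∞) (ε : ℝ) (Δ : ℝ → ℝ) (k : Fin 3 → ℝ → ℝ)
    (γ : ℝ → Matrix (Fin 3) (Fin 3) ℝ) : Prop where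
  pos : 0 < ε
  reg_Delta : ContDiffOn ℝ n Δ (Ioo (-ε) ε)
  reg_k : ∀ i, ContDiffOn ℝ n (k i) (Ioo (-ε) ε)
  reg_gamma : ∀ i j, ContDiffOn ℝ n (fun x => γ x i j) (Ioo (-ε) ε)
  posDef : ∀ x ∈ Ioo (-ε) ε, (γ x).PosDef

/-- The near-horizon data, i.e. the values at `λ = 0`, are those of the Gutowski-Reall near-horizon
geometry. -/
structure IsGutowskiReallNH (ℓ : ℝ) (Δ : ℝ → ℝ) (k : Fin 3 → ℝ → ℝ)
    (γ : ℝ → Matrix (Fin 3) (Fin 3) ℝ) : Prop where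
  Delta_gt : Real.sqrt 3 / ℓ < Δ 0
  k_eq : (fun i => k i 0) = ![0, 0, -(3 * Δ 0 / (ℓ * (Δ 0 ^ 2 - 3 / ℓ ^ 2)))]
  gamma_eq : γ 0 = Matrix.diagonal ![1 / (Δ 0 ^ 2 - 3 / ℓ ^ 2), 1 / (Δ 0 ^ 2 - 3 / ℓ ^ 2),
    Δ 0 ^ 2 / (Δ 0 ^ 2 - 3 / ℓ ^ 2) ^ 2]

/-- The coordinate change `(λ, θ, φ, ψ) ↦ (r(λ), θ, φ, ψ + χ(λ))`. -/
def baseChange (r χ : ℝ → ℝ) (p : Base) : Base := ![r (p 0), p 1, p 2, p 3 + χ (p 0)]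

/-- The coordinate change `(v, λ, θ, φ, ψ) ↦ (v + T(λ), r(λ), θ, φ, ψ + χ(λ))`; these are the
coordinate changes compatible with `∂_t`, `Rᵢ` and `L₃`. -/
def spacetimeChange (T r χ : ℝ → ℝ) (P : Spacetime) : Spacetime :=
  (P.1 + T (P.2 0), baseChange r χ P.2)

/-- For `0 < λ < δ`, the coordinate change `(T, r, χ)` identifies the metric given by the Gaussian
null data `(Δ, k, γ)` with the metric `-f² (dt + w σ₃)² + f⁻¹ (N dr² + A (σ₁² + σ₂²) + C σ₃²)`, where
`f, w, N, A, C` are functions of `r > 0`. -/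
structure IsStandardChart (δ : ℝ) (Δ : ℝ → ℝ) (k : Fin 3 → ℝ → ℝ)
    (γ : ℝ → Matrix (Fin 3) (Fin 3) ℝ) (T r χ N A C f w : ℝ → ℝ) : Prop where
  smooth_T : ContDiffOn ℝ ∞ T (Ioo 0 δ)
  smooth_r : ContDiffOn ℝ ∞ r (Ioo 0 δ)
  smooth_chi : ContDiffOn ℝ ∞ χ (Ioo 0 δ)
  r_pos : ∀ x ∈ Ioo 0 δ, 0 < r x
  deriv_r : ∀ x ∈ Ioo 0 δ, deriv r x ≠ 0
  metric_eq : ∀ P : Spacetime, P.2 ∈ region δ → ∀ U W : Spacetime,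
    gaussianNullMetric Δ k γ P U W =
      timelikeMetric (fun p => f (p 0)) (sigma3Form w) (radialMetric N A C)
        (spacetimeChange T r χ P) (fderiv ℝ (spacetimeChange T r χ) P U)
        (fderiv ℝ (spacetimeChange T r χ) P W)

/-- For `0 < λ < δ`, the 2-form `J` is the pull-back of `d(A(r) σ₃)`. -/
def FormMatches (δ : ℝ) (J : TwoTensor) (r χ A : ℝ → ℝ) : Prop :=
  ∀ p ∈ region δ, ∀ u w : Base,
    eval2 J p u w = eval2 (ext1 (sigma3Form A)) (baseChange r χ p)
      (fderiv ℝ (baseChange r χ) p u) (fderiv ℝ (baseChange r χ) p w)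

/-- The solution with base metric `N dr² + A (σ₁² + σ₂²) + C σ₃²`, `ω = w σ₃` and `f`, all functions
of `r ∈ (0, x₁)`, has a `C^n` horizon at `r = 0`, with Gutowski-Reall near-horizon geometry. -/
def HasHorizonAtZero (ℓ : ℝ) (n : WithTop ℕ∞) (x₁ : ℝ) (N A C f w : ℝ → ℝ) : Prop :=
  ∃ (ε : ℝ) (Δ : ℝ → ℝ) (k : Fin 3 → ℝ → ℝ) (γ : ℝ → Matrix (Fin 3) (Fin 3) ℝ) (T r χ : ℝ → ℝ),
    IsRegularHorizon n ε Δ k γ ∧ IsGutowskiReallNH ℓ Δ k γ ∧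
    IsStandardChart ε Δ k γ T r χ N A C f w ∧
    Tendsto r (𝓝[>] 0) (𝓝 0) ∧ ∀ x ∈ Ioo 0 ε, r x < x₁

/-- Boundary conditions at a conical singularity `ρ = 0`, for the base metric
`dρ² + a² (σ₁² + σ₂²) + c² σ₃²`, the function `f` and `ω = w σ₃`. -/
def IsConical (n : WithTop ℕ∞) (α2 f₀ w₀ : ℝ) (a c f w : ℝ → ℝ) : Prop :=
  (∃ (η : ℝ) (A C F W : ℝ → ℝ), 0 < η ∧
    ContDiffOn ℝ n A (Ioo (-η) η) ∧ ContDiffOn ℝ n C (Ioo (-η) η) ∧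
    ContDiffOn ℝ n F (Ioo (-η) η) ∧ ContDiffOn ℝ n W (Ioo (-η) η) ∧
    ∀ x, 0 < x → x ^ 2 < η →
      a x ^ 2 = A (x ^ 2) ∧ c x ^ 2 = C (x ^ 2) ∧ f x = F (x ^ 2) ∧ x ^ 2 * w x = W (x ^ 2)) ∧
  (fun x => a x ^ 2 - α2 * x ^ 2) =O[𝓝[>] 0] (fun x : ℝ => x ^ 4) ∧
  (fun x => c x ^ 2 - 4 * α2 ^ 2 * x ^ 2) =O[𝓝[>] 0] (fun x : ℝ => x ^ 4) ∧
  (fun x => f x - f₀ * x ^ 2) =O[𝓝[>] 0] (fun x : ℝ => x ^ 4) ∧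
  (fun x => w x - w₀ / x ^ 2) =O[𝓝[>] 0] (fun _ : ℝ => (1 : ℝ))

/-- Boundary conditions at `r = 0` in the chart in which the base metric is
`dr²/V + (r²/4) (σ₁² + σ₂²) + (r² V/4) σ₃²`: near `r = 0`, the functions `V > 0`, `r⁻² f > 0` and
`r² w` are `C^n` functions of `r²`, and `V` has the value `V₀` at `r = 0`. -/
def IsRegularInRSquared (n : WithTop ℕ∞) (V₀ : ℝ) (V f w : ℝ → ℝ) : Prop :=
  ∃ (η : ℝ) (Vs Fs Ws : ℝ → ℝ), 0 < η ∧
    ContDiffOn ℝ n Vs (Ioo (-η) η) ∧ ContDiffOn ℝ n Fs (Ioo (-η) η) ∧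
    ContDiffOn ℝ n Ws (Ioo (-η) η) ∧
    (∀ s ∈ Ico 0 η, 0 < Vs s ∧ 0 < Fs s) ∧ Vs 0 = V₀ ∧
    ∀ r, 0 < r → r ^ 2 < η →
      V r = Vs (r ^ 2) ∧ f r / r ^ 2 = Fs (r ^ 2) ∧ r ^ 2 * w r = Ws (r ^ 2)

/-- `α²` in terms of the near-horizon constant `Δ(0)`. -/
def alphaSq (ℓ Δ₀ : ℝ) : ℝ := (Δ₀ ^ 2 + 9 / ℓ ^ 2) / (4 * (Δ₀ ^ 2 - 3 / ℓ ^ 2))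

def fZero (ℓ α2 : ℝ) : ℝ := 12 * α2 / (ℓ ^ 2 * (4 * α2 - 1))

def omegaZero (ℓ α2 : ℝ) : ℝ := ℓ ^ 3 * (4 * α2 - 1) ^ 2 / (48 * α2)

end

end SusyHorizon

/-!
Everything is reduced to functions of one radial variable, and the regularity statements to a
singular linear equation.

**Gaussian null coordinates.** Comparing the two forms of the metric gives `f = λ Δ` and
expresses `ω` and `h` through `Δ`, `hᵢ`, `γᵢⱼ`. Invariance under `L₃` makes `h₁ = h₂ = 0` and
`γ` diagonal with `γ₁₁ = γ₂₂` (`invariant_data`). The components of the Maxwell field that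
rotate under `L₃` are multiples of those of `J`, so they vanish; with `dJ = 0` and `J² = -1`
this leaves `J = ± d(A σ₃)`, where `A = λ Δ γ₁₁`, together with `γ₃₃ = A'²`
(`invariant_kahlerForm`). The `σ₁ ∧ σ₂` component of the equation for `G⁺` has a limit at `λ =
0`, and the Gutowski-Reall values satisfy it only for the positive sign (`kahlerForm_eq`).

**Standard charts.** In a chart `(T, r, χ)` the metric identity is equivalent to algebraic
relations for `f`, `A`, `C`, `w` at `r(λ)` and one relation for `N r'²`, with `T` and `χ` found
by quadrature (`ChartRelations`, `exists_standardChart`, `IsStandardChart.relations`). For `N =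
1` the last relation says `ρ' = g(λ) / √λ` with `g > 0` regular. Its solution vanishing at the
horizon is `√λ Q(λ)`, where `λ Q' + Q / 2 = g`; this equation has a solution as regular as `g`,
namely a weighted average of `g`, which is smooth by differentiation under the integral and
analytic by termwise integration of the power series (`exists_regular_solution`). So `ρ² = λ Q²`
is a regular coordinate at `λ = 0`, and all coefficients are regular functions of it. In the
other chart `r² = 4 λ Δ γ₁₁` directly. That these are the only charts follows since `ρ'` is
determined up to a constant sign, and `ρ → 0` and `ρ > 0` fix the rest (`eq_of_sq_deriv_eq`).

**Converse.** Both charts are instances of one situation: `N`, `A / x²`, `C / x²`, `f / x²`, `x²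
w` are regular functions of `s = x²` (`ConicalData`). The equation `J² = -1` and the limits at
`s = 0` of the two `G⁺` equations determine the leading coefficients in terms of those of `A`
and `f` (`ConicalData.values_at_zero`). The horizon coordinate `λ` is then a primitive of a
positive regular function of `s`, and inverting `s ↦ λ` gives regular Gaussian null data, whose
values at `λ = 0` are those of Gutowski and Reall with `Δ(0)² - 3/ℓ² = lim f / A`
(`ConicalData.hasHorizonAtZero`).
-/

namespace SusyHorizon

noncomputable section

/-! ### A singular first-order equation -/

/-- The average `∫₀¹ u^m g(x u²) du`. It solves `2 x Q' + (m + 1) Q = g`, see `eulerMean_ode`. -/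
def eulerMean (m : ℕ) (g : ℝ → ℝ) (x : ℝ) : ℝ := ∫ u in (0 : ℝ)..1, u ^ m * g (x * u ^ 2)

theorem mul_sq_mem_Ioo {η x u : ℝ} (hx : x ∈ Ioo (-η) η) (hu : u ∈ Icc (0 : ℝ) 1) :
    x * u ^ 2 ∈ Ioo (-η) η := by
  have h1 : |x| < η := abs_lt.2 hx
  have h2 : u ^ 2 ≤ 1 := by nlinarith [hu.1, hu.2]
  refine abs_lt.1 (lt_of_le_of_lt ?_ h1)
  rw [abs_mul, abs_of_nonneg (sq_nonneg u)]
  nlinarith [abs_nonneg x, sq_nonneg u]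

theorem hasDerivAt_eulerMean {η : ℝ} {g : ℝ → ℝ} (hg : ContDiffOn ℝ 1 g (Ioo (-η) η)) (m : ℕ)
    {x : ℝ} (hx : x ∈ Ioo (-η) η) :
    HasDerivAt (eulerMean m g) (eulerMean (m + 2) (deriv g) x) x := by
  -- a compact interval around `x`, on which `g'` is bounded
  obtain ⟨b, hxb, hbη⟩ : ∃ b, |x| < b ∧ b < η := exists_between (abs_lt.2 hx)
  have hb : 0 < b := (abs_nonneg x).trans_lt hxb
  have hsub : Icc (-b) b ⊆ Ioo (-η) η := fun y hy => ⟨by linarith [hy.1], by linarith [hy.2]⟩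
  have hg' : ContinuousOn (deriv g) (Ioo (-η) η) :=
    hg.continuousOn_deriv_of_isOpen isOpen_Ioo le_rfl
  obtain ⟨C, hC⟩ := isCompact_Icc.exists_bound_of_continuousOn (hg'.mono hsub)
  have hgc := hg.continuousOn
  have hmaps : ∀ y ∈ Ioo (-b) b, MapsTo (fun u : ℝ => y * u ^ 2) (Icc 0 1) (Ioo (-η) η) :=
    fun y hy u hu => mul_sq_mem_Ioo ⟨by linarith [hy.1], by linarith [hy.2]⟩ hu
  have hcont : ∀ (G : ℝ → ℝ), ContinuousOn G (Ioo (-η) η) → ∀ (j : ℕ), ∀ y ∈ Ioo (-b) b,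
      ContinuousOn (fun u : ℝ => u ^ j * G (y * u ^ 2)) (Icc 0 1) := fun G hG j y hy =>
    (by fun_prop : ContinuousOn (fun u : ℝ => u ^ j) (Icc 0 1)).mul
      (hG.comp (by fun_prop) (hmaps y hy))
  have hxb' : x ∈ Ioo (-b) b := abs_lt.1 hxb
  have hmeas : ∀ (G : ℝ → ℝ), ContinuousOn G (Ioo (-η) η) → ∀ (j : ℕ), ∀ y ∈ Ioo (-b) b,
      IntervalIntegrable (fun u : ℝ => u ^ j * G (y * u ^ 2)) MeasureTheory.volume 0 1 :=
    fun G hG j y hy => ContinuousOn.intervalIntegrable (by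
      rw [uIcc_of_le zero_le_one]; exact hcont G hG j y hy)
  refine (intervalIntegral.hasDerivAt_integral_of_dominated_loc_of_deriv_le
    (F := fun y u => u ^ m * g (y * u ^ 2))
    (F' := fun y u => u ^ (m + 2) * deriv g (y * u ^ 2)) (bound := fun _ => C)
    (isOpen_Ioo.mem_nhds hxb') ?_ (hmeas g hgc m x hxb')
    (hmeas _ hg' (m + 2) x hxb').aestronglyMeasurable_restrict_uIoc ?_ (by simp) ?_).2
  · filter_upwards [isOpen_Ioo.mem_nhds hxb'] with y hy
    exact (hmeas g hgc m y hy).aestronglyMeasurable_restrict_uIoc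
  · refine Eventually.of_forall fun u hu y hy => ?_
    rw [uIoc_of_le zero_le_one] at hu
    have hu' : u ∈ Icc (0 : ℝ) 1 := ⟨hu.1.le, hu.2⟩
    have h1 : ‖u ^ (m + 2)‖ ≤ 1 := by
      rw [norm_pow, Real.norm_of_nonneg hu'.1]; exact pow_le_one₀ hu'.1 hu'.2
    have h2 := mul_sq_mem_Ioo (η := b) hy hu'
    have h3 := hC (y * u ^ 2) ⟨h2.1.le, h2.2.le⟩
    rw [norm_mul]
    calc _ ≤ 1 * C := mul_le_mul h1 h3 (norm_nonneg _) zero_le_one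
      _ = C := one_mul C
  · refine Eventually.of_forall fun u hu y hy => ?_
    rw [uIoc_of_le zero_le_one] at hu
    have hu' : u ∈ Icc (0 : ℝ) 1 := ⟨hu.1.le, hu.2⟩
    have hd : HasDerivAt g (deriv g (y * u ^ 2)) (y * u ^ 2) :=
      ((hg.differentiableOn one_ne_zero).differentiableAt
        (isOpen_Ioo.mem_nhds (hmaps y hy hu'))).hasDerivAt
    have := (hd.comp y ((hasDerivAt_id y).mul_const (u ^ 2))).const_mul (u ^ m)
    refine this.congr_deriv ?_
    ring

/-- Differentiation under the integral raises `m`, hence the induction over all `m` and `g`. -/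
theorem contDiffOn_eulerMean {η : ℝ} {g : ℝ → ℝ} (hg : ContDiffOn ℝ ∞ g (Ioo (-η) η)) (m : ℕ) :
    ContDiffOn ℝ ∞ (eulerMean m g) (Ioo (-η) η) := by
  rw [contDiffOn_infty]
  intro j
  induction j generalizing g m with
  | zero =>
    rw [Nat.cast_zero, contDiffOn_zero]
    exact fun x hx => (hasDerivAt_eulerMean (hg.of_le (by norm_cast)) m
      hx).continuousAt.continuousWithinAt
  | succ j ih =>
    have h1 : ContDiffOn ℝ 1 g (Ioo (-η) η) := hg.of_le (by norm_cast)
    have h2 := ((contDiffOn_infty_iff_deriv_of_isOpen isOpen_Ioo).1 hg).2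
    push_cast
    rw [contDiffOn_succ_iff_deriv_of_isOpen isOpen_Ioo]
    refine ⟨fun x hx => (hasDerivAt_eulerMean h1 m hx).differentiableAt.differentiableWithinAt,
      by simp, (ih h2 (m + 2)).congr fun x hx => (hasDerivAt_eulerMean h1 m hx).deriv⟩

theorem eulerMean_ode {η : ℝ} {g : ℝ → ℝ} (hg : ContDiffOn ℝ 1 g (Ioo (-η) η)) (m : ℕ)
    {x : ℝ} (hx : x ∈ Ioo (-η) η) :
    2 * x * deriv (eulerMean m g) x + (m + 1) * eulerMean m g x = g x := by
  rw [(hasDerivAt_eulerMean hg m hx).deriv]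
  have hg' : ContinuousOn (deriv g) (Ioo (-η) η) :=
    hg.continuousOn_deriv_of_isOpen isOpen_Ioo le_rfl
  have hcont : ∀ (G : ℝ → ℝ), ContinuousOn G (Ioo (-η) η) → ∀ (j : ℕ),
      IntervalIntegrable (fun u : ℝ => u ^ j * G (x * u ^ 2)) MeasureTheory.volume 0 1 :=
    fun G hG j => ContinuousOn.intervalIntegrable (by
      rw [uIcc_of_le zero_le_one]
      exact (by fun_prop : ContinuousOn (fun u : ℝ => u ^ j) (Icc 0 1)).mul
        (hG.comp (by fun_prop) fun u hu => mul_sq_mem_Ioo hx hu))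
  have i1 := hcont g hg.continuousOn m
  have i2 := hcont _ hg' (m + 2)
  -- the integrand is the derivative of `u ^ (m + 1) * g (x * u ^ 2)`
  have key := intervalIntegral.integral_eq_sub_of_hasDerivAt
    (f := fun u => u ^ (m + 1) * g (x * u ^ 2))
    (f' := fun u => 2 * x * (u ^ (m + 2) * deriv g (x * u ^ 2))
      + (m + 1) * (u ^ m * g (x * u ^ 2))) (a := 0) (b := 1) (fun u hu => by
      rw [uIcc_of_le zero_le_one] at hu
      have hd : HasDerivAt g (deriv g (x * u ^ 2)) (x * u ^ 2) :=
        ((hg.differentiableOn one_ne_zero).differentiableAt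
          (isOpen_Ioo.mem_nhds (mul_sq_mem_Ioo hx hu))).hasDerivAt
      have h3 := (hasDerivAt_pow (m + 1) u).mul
        (hd.comp u (((hasDerivAt_pow 2 u).const_mul x)))
      refine h3.congr_deriv ?_
      simp
      ring) ((i2.const_mul _).add (i1.const_mul _))
  rw [intervalIntegral.integral_add (i2.const_mul _) (i1.const_mul _),
    intervalIntegral.integral_const_mul, intervalIntegral.integral_const_mul] at key
  unfold eulerMean
  rw [key]
  simp

/-- Integrating a power series term by term. -/
theorem analyticAt_eulerMean {g : ℝ → ℝ} (hg : AnalyticAt ℝ g 0) (m : ℕ) :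
    AnalyticAt ℝ (eulerMean m g) 0 := by
  obtain ⟨p, r, hp⟩ := hg
  obtain ⟨r', hr0, hr'⟩ := ENNReal.lt_iff_exists_nnreal_btwn.1 hp.r_pos
  have hr0' : 0 < r' := by exact_mod_cast hr0
  obtain ⟨C, hC, hpC⟩ := p.norm_mul_pow_le_of_lt_radius (lt_of_lt_of_le hr' hp.r_le)
  set b : ℕ → ℝ := fun i => p.coeff i / (m + 2 * i + 1) with hb
  have hpos : ∀ i : ℕ, (1 : ℝ) ≤ m + 2 * i + 1 := fun i => by
    have : (0 : ℝ) ≤ m := by positivity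
    have : (0 : ℝ) ≤ i := by positivity
    linarith
  have hpc : ∀ i, |p.coeff i| * (r' : ℝ) ^ i ≤ C := fun i => by
    have := hpC i
    rwa [FormalMultilinearSeries.norm_apply_eq_norm_coef, Real.norm_eq_abs] at this
  have hbc : ∀ i, |b i| ≤ |p.coeff i| := fun i => by
    rw [hb]; simp only [abs_div]
    rw [abs_of_pos (lt_of_lt_of_le one_pos (hpos i))]
    exact div_le_self (abs_nonneg _) (hpos i)
  refine ⟨FormalMultilinearSeries.ofScalars ℝ b, r', ?_, by exact_mod_cast hr0', ?_⟩
  · refine FormalMultilinearSeries.le_radius_of_bound _ C fun i => ?_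
    refine le_trans ?_ (hpc i)
    gcongr
    rw [FormalMultilinearSeries.norm_apply_eq_norm_coef, FormalMultilinearSeries.coeff_ofScalars,
      Real.norm_eq_abs]
    exact hbc i
  · intro y hy
    have hy' : |y| < r' := by
      simpa [edist_dist, Real.dist_eq, ENNReal.ofReal_lt_coe_iff] using hy
    rw [zero_add]
    have hsum : Summable fun i => |p.coeff i| * |y| ^ i := by
      refine Summable.of_nonneg_of_le (fun i => by positivity) (fun i => ?_)
        ((summable_geometric_of_lt_one (r := |y| / r') (by positivity)
          ((div_lt_one (NNReal.coe_pos.2 hr0')).2 hy')).mul_left C)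
      have h1 := hpc i
      have h2 : |y| ^ i = (r' : ℝ) ^ i * (|y| / r') ^ i := by
        rw [div_pow]; field_simp
      rw [h2, ← mul_assoc]
      gcongr
    have hseries : ∀ u ∈ Icc (0 : ℝ) 1, HasSum (fun i => u ^ m * (p.coeff i * (y * u ^ 2) ^ i))
        (u ^ m * g (y * u ^ 2)) := fun u hu => by
      refine HasSum.mul_left _ ?_
      have h1 : |y * u ^ 2| < r' := abs_lt.2 (mul_sq_mem_Ioo (abs_lt.1 hy') hu)
      have := hp.hasSum (y := y * u ^ 2) (by
        refine lt_trans ?_ hr'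
        rw [edist_dist, ENNReal.ofReal_lt_coe_iff dist_nonneg, Real.dist_eq, sub_zero]
        exact h1)
      simpa [FormalMultilinearSeries.apply_eq_pow_smul_coeff, mul_comm] using this
    have key := intervalIntegral.hasSum_integral_of_dominated_convergence
      (μ := MeasureTheory.volume) (a := 0) (b := 1)
      (F := fun (i : ℕ) (u : ℝ) => u ^ m * (p.coeff i * (y * u ^ 2) ^ i))
      (f := fun u => u ^ m * g (y * u ^ 2)) (fun i _ => |p.coeff i| * |y| ^ i)
      (fun i => (by fun_prop : Continuous _).aestronglyMeasurable)
      (fun i => Eventually.of_forall fun u hu => by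
        rw [uIoc_of_le zero_le_one] at hu
        rw [Real.norm_eq_abs, abs_mul, abs_mul, abs_pow, abs_pow, abs_mul, abs_pow,
          abs_of_pos hu.1]
        have h1 : u ^ m ≤ 1 := pow_le_one₀ hu.1.le hu.2
        have h2 : (|y| * u ^ 2) ^ i ≤ |y| ^ i := by
          gcongr
          exact mul_le_of_le_one_right (abs_nonneg y) (pow_le_one₀ hu.1.le hu.2)
        calc _ ≤ 1 * (|p.coeff i| * |y| ^ i) := by gcongr
          _ = _ := one_mul _)
      (Eventually.of_forall fun u _ => hsum) (by simp)
      (Eventually.of_forall fun u hu => by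
        rw [uIoc_of_le zero_le_one] at hu
        exact hseries u ⟨hu.1.le, hu.2⟩)
    unfold eulerMean
    convert key using 1
    funext i
    have h1 : (m : ℝ) + 2 * i + 1 ≠ 0 := (lt_of_lt_of_le one_pos (hpos i)).ne'
    have h2 : ∀ u : ℝ, u ^ m * (p.coeff i * (y * u ^ 2) ^ i)
        = p.coeff i * y ^ i * u ^ (m + 2 * i) := fun u => by
      rw [mul_pow, ← pow_mul, pow_add]; ring
    simp only [h2]
    rw [intervalIntegral.integral_const_mul, integral_pow]
    simp only [FormalMultilinearSeries.apply_eq_pow_smul_coeff,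
      FormalMultilinearSeries.coeff_ofScalars, hb]
    simp
    ring

/-- For `m ∈ ℕ` the equation `x Q' + ½ (m + 1) Q = g`, singular at `x = 0`, has a solution which is
as regular at `x = 0` as `g`. For `m = 1` the left-hand side is `(x Q)'`; for `m = 0` it is
`√x (√x Q)'`. -/
theorem exists_regular_solution {n : WithTop ℕ∞} (hn : n = ∞ ∨ n = ω) {η : ℝ} (hη : 0 < η)
    {g : ℝ → ℝ} (hg : ContDiffOn ℝ n g (Ioo (-η) η)) (m : ℕ) :
    ∃ (η' : ℝ) (Q : ℝ → ℝ), 0 < η' ∧ η' ≤ η ∧ ContDiffOn ℝ n Q (Ioo (-η') η') ∧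
      ∀ x ∈ Ioo (-η') η', x * deriv Q x + (m + 1) / 2 * Q x = g x := by
  have hone : (1 : WithTop ℕ∞) ≤ n := by rcases hn with rfl | rfl <;> simp
  have hd : ∀ x ∈ Ioo (-η) η, HasDerivAt (eulerMean m g) (deriv (eulerMean m g) x) x := fun x hx =>
    (hasDerivAt_eulerMean (hg.of_le hone) m hx).differentiableAt.hasDerivAt
  have hode : ∀ x ∈ Ioo (-η) η, x * deriv (fun y => 2 * eulerMean m g y) x
      + (m + 1) / 2 * (2 * eulerMean m g x) = g x := fun x hx => by
    rw [((hd x hx).const_mul 2).deriv, ← eulerMean_ode (hg.of_le hone) m hx]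
    ring
  rcases hn with rfl | rfl
  · exact ⟨η, _, hη, le_rfl, contDiffOn_const.mul (contDiffOn_eulerMean hg m), hode⟩
  · have h0 : (0 : ℝ) ∈ Ioo (-η) η := ⟨by linarith, hη⟩
    have hg0 : AnalyticAt ℝ g 0 := (hg.contDiffAt (isOpen_Ioo.mem_nhds h0)).analyticAt
    have h1 := (analyticAt_eulerMean hg0 m).eventually_analyticAt
    obtain ⟨η', hη', hball⟩ := Metric.eventually_nhds_iff_ball.1 h1
    rw [Real.ball_zero_eq_Ioo] at hball
    refine ⟨min η' η, _, lt_min hη' hη, min_le_right _ _, ?_, fun x hx => hode x ⟨?_, ?_⟩⟩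
    · refine contDiffOn_const.mul fun x hx => (hball x ⟨?_, ?_⟩).contDiffAt.contDiffWithinAt
      · linarith [hx.1, min_le_left η' η]
      · linarith [hx.2, min_le_left η' η]
    · linarith [hx.1, min_le_right η' η]
    · linarith [hx.2, min_le_right η' η]

/-! ### Regular local inverses -/

/-- The inverse function theorem on intervals around `0`, for a function fixing `0` with positive
derivative there. -/
theorem exists_regular_inverse {n : WithTop ℕ∞} (hn : n = ∞ ∨ n = ω) {η : ℝ} (hη : 0 < η)
    {S : ℝ → ℝ} (hS : ContDiffOn ℝ n S (Ioo (-η) η)) (hS0 : S 0 = 0) (hS' : 0 < deriv S 0) :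
    ∃ (δ σ : ℝ) (R : ℝ → ℝ), 0 < δ ∧ δ ≤ η ∧ 0 < σ ∧ ContDiffOn ℝ n R (Ioo (-σ) σ) ∧ R 0 = 0 ∧
      (∀ x ∈ Ioo (-δ) δ, 0 < deriv S x ∧ S x ∈ Ioo (-σ) σ ∧ R (S x) = x) ∧
      (∀ x ∈ Ioo 0 δ, 0 < S x) ∧
      (∀ s ∈ Ioo (-σ) σ, R s ∈ Ioo (-η) η ∧ 0 < deriv S (R s) ∧ S (R s) = s) ∧
      (∀ s ∈ Ioo 0 σ, 0 < R s) := by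
  have hone : (1 : WithTop ℕ∞) ≤ n := by rcases hn with rfl | rfl <;> simp
  have hn0 : n ≠ 0 := by rcases hn with rfl | rfl <;> simp
  have hz : ∀ {a : ℝ}, 0 < a → (0 : ℝ) ∈ Ioo (-a) a := fun ha => ⟨by linarith, ha⟩
  have hsmall : ∀ {p : ℝ → Prop}, (∀ᶠ x in 𝓝 (0 : ℝ), p x) → ∃ a > 0, ∀ x ∈ Ioo (-a) a, p x :=
    fun hp => by
      obtain ⟨a, ha, h⟩ := Metric.eventually_nhds_iff_ball.1 hp
      rw [Real.ball_zero_eq_Ioo] at h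
      exact ⟨a, ha, h⟩
  have hat : ∀ x ∈ Ioo (-η) η, ContDiffAt ℝ n S x := fun x hx =>
    hS.contDiffAt (isOpen_Ioo.mem_nhds hx)
  have hder : ∀ x ∈ Ioo (-η) η, HasDerivAt S (deriv S x) x := fun x hx =>
    ((hat x hx).differentiableAt hn0).hasDerivAt
  have hdc : ContinuousAt (deriv S) 0 := (hS.continuousOn_deriv_of_isOpen isOpen_Ioo
    hone).continuousAt (isOpen_Ioo.mem_nhds (hz hη))
  have hfd := (hder 0 (hz hη)).hasFDerivAt_equiv hS'.ne'
  set e := (hat 0 (hz hη)).toOpenPartialHomeomorph S hfd hn0 with he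
  have heS : ∀ x, e x = S x := fun x => rfl
  have h0s : (0 : ℝ) ∈ e.source := ContDiffAt.mem_toOpenPartialHomeomorph_source _ _ _
  have h0t : (0 : ℝ) ∈ e.target := by
    have := e.map_source h0s
    rwa [heS, hS0] at this
  have hsymm0 : e.symm 0 = 0 := by
    have := e.left_inv h0s
    rwa [heS, hS0] at this
  obtain ⟨η₁, hη₁, h1⟩ := hsmall (((hdc.eventually (lt_mem_nhds hS')).and
    (isOpen_Ioo.mem_nhds (hz hη))).and (e.open_source.mem_nhds h0s))
  have hsc : ContinuousAt e.symm 0 := e.continuousAt_symm h0t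
  have hnear : ∀ᶠ s in 𝓝 (0 : ℝ), e.symm s ∈ Ioo (-η₁) η₁ :=
    hsc.eventually_mem (by rw [hsymm0]; exact isOpen_Ioo.mem_nhds (hz hη₁))
  obtain ⟨σ, hσ, h2⟩ := hsmall (hnear.and (e.open_target.mem_nhds h0t))
  have hSc : ∀ᶠ x in 𝓝 (0 : ℝ), S x ∈ Ioo (-σ) σ :=
    (hat 0 (hz hη)).continuousAt.eventually_mem (by rw [hS0]; exact isOpen_Ioo.mem_nhds (hz hσ))
  obtain ⟨δ, hδ, h3⟩ := hsmall (hSc.and (isOpen_Ioo.mem_nhds (hz hη₁)))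
  have hmono : StrictMonoOn S (Ioo (-η₁) η₁) := by
    refine strictMonoOn_of_deriv_pos (convex_Ioo _ _)
      (fun x hx => (hat x (h1 x hx).1.2).continuousAt.continuousWithinAt) fun x hx => ?_
    rw [interior_Ioo] at hx
    exact (h1 x hx).1.1
  have hinv : ∀ s ∈ Ioo (-σ) σ, S (e.symm s) = s := fun s hs => e.right_inv (h2 s hs).2
  have hle : min δ η ≤ δ := min_le_left _ _
  refine ⟨min δ η, σ, e.symm, lt_min hδ hη, min_le_right _ _, hσ, fun s hs => ?_, hsymm0,
    fun x hx => ?_, fun x hx => ?_, fun s hs => ?_, fun s hs => ?_⟩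
  · have h4 := h1 _ (h2 s hs).1
    exact (e.contDiffAt_symm_deriv h4.1.1.ne' (h2 s hs).2 (hder _ h4.1.2)
      (hat _ h4.1.2)).contDiffWithinAt
  · have h4 := h3 x ⟨by linarith [hx.1], by linarith [hx.2]⟩
    exact ⟨(h1 x h4.2).1.1, h4.1, e.left_inv (h1 x h4.2).2⟩
  · have h4 := h3 x ⟨by linarith [hx.1], by linarith [hx.2]⟩
    have := hmono (hz hη₁) h4.2 hx.1
    rwa [hS0] at this
  · have h4 := h1 _ (h2 s hs).1
    exact ⟨h4.1.2, h4.1.1, hinv s hs⟩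
  · have h4 : s ∈ Ioo (-σ) σ := ⟨by linarith [hs.1], hs.2⟩
    rw [← hmono.lt_iff_lt (hz hη₁) (h2 s h4).1, hS0, hinv s h4]
    exact hs.1

/-- Hadamard's lemma: a function vanishing at `0` is `x` times a function of the same regularity. -/
theorem exists_regular_quotient {n : WithTop ℕ∞} (hn : n = ∞ ∨ n = ω) {η : ℝ} (hη : 0 < η)
    {F : ℝ → ℝ} (hF : ContDiffOn ℝ n F (Ioo (-η) η)) (hF0 : F 0 = 0) :
    ∃ (η' : ℝ) (Q : ℝ → ℝ), 0 < η' ∧ η' ≤ η ∧ ContDiffOn ℝ n Q (Ioo (-η') η') ∧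
      Q 0 = deriv F 0 ∧ ∀ x ∈ Ioo (-η') η', F x = x * Q x := by
  have hsucc : n + 1 ≤ n := by rcases hn with rfl | rfl <;> simp
  have hn0 : n ≠ 0 := by rcases hn with rfl | rfl <;> simp
  obtain ⟨η', Q, hη', hle, hQ, hode⟩ :=
    exists_regular_solution hn hη (hF.deriv_of_isOpen isOpen_Ioo hsucc) 1
  have h0 : (0 : ℝ) ∈ Ioo (-η') η' := ⟨by linarith, hη'⟩
  have hsub : Ioo (-η') η' ⊆ Ioo (-η) η := Ioo_subset_Ioo (by linarith) hle
  have hd : ∀ x ∈ Ioo (-η') η', HasDerivAt (fun y => F y - y * Q y) 0 x := fun x hx => by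
    have hxn := isOpen_Ioo.mem_nhds hx
    have h1 : HasDerivAt Q (deriv Q x) x := ((hQ.contDiffAt hxn).differentiableAt hn0).hasDerivAt
    have h2 : HasDerivAt F (deriv F x) x :=
      (((hF.mono hsub).contDiffAt hxn).differentiableAt hn0).hasDerivAt
    refine (h2.sub ((hasDerivAt_id x).mul h1)).congr_deriv ?_
    rw [← hode x hx]
    simp
    ring
  refine ⟨η', Q, hη', hle, hQ, ?_, fun x hx => ?_⟩
  · have := hode 0 h0
    norm_num at this
    exact this
  · have := (convex_Ioo (-η') η').is_const_of_fderivWithin_eq_zero (𝕜 := ℝ)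
      (f := fun y => F y - y * Q y)
      (fun y hy => (hd y hy).differentiableAt.differentiableWithinAt) (fun y hy => by
        rw [fderivWithin_of_isOpen isOpen_Ioo hy]
        ext
        simp [(hd y hy).hasFDerivAt.fderiv]) hx h0
    simp only [hF0, zero_mul, sub_zero] at this
    linarith

/-! ### Invariant tensors -/

/-- The components of the symmetric tensor `N dx² + 2 M dx σ₃ + A (σ₁² + σ₂²) + C σ₃²`. -/
def blockMat (N M A C : ℝ) : Matrix (Fin 4) (Fin 4) ℝ :=
  !![N, 0, 0, M; 0, A, 0, 0; 0, 0, A, 0; M, 0, 0, C]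

/-- The components of the 2-form `b dx ∧ σ₃ - q σ₁ ∧ σ₂`. -/
def formMat (b q : ℝ) : Matrix (Fin 4) (Fin 4) ℝ :=
  !![0, 0, 0, b; 0, 0, -q, 0; 0, q, 0, 0; -b, 0, 0, 0]

theorem isOpen_region (x₁ : ℝ) : IsOpen (region x₁) := by
  unfold region
  simp only [ofPred_and]
  exact (isOpen_lt (by fun_prop) (by fun_prop)).inter ((isOpen_lt (by fun_prop) (by fun_prop)).inter
    ((isOpen_lt (by fun_prop) (by fun_prop)).inter (isOpen_lt (by fun_prop) (by fun_prop))))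

theorem mem_region_coord {x₁ : ℝ} {p : Base} (hp : p ∈ region x₁) : p 0 ∈ Ioo 0 x₁ :=
  ⟨hp.1, hp.2.1⟩

theorem sin_pos_of_mem_region {x₁ : ℝ} {p : Base} (hp : p ∈ region x₁) : 0 < Real.sin (p 1) :=
  Real.sin_pos_of_pos_of_lt_pi hp.2.2.1 hp.2.2.2

theorem equator_mem_region {x₁ x : ℝ} (hx : x ∈ Ioo 0 x₁) :
    (![x, Real.pi / 2, 0, 0] : Base) ∈ region x₁ :=
  ⟨hx.1, hx.2, by simp [Real.pi_pos], by simp [Real.pi_pos]⟩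

theorem frame_zero_coord (a : Fin 4) (p : Base) : frame a p 0 = if a = 0 then 1 else 0 := by
  fin_cases a <;> simp [frame]

theorem hasFDerivAt_radial {D : Set Base} (hD : IsOpen D) {p : Base} (hp : p ∈ D) {F : Base → ℝ}
    {g : ℝ → ℝ} {g' : ℝ} (hF : ∀ q ∈ D, F q = g (q 0)) (hg : HasDerivAt g g' (p 0)) :
    HasFDerivAt F (g' • (ContinuousLinearMap.proj 0 : Base →L[ℝ] ℝ)) p := by
  have h0 : HasFDerivAt (fun q : Base => q 0) (ContinuousLinearMap.proj 0 : Base →L[ℝ] ℝ) p :=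
    (ContinuousLinearMap.proj (R := ℝ) (φ := fun _ : Fin 4 => ℝ) 0).hasFDerivAt
  have h := hg.comp_hasFDerivAt p h0
  exact h.congr_of_eventuallyEq (by filter_upwards [hD.mem_nhds hp] with q hq using hF q hq)

/-- A function of `x` has frame derivatives `(g', 0, 0, 0)`. -/
theorem der_radial {D : Set Base} (hD : IsOpen D) {p : Base} (hp : p ∈ D) {F : Base → ℝ}
    {g : ℝ → ℝ} {g' : ℝ} (hF : ∀ q ∈ D, F q = g (q 0)) (hg : HasDerivAt g g' (p 0)) (a : Fin 4) :
    der a F p = if a = 0 then g' else 0 := by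
  rw [der, (hasFDerivAt_radial hD hp hF hg).fderiv]
  simp [frame_zero_coord]

/-- The exterior derivative of `w₀(x) dx + w(x) σ₃`. -/
theorem ext1_radial {D : Set Base} (hD : IsOpen D) {p : Base} (hp : p ∈ D) {om : OneForm}
    {w₀ w : ℝ → ℝ} {w₀' w' : ℝ} (hom : ∀ q ∈ D, om q = ![w₀ (q 0), 0, 0, w (q 0)])
    (hw₀ : HasDerivAt w₀ w₀' (p 0)) (hw : HasDerivAt w w' (p 0)) :
    ext1 om p = formMat w' (w (p 0)) := by
  have h : ∀ a b, der a (fun q => om q b) p =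
      if a = 0 then (![w₀', 0, 0, w'] : Fin 4 → ℝ) b else 0 := by
    intro a b
    fin_cases b
    · exact der_radial hD hp (fun q hq => by simp [hom q hq]) hw₀ a
    · exact der_radial hD hp (g := fun _ => 0)
        (fun q hq => by simp [hom q hq]) (hasDerivAt_const _ _) a
    · exact der_radial hD hp (g := fun _ => 0)
        (fun q hq => by simp [hom q hq]) (hasDerivAt_const _ _) a
    · exact der_radial hD hp (fun q hq => by simp [hom q hq]) hw a
  ext a b
  simp only [ext1, Matrix.of_apply, h, hom p hp, Fin.sum_univ_four]
  fin_cases a <;> fin_cases b <;> simp [formMat, strucConst]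

theorem ext1_sigma3Form {w : ℝ → ℝ} {w' : ℝ} {p : Base} (hw : HasDerivAt w w' (p 0)) :
    ext1 (sigma3Form w) p = formMat w' (w (p 0)) :=
  ext1_radial isOpen_univ (mem_univ p) (w₀ := fun _ => 0) (fun _ _ => rfl) (hasDerivAt_const _ _) hw

theorem blockMat_inv {N M A C : ℝ} (hA : A ≠ 0) (hdet : N * C - M ^ 2 ≠ 0) :
    (blockMat N M A C)⁻¹ = blockMat (C / (N * C - M ^ 2)) (-M / (N * C - M ^ 2)) A⁻¹
      (N / (N * C - M ^ 2)) := by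
  refine Matrix.inv_eq_right_inv ?_
  ext i j
  rw [Matrix.mul_apply, Fin.sum_univ_four]
  fin_cases i <;> fin_cases j <;> simp [blockMat, hA] <;> field_simp <;> ring

/-- Forms `b dx ∧ σ₃ - q σ₁ ∧ σ₂` are closed under raising of indices by a block metric. -/
theorem raise_formMat {h B : TwoTensor} {p : Base} {N M A C b q : ℝ}
    (hh : h p = blockMat N M A C) (hB : B p = formMat b q) (hA : A ≠ 0)
    (hdet : N * C - M ^ 2 ≠ 0) (i j : Fin 4) :
    raise h B p i j = formMat (b / (N * C - M ^ 2)) (q / A ^ 2) i j := by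
  simp only [raise, hh, hB, blockMat_inv hA hdet, Fin.sum_univ_four]
  obtain ⟨D, hD⟩ : ∃ D, D = N * C - M ^ 2 := ⟨_, rfl⟩
  rw [← hD] at hdet ⊢
  fin_cases i <;> fin_cases j <;> simp [blockMat, formMat] <;> field_simp <;>
    first
    | ring1
    | linear_combination -b * hD
    | linear_combination b * hD

/-! ### Curvature of an invariant metric -/

/-- The connection coefficients of `N dx² + 2 M dx σ₃ + A (σ₁² + σ₂²) + C σ₃²`, in terms of the
coefficients of the metric and their derivatives `N', M', A', C'`. -/
def blockConn (N M A C N' M' A' C' : ℝ) (d a b : Fin 4) : ℝ :=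
  ∑ c, blockMat (C / (N * C - M ^ 2)) (-M / (N * C - M ^ 2)) A⁻¹ (N / (N * C - M ^ 2)) d c *
    ((1 / 2) * ((if a = 0 then blockMat N' M' A' C' b c else 0)
      + (if b = 0 then blockMat N' M' A' C' a c else 0)
      - (if c = 0 then blockMat N' M' A' C' a b else 0)
      + ∑ d, (strucConst a b d * blockMat N M A C d c - strucConst a c d * blockMat N M A C d b
        - strucConst b c d * blockMat N M A C d a)))

/-- Pairs of components related by the antisymmetry in the last two indices enter the Ricci form. -/
theorem riem_antisymm (h : TwoTensor) (p : Base) (d c a b : Fin 4) :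
    riem h p d c a b = -riem h p d c b a := by
  have hs : ∀ e, strucConst a b e = -strucConst b a e := by
    intro e
    fin_cases a <;> fin_cases b <;> fin_cases e <;> simp [strucConst]
  simp only [riem, hs, Fin.sum_univ_four]
  ring

/-- A metric `N dx² + 2 M dx σ₃ + A (σ₁² + σ₂²) + C σ₃²` on `region x₁`, non-degenerate and with
differentiable coefficients. -/
structure IsBlockMetric (x₁ : ℝ) (h : TwoTensor) (N M A C N' M' A' C' : ℝ → ℝ) : Prop where
  eq : ∀ p ∈ region x₁, h p = blockMat (N (p 0)) (M (p 0)) (A (p 0)) (C (p 0))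
  derivN : ∀ x ∈ Ioo 0 x₁, HasDerivAt N (N' x) x
  derivM : ∀ x ∈ Ioo 0 x₁, HasDerivAt M (M' x) x
  derivA : ∀ x ∈ Ioo 0 x₁, HasDerivAt A (A' x) x
  derivC : ∀ x ∈ Ioo 0 x₁, HasDerivAt C (C' x) x
  A_ne : ∀ x ∈ Ioo 0 x₁, A x ≠ 0
  det_ne : ∀ x ∈ Ioo 0 x₁, N x * C x - M x ^ 2 ≠ 0

namespace IsBlockMetric

variable {x₁ : ℝ} {h : TwoTensor} {N M A C N' M' A' C' : ℝ → ℝ}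

theorem der_eq (H : IsBlockMetric x₁ h N M A C N' M' A' C') {p : Base} (hp : p ∈ region x₁)
    (a b c : Fin 4) : der a (fun q => h q b c) p =
      if a = 0 then blockMat (N' (p 0)) (M' (p 0)) (A' (p 0)) (C' (p 0)) b c else 0 := by
  have hx := mem_region_coord hp
  have key : ∀ {g : ℝ → ℝ} {g' : ℝ}, HasDerivAt g g' (p 0) →
      (∀ q ∈ region x₁, h q b c = g (q 0)) → der a (fun q => h q b c) p = if a = 0 then g' else 0 :=
    fun hg hF => der_radial (isOpen_region x₁) hp hF hg a
  refine key (g := fun x => blockMat (N x) (M x) (A x) (C x) b c) ?_ fun q hq => by rw [H.eq q hq]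
  fin_cases b <;> fin_cases c <;> simp only [blockMat] <;>
    first
    | exact hasDerivAt_const _ _
    | exact H.derivN _ hx
    | exact H.derivM _ hx
    | exact H.derivA _ hx
    | exact H.derivC _ hx

theorem conn_eq (H : IsBlockMetric x₁ h N M A C N' M' A' C') {p : Base} (hp : p ∈ region x₁)
    (d a b : Fin 4) : conn h p d a b = blockConn (N (p 0)) (M (p 0)) (A (p 0)) (C (p 0))
      (N' (p 0)) (M' (p 0)) (A' (p 0)) (C' (p 0)) d a b := by
  have hx := mem_region_coord hp
  simp only [conn, koszul, H.der_eq hp, blockConn]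
  rw [H.eq p hp, blockMat_inv (H.A_ne _ hx) (H.det_ne _ hx)]

/-- The connection coefficients are functions of `x`: `g` is a simplified expression for one of them
on `region x₁`, and `g'` its derivative. -/
theorem der_conn (H : IsBlockMetric x₁ h N M A C N' M' A' C') {p : Base} (hp : p ∈ region x₁)
    {g : ℝ → ℝ} {g' : ℝ} (hg : HasDerivAt g g' (p 0)) {d a b : Fin 4}
    (hc : ∀ x ∈ Ioo 0 x₁, blockConn (N x) (M x) (A x) (C x) (N' x) (M' x) (A' x) (C' x) d a b = g x)
    (c : Fin 4) :
    der c (fun q => conn h q d a b) p = if c = 0 then g' else 0 :=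
  der_radial (isOpen_region x₁) hp (fun q hq => by
    rw [H.conn_eq hq, hc _ (mem_region_coord hq)]) hg c

theorem riem_1_2_1_2 (H : IsBlockMetric x₁ h N M A C N' M' A' C') {p : Base}
    (hp : p ∈ region x₁) : riem h p 1 2 1 2 =
      1 - 3 * C (p 0) / (4 * A (p 0))
        - C (p 0) * A' (p 0) ^ 2 / (4 * A (p 0) * (N (p 0) * C (p 0) - M (p 0) ^ 2)) := by
  have hx := mem_region_coord hp
  have hA := H.A_ne _ hx
  have hdet := H.det_ne _ hx
  have h1 : der 1 (fun q => conn h q 1 2 2) p = 0 := by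
    rw [H.der_conn hp (hasDerivAt_const _ (0 : ℝ)) fun x hx => ?_]
    · simp
    · simp [blockConn, Fin.sum_univ_four, blockMat, strucConst]
  have h2 : der 2 (fun q => conn h q 1 1 2) p = 0 := by
    rw [H.der_conn hp (hasDerivAt_const _ (0 : ℝ)) fun x hx => ?_]
    · simp
    · simp [blockConn, Fin.sum_univ_four, blockMat, strucConst]
  simp only [riem, h1, h2, H.conn_eq hp]
  obtain ⟨D, hD⟩ : ∃ D, D = N (p 0) * C (p 0) - M (p 0) ^ 2 := ⟨_, rfl⟩
  simp only [blockConn, Fin.sum_univ_four]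
  rw [← hD] at hdet ⊢
  simp [blockMat, strucConst]
  field_simp
  rw [hD]
  ring

theorem riem_1_2_0_3 (H : IsBlockMetric x₁ h N M A C N' M' A' C') {p : Base}
    (hp : p ∈ region x₁) : riem h p 1 2 0 3 =
      (C' (p 0) * A (p 0) - C (p 0) * A' (p 0)) / (2 * A (p 0) ^ 2) := by
  have hx := mem_region_coord hp
  have hA := H.A_ne _ hx
  have hdet := H.det_ne _ hx
  have h1 : der 0 (fun q => conn h q 1 3 2) p
      = (C' (p 0) * A (p 0) - C (p 0) * A' (p 0)) / (2 * A (p 0) ^ 2) := by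
    rw [H.der_conn hp (g := fun x => C x / A x * (1 / 2) - 1)
      ((((H.derivC _ hx).div (H.derivA _ hx) hA).mul_const _).sub_const 1) fun x hx => ?_]
    · simp only [if_true]
      field_simp
    · have := H.A_ne _ hx
      simp [blockConn, Fin.sum_univ_four, blockMat, strucConst]
      field_simp
      ring
  have h2 : der 3 (fun q => conn h q 1 0 2) p = 0 := by
    rw [H.der_conn hp (g := fun x => M x / A x * (1 / 2))
      ((((H.derivM _ hx).div (H.derivA _ hx) hA).mul_const _)) fun x hx => ?_]
    · simp
    · have := H.A_ne _ hx
      simp [blockConn, Fin.sum_univ_four, blockMat, strucConst]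
      field_simp
  simp only [riem, h1, h2, H.conn_eq hp]
  simp only [blockConn, Fin.sum_univ_four]
  simp [blockMat, strucConst]
  ring

theorem riem_0_3_1_2 (H : IsBlockMetric x₁ h N (fun _ => 0) A C N' (fun _ => 0) A' C') {p : Base}
    (hp : p ∈ region x₁) : riem h p 0 3 1 2 =
      (C' (p 0) - C (p 0) * A' (p 0) / A (p 0)) / (2 * N (p 0)) := by
  have hx := mem_region_coord hp
  have hA := H.A_ne _ hx
  have hdet := H.det_ne _ hx
  have hN : N (p 0) ≠ 0 := fun h => hdet (by simp [h])
  have hC : C (p 0) ≠ 0 := fun h => hdet (by simp [h])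
  have h1 : der 1 (fun q => conn h q 0 2 3) p = 0 := by
    rw [H.der_conn hp (hasDerivAt_const _ (0 : ℝ)) fun x hx => ?_]
    · simp
    · simp [blockConn, Fin.sum_univ_four, blockMat, strucConst]
  have h2 : der 2 (fun q => conn h q 0 1 3) p = 0 := by
    rw [H.der_conn hp (hasDerivAt_const _ (0 : ℝ)) fun x hx => ?_]
    · simp
    · simp [blockConn, Fin.sum_univ_four, blockMat, strucConst]
  simp only [riem, h1, h2, H.conn_eq hp]
  simp only [blockConn, Fin.sum_univ_four]
  simp [blockMat, strucConst]
  field_simp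
  ring

theorem riem_0_3_0_3 (H : IsBlockMetric x₁ h N (fun _ => 0) A C N' (fun _ => 0) A' C') {p : Base}
    (hp : p ∈ region x₁) {c : ℝ} (hc : HasDerivAt C' c (p 0)) : riem h p 0 3 0 3 =
      (C' (p 0) ^ 2 / (2 * C (p 0)) + N' (p 0) * C' (p 0) / (2 * N (p 0)) - c) / (2 * N (p 0)) := by
  have hx := mem_region_coord hp
  have hA := H.A_ne _ hx
  have hdet := H.det_ne _ hx
  have hN : N (p 0) ≠ 0 := fun h => hdet (by simp [h])
  have hC : C (p 0) ≠ 0 := fun h => hdet (by simp [h])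
  have h1 : der 0 (fun q => conn h q 0 3 3) p
      = (c * N (p 0) - C' (p 0) * N' (p 0)) / N (p 0) ^ 2 * (-1 / 2) := by
    rw [H.der_conn hp (g := fun x => C' x / N x * (-1 / 2))
      ((hc.div (H.derivN _ hx) hN).mul_const _) fun x hx => ?_]
    · simp only [if_true]
    · have hdet := H.det_ne _ hx
      have hN : N x ≠ 0 := fun h => hdet (by simp [h])
      have hC : C x ≠ 0 := fun h => hdet (by simp [h])
      simp [blockConn, Fin.sum_univ_four, blockMat, strucConst]
      field_simp
  have h2 : der 3 (fun q => conn h q 0 0 3) p = 0 := by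
    rw [H.der_conn hp (hasDerivAt_const _ (0 : ℝ)) fun x hx => ?_]
    · simp
    · simp [blockConn, Fin.sum_univ_four, blockMat, strucConst]
  simp only [riem, h1, h2, H.conn_eq hp]
  simp only [blockConn, Fin.sum_univ_four]
  simp [blockMat, strucConst]
  field_simp
  ring

theorem ricciForm_1_2 (H : IsBlockMetric x₁ h N M A C N' M' A' C') {p : Base}
    (hp : p ∈ region x₁) {J : TwoTensor} {s : ℝ} (hJ : J p = formMat (s * A' (p 0)) (s * A (p 0)))
    (hdet' : N (p 0) * C (p 0) - M (p 0) ^ 2 = A' (p 0) ^ 2) :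
    ricciForm h J p 1 2
      = s * (C (p 0) / (2 * A (p 0)) + C' (p 0) / (2 * A' (p 0)) - 1) := by
  have hx := mem_region_coord hp
  have hA := H.A_ne _ hx
  have hdet := H.det_ne _ hx
  have hA' : A' (p 0) ≠ 0 := fun h => hdet (by rw [hdet', h]; norm_num)
  simp only [ricciForm, Matrix.of_apply, raise_formMat (H.eq p hp) hJ hA hdet, Fin.sum_univ_four,
    H.eq p hp]
  rw [riem_antisymm h p 1 2 2 1, riem_antisymm h p 1 2 3 0, H.riem_1_2_1_2 hp, H.riem_1_2_0_3 hp,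
    hdet']
  simp [blockMat, formMat]
  field_simp
  ring

theorem ricciForm_0_3 (H : IsBlockMetric x₁ h N (fun _ => 0) A C N' (fun _ => 0) A' C') {p : Base}
    (hp : p ∈ region x₁) {J : TwoTensor} {s : ℝ} (hJ : J p = formMat (s * A' (p 0)) (s * A (p 0)))
    (hdet' : N (p 0) * C (p 0) = A' (p 0) ^ 2) {c : ℝ} (hc : HasDerivAt C' c (p 0)) :
    ricciForm h J p 0 3 = s * (
      (C' (p 0) ^ 2 / (2 * C (p 0)) + N' (p 0) * C' (p 0) / (2 * N (p 0)) - c) / (2 * A' (p 0))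
      - (C' (p 0) - C (p 0) * A' (p 0) / A (p 0)) / (2 * A (p 0))) := by
  have hx := mem_region_coord hp
  have hA := H.A_ne _ hx
  have hdet := H.det_ne _ hx
  have hN : N (p 0) ≠ 0 := fun h => hdet (by simp [h])
  have hC : C (p 0) ≠ 0 := fun h => hdet (by simp [h])
  have hA' : A' (p 0) ≠ 0 := fun h => hdet (by rw [hdet', h]; norm_num)
  simp only [ricciForm, Matrix.of_apply, raise_formMat (H.eq p hp) hJ hA hdet, Fin.sum_univ_four,
    H.eq p hp]
  rw [riem_antisymm h p 0 3 2 1, riem_antisymm h p 0 3 3 0, H.riem_0_3_1_2 hp,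
    H.riem_0_3_0_3 hp hc, hdet']
  simp [blockMat, formMat]
  field_simp
  ring

end IsBlockMetric

/-! ### The supersymmetry constraints on an invariant solution -/

/-- Since `J` is anti-self-dual, the star exchanges the two blocks with a sign. -/
theorem star_formMat {h J B : TwoTensor} {p : Base} {N M A C b q A' s : ℝ} (hs : s ^ 2 = 1)
    (hh : h p = blockMat N M A C) (hJ : J p = formMat (s * A') (s * A)) (hB : B p = formMat b q)
    (hA : A ≠ 0) (hA' : A' ≠ 0) (hdet : N * C - M ^ 2 = A' ^ 2) :
    star h J B p 1 2 = A * b / A' ∧ star h J B p 0 3 = -(A' * q / A) := by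
  have hd : N * C - M ^ 2 ≠ 0 := by rw [hdet]; positivity
  simp only [star, volForm, Matrix.of_apply, raise_formMat hh hB hA hd, Fin.sum_univ_four, hJ, hdet]
  refine ⟨?_, ?_⟩ <;> simp [formMat] <;> field_simp <;> rw [hs] <;> ring

/-- The components along `σ₁ ∧ σ₂` and `dx ∧ σ₃` of the equation for `G⁺`, with the scalar curvature
eliminated by means of the equation for `f`. -/
theorem IsTimelikeSusy.Gplus_components {ℓ : ℝ} {D : Set Base} {f : Base → ℝ} {om : OneForm}
    {h J : TwoTensor} (hℓ : 0 < ℓ) (hsusy : IsTimelikeSusy ℓ D f om h J) {p : Base}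
    (hp : p ∈ D) {N M A C w' w A' s : ℝ} (hs : s ^ 2 = 1)
    (hh : h p = blockMat N M A C) (hJ : J p = formMat (s * A') (s * A))
    (hom : ext1 om p = formMat w' w) (hA : A ≠ 0) (hA' : A' ≠ 0)
    (hdet : N * C - M ^ 2 = A' ^ 2) :
    f p / 2 * (A * w' / A' - w) = -(ℓ / 2) * (ricciForm h J p 1 2 - s * (6 * A / (ℓ ^ 2 * f p))) ∧
    f p / 2 * (w' - A' * w / A)
      = -(ℓ / 2) * (ricciForm h J p 0 3 + s * (6 * A' / (ℓ ^ 2 * f p))) := by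
  have hf := hsusy.f_pos p hp
  have hR : scalarCurv h p = -(24 / (ℓ ^ 2 * f p)) := by
    have := hsusy.f_eq p hp
    field_simp at this ⊢
    linarith
  obtain ⟨h1, h2⟩ := star_formMat hs hh hJ hom hA hA' hdet
  have e := hsusy.Gplus_eq p hp
  have e12 := congrFun (congrFun e 1) 2
  have e03 := congrFun (congrFun e 0) 3
  simp only [Gplus, Matrix.smul_apply, Matrix.add_apply, Matrix.sub_apply, smul_eq_mul, hom, h1, h2,
    hJ, hR] at e12 e03
  simp [formMat] at e12 e03
  refine ⟨?_, ?_⟩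
  · linear_combination (exp := 1) e12
  · linear_combination (exp := 1) e03

/-- A compatible invariant 2-form `b dx ∧ σ₃ - q σ₁ ∧ σ₂` has the norm of the Kähler form on both
blocks. -/
theorem formMat_sq_of_almost_complex {N M A C b q : ℝ} (hA : A ≠ 0) (hdet : N * C - M ^ 2 ≠ 0)
    (h : ((blockMat N M A C)⁻¹ * formMat b q) * ((blockMat N M A C)⁻¹ * formMat b q) = -1) :
    b ^ 2 = N * C - M ^ 2 ∧ q ^ 2 = A ^ 2 := by
  rw [blockMat_inv hA hdet] at h
  have h0 := congrFun (congrFun h 0) 0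
  have h1 := congrFun (congrFun h 1) 1
  obtain ⟨D, hD⟩ : ∃ D, D = N * C - M ^ 2 := ⟨_, rfl⟩
  rw [← hD] at hdet h0 h1 ⊢
  simp only [Matrix.mul_apply, Fin.sum_univ_four] at h0 h1
  simp [blockMat, formMat] at h0 h1
  field_simp at h0 h1
  refine ⟨?_, by linarith⟩
  have : D * (b ^ 2 - D) = 0 := by
    rw [hD] at h0 ⊢
    linear_combination -h0
  rcases mul_eq_zero.1 this with h | h
  · exact absurd h hdet
  · linarith

/-! ### Charts adapted to the symmetry -/

theorem hasFDerivAt_baseChange {r χ : ℝ → ℝ} {r' χ' : ℝ} {p : Base} (hr : HasDerivAt r r' (p 0))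
    (hχ : HasDerivAt χ χ' (p 0)) (u : Base) :
    DifferentiableAt ℝ (baseChange r χ) p ∧
    fderiv ℝ (baseChange r χ) p u = ![r' * u 0, u 1, u 2, u 3 + χ' * u 0] := by
  have e (i : Fin 4) : HasFDerivAt (fun q : Base => q i)
      (ContinuousLinearMap.proj i : Base →L[ℝ] ℝ) p :=
    (ContinuousLinearMap.proj (R := ℝ) (φ := fun _ : Fin 4 => ℝ) i).hasFDerivAt
  have h0 := hr.comp_hasFDerivAt p (e 0)
  have h3 := (e 3).add (hχ.comp_hasFDerivAt p (e 0))
  have key : HasFDerivAt (baseChange r χ) (ContinuousLinearMap.pi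
      ![r' • (ContinuousLinearMap.proj 0 : Base →L[ℝ] ℝ), ContinuousLinearMap.proj 1,
        ContinuousLinearMap.proj 2,
        (ContinuousLinearMap.proj 3 : Base →L[ℝ] ℝ) + χ' • ContinuousLinearMap.proj 0]) p := by
    rw [hasFDerivAt_pi']
    intro i
    fin_cases i
    · exact h0
    · exact e 1
    · exact e 2
    · exact h3
  refine ⟨key.differentiableAt, ?_⟩
  rw [key.fderiv]
  ext i
  fin_cases i <;> simp

theorem fderiv_spacetimeChange {T r χ : ℝ → ℝ} {T' r' χ' : ℝ} {P : Spacetime}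
    (hT : HasDerivAt T T' (P.2 0)) (hr : HasDerivAt r r' (P.2 0)) (hχ : HasDerivAt χ χ' (P.2 0))
    (U : Spacetime) : fderiv ℝ (spacetimeChange T r χ) P U =
      (U.1 + T' * U.2 0, ![r' * U.2 0, U.2 1, U.2 2, U.2 3 + χ' * U.2 0]) := by
  have e : HasFDerivAt (fun Q : Spacetime => Q.2 0)
      ((ContinuousLinearMap.proj 0 : Base →L[ℝ] ℝ).comp (ContinuousLinearMap.snd ℝ ℝ Base)) P :=
    ((ContinuousLinearMap.proj 0 : Base →L[ℝ] ℝ).comp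
      (ContinuousLinearMap.snd ℝ ℝ Base)).hasFDerivAt
  have h1 := (hasFDerivAt_fst (𝕜 := ℝ) (p := P)).add (hT.comp_hasFDerivAt P e)
  have h2 := (hasFDerivAt_baseChange hr hχ U.2).1.hasFDerivAt.comp P
    (hasFDerivAt_snd (𝕜 := ℝ) (p := P))
  have h3 := h1.prodMk h2
  have h4 : fderiv ℝ (spacetimeChange T r χ) P = _ := h3.fderiv
  rw [h4, ← (hasFDerivAt_baseChange hr hχ U.2).2]
  simp

/-- The pull-back of the coframe under the shift `ψ ↦ ψ + χ`, which rotates `σ₁, σ₂`. -/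
theorem coframe_baseChange (r χ : ℝ → ℝ) (r' χ' : ℝ) (p u : Base) :
    coframe (baseChange r χ p) ![r' * u 0, u 1, u 2, u 3 + χ' * u 0] =
      ![r' * coframe p u 0,
        Real.cos (χ (p 0)) * coframe p u 1 + Real.sin (χ (p 0)) * coframe p u 2,
        Real.cos (χ (p 0)) * coframe p u 2 - Real.sin (χ (p 0)) * coframe p u 1,
        coframe p u 3 + χ' * coframe p u 0] := by
  ext i
  fin_cases i <;> simp [coframe, baseChange, Real.sin_add, Real.cos_add] <;> ring

/-- The pull-back of the supersymmetric metric in a standard chart, in the coframe of the Gaussian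
null coordinates. The rotation of `σ₁, σ₂` by `χ` drops out. -/
theorem timelikeMetric_spacetimeChange {T r χ : ℝ → ℝ} {T' r' χ' : ℝ} {P : Spacetime}
    (hT : HasDerivAt T T' (P.2 0)) (hr : HasDerivAt r r' (P.2 0)) (hχ : HasDerivAt χ χ' (P.2 0))
    (N A C f w : ℝ → ℝ) (U W : Spacetime) :
    timelikeMetric (fun p => f (p 0)) (sigma3Form w) (radialMetric N A C)
        (spacetimeChange T r χ P) (fderiv ℝ (spacetimeChange T r χ) P U)
        (fderiv ℝ (spacetimeChange T r χ) P W) =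
      let e := coframe P.2 U.2
      let e' := coframe P.2 W.2
      let x := r (P.2 0)
      (f x)⁻¹ * (N x * r' ^ 2 * (e 0 * e' 0) + A x * (e 1 * e' 1 + e 2 * e' 2)
          + C x * (e 3 + χ' * e 0) * (e' 3 + χ' * e' 0))
        - f x ^ 2 * (U.1 + T' * e 0 + w x * (e 3 + χ' * e 0))
          * (W.1 + T' * e' 0 + w x * (e' 3 + χ' * e' 0)) := by
  rw [fderiv_spacetimeChange hT hr hχ, fderiv_spacetimeChange hT hr hχ]
  have hsc := Real.sin_sq_add_cos_sq (χ (P.2 0))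
  simp only [timelikeMetric, spacetimeChange, eval1, eval2, coframe_baseChange, Fin.sum_univ_four]
  simp [sigma3Form, radialMetric, baseChange, Matrix.diagonal]
  have h0 : ∀ u : Base, coframe P.2 u 0 = u 0 := fun u => rfl
  simp only [h0]
  linear_combination ((f (r (P.2 0)))⁻¹ * A (r (P.2 0)) * (coframe P.2 U.2 1 * coframe P.2 W.2 1
    + coframe P.2 U.2 2 * coframe P.2 W.2 2)) * hsc

/-- Relations at `λ = x` between Gaussian null data `(Δ, k, γ)` and the functions
`(N, A, C, f, w)` of `r` of a standard chart with radial function `r`, whose derivative is `r'`. -/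
structure ChartRelations (Δ k₃ γ₁ γ₃ : ℝ) (x r r' : ℝ) (N A C f w : ℝ → ℝ) : Prop where
  f_eq : f r = x * Δ
  A_eq : A r = x * Δ * γ₁
  C_eq : C r = x * (Δ * (γ₃ + k₃ ^ 2 / Δ ^ 2))
  w_eq : w r = -(k₃ / (x * Δ ^ 2))
  N_eq : N r * r' ^ 2 = γ₃ / (x * (Δ * (γ₃ + k₃ ^ 2 / Δ ^ 2)))

theorem exists_smooth_primitive {δ : ℝ} {g : ℝ → ℝ} (hδ : 0 < δ)
    (hg : ContDiffOn ℝ ∞ g (Ioo 0 δ)) :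
    ∃ G : ℝ → ℝ, ContDiffOn ℝ ∞ G (Ioo 0 δ) ∧ ∀ x ∈ Ioo 0 δ, HasDerivAt G (g x) x := by
  have hd : ∀ x ∈ Ioo 0 δ, HasDerivAt (fun y => ∫ t in (δ / 2)..y, g t) (g x) x := fun x hx => by
    have hsub : uIcc (δ / 2) x ⊆ Ioo 0 δ :=
      (convex_Ioo 0 δ).ordConnected.uIcc_subset ⟨by linarith, by linarith⟩ hx
    refine intervalIntegral.integral_hasDerivAt_right
      ((hg.continuousOn.mono hsub).intervalIntegrable)
      (hg.continuousOn.stronglyMeasurableAtFilter isOpen_Ioo x hx)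
      (hg.continuousOn.continuousAt (isOpen_Ioo.mem_nhds hx))
  refine ⟨_, ?_, hd⟩
  rw [contDiffOn_infty_iff_deriv_of_isOpen isOpen_Ioo]
  exact ⟨fun x hx => (hd x hx).differentiableAt.differentiableWithinAt,
    hg.congr fun x hx => (hd x hx).deriv⟩

theorem gaussianNullMetric_diagonal {Δ : ℝ → ℝ} {k : Fin 3 → ℝ → ℝ}
    {γ : ℝ → Matrix (Fin 3) (Fin 3) ℝ} {P : Spacetime} {k₃ γ₁ γ₃ : ℝ}
    (hk : (fun i => k i (P.2 0)) = ![0, 0, k₃])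
    (hγ : γ (P.2 0) = Matrix.diagonal ![γ₁, γ₁, γ₃]) (U W : Spacetime) :
    gaussianNullMetric Δ k γ P U W =
      let e := coframe P.2 U.2
      let e' := coframe P.2 W.2
      let x := P.2 0
      (U.1 * e' 0 + W.1 * e 0) - x ^ 2 * Δ x ^ 2 * U.1 * W.1
        + x * k₃ * (e 3 * W.1 + e' 3 * U.1) + γ₁ * (e 1 * e' 1 + e 2 * e' 2)
        + γ₃ * e 3 * e' 3 := by
  have k0 := congrFun hk 0
  have k1 := congrFun hk 1
  have k2 := congrFun hk 2
  simp at k0 k1 k2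
  simp only [gaussianNullMetric, Fin.sum_univ_three, hγ, k0, k1, k2]
  have h0 : ∀ u : Base, u 0 = coframe P.2 u 0 := fun u => rfl
  rw [h0 U.2, h0 W.2]
  simp [Matrix.diagonal]
  ring

/-- The change of chart exists: the functions `T` and `χ` are found by quadrature. -/
theorem exists_standardChart {δ : ℝ} (hδ : 0 < δ) {Δ k₃ γ₁ γ₃ : ℝ → ℝ} {k : Fin 3 → ℝ → ℝ}
    {γ : ℝ → Matrix (Fin 3) (Fin 3) ℝ} {r N A C f w : ℝ → ℝ}
    (hk : ∀ x ∈ Ioo 0 δ, (fun i => k i x) = ![0, 0, k₃ x])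
    (hγ : ∀ x ∈ Ioo 0 δ, γ x = Matrix.diagonal ![γ₁ x, γ₁ x, γ₃ x])
    (hΔ : ∀ x ∈ Ioo 0 δ, 0 < Δ x) (hγ₃ : ∀ x ∈ Ioo 0 δ, 0 < γ₃ x)
    (sΔ : ContDiffOn ℝ ∞ Δ (Ioo 0 δ)) (sk : ContDiffOn ℝ ∞ k₃ (Ioo 0 δ))
    (sγ₃ : ContDiffOn ℝ ∞ γ₃ (Ioo 0 δ)) (sr : ContDiffOn ℝ ∞ r (Ioo 0 δ))
    (hr : ∀ x ∈ Ioo 0 δ, 0 < r x) (hr' : ∀ x ∈ Ioo 0 δ, deriv r x ≠ 0)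
    (hrel : ∀ x ∈ Ioo 0 δ,
      ChartRelations (Δ x) (k₃ x) (γ₁ x) (γ₃ x) x (r x) (deriv r x) N A C f w) :
    ∃ T χ, IsStandardChart δ Δ k γ T r χ N A C f w := by
  have sH : ContDiffOn ℝ ∞ (fun x => x * (Δ x * (γ₃ x + k₃ x ^ 2 / Δ x ^ 2))) (Ioo 0 δ) :=
    contDiffOn_id.mul (sΔ.mul (sγ₃.add ((sk.pow 2).div (sΔ.pow 2)
      fun x hx => (pow_pos (hΔ x hx) 2).ne')))
  have hH : ∀ x ∈ Ioo 0 δ, 0 < x * (Δ x * (γ₃ x + k₃ x ^ 2 / Δ x ^ 2)) := fun x hx => by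
    have h1 := hΔ x hx
    have h2 := hγ₃ x hx
    have h3 := hx.1
    positivity
  have sχ : ContDiffOn ℝ ∞ (fun x => k₃ x / Δ x / (x * (Δ x * (γ₃ x + k₃ x ^ 2 / Δ x ^ 2))))
      (Ioo 0 δ) := (sk.div sΔ fun x hx => (hΔ x hx).ne').div sH fun x hx => (hH x hx).ne'
  obtain ⟨χ, hχ, dχ⟩ := exists_smooth_primitive hδ sχ
  have sT : ContDiffOn ℝ ∞ (fun x => -(1 / (x * Δ x) ^ 2) + k₃ x / (x * Δ x ^ 2) *
      (k₃ x / Δ x / (x * (Δ x * (γ₃ x + k₃ x ^ 2 / Δ x ^ 2))))) (Ioo 0 δ) := by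
    refine ((contDiffOn_const.div ((contDiffOn_id.mul sΔ).pow 2) fun x hx => ?_).neg).add
      ((sk.div (contDiffOn_id.mul (sΔ.pow 2)) fun x hx => ?_).mul sχ)
    · exact (pow_pos (mul_pos hx.1 (hΔ x hx)) 2).ne'
    · exact (mul_pos hx.1 (pow_pos (hΔ x hx) 2)).ne'
  obtain ⟨T, hT, dT⟩ := exists_smooth_primitive hδ sT
  refine ⟨T, χ, hT, sr, hχ, hr, hr', fun P hP U W => ?_⟩
  have hx := mem_region_coord hP
  have dr : HasDerivAt r (deriv r (P.2 0)) (P.2 0) :=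
    ((sr.contDiffAt (isOpen_Ioo.mem_nhds hx)).differentiableAt (by simp)).hasDerivAt
  rw [timelikeMetric_spacetimeChange (dT _ hx) dr (dχ _ hx)]
  obtain ⟨h1, h2, h3, h4, h5⟩ := hrel _ hx
  rw [gaussianNullMetric_diagonal (hk _ hx) (hγ _ hx)]
  have hx0 := hx.1.ne'
  have hΔ0 := (hΔ _ hx).ne'
  have hK : Δ (P.2 0) ^ 2 * γ₃ (P.2 0) + k₃ (P.2 0) ^ 2 ≠ 0 := by
    have h1 := hΔ _ hx
    have h2 := hγ₃ _ hx
    positivity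
  simp only [h1, h2, h3, h4, h5]
  generalize P.2 0 = x at *
  field_simp
  ring

/-- A standard chart is determined by the Gaussian null data, up to the shifts of `t` and `ψ`. -/
theorem IsStandardChart.relations {δ : ℝ} {Δ : ℝ → ℝ} {k : Fin 3 → ℝ → ℝ}
    {γ : ℝ → Matrix (Fin 3) (Fin 3) ℝ} {T r χ N A C f w : ℝ → ℝ}
    (H : IsStandardChart δ Δ k γ T r χ N A C f w) {x k₃ γ₁ γ₃ : ℝ} (hx : x ∈ Ioo 0 δ)
    (hk : (fun i => k i x) = ![0, 0, k₃]) (hγ : γ x = Matrix.diagonal ![γ₁, γ₁, γ₃])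
    (hΔ : 0 < Δ x) (hγ₁ : 0 < γ₁) (hγ₃ : 0 < γ₃) (hA : 0 ≤ A (r x)) :
    ChartRelations (Δ x) k₃ γ₁ γ₃ x (r x) (deriv r x) N A C f w := by
  have hxn := isOpen_Ioo.mem_nhds hx
  have hd : ∀ {g : ℝ → ℝ}, ContDiffOn ℝ ∞ g (Ioo 0 δ) → HasDerivAt g (deriv g x) x := fun hg =>
    ((hg.contDiffAt hxn).differentiableAt (by simp)).hasDerivAt
  set q : Base := ![x, Real.pi / 2, 0, 0] with hq
  have hqr : q ∈ region δ := equator_mem_region hx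
  have hsin : Real.sin (q 1) ≠ 0 := (sin_pos_of_mem_region hqr).ne'
  have hc : ∀ a b, coframe q (frame a q) b = if a = b then 1 else 0 := coframe_frame q hsin
  have hc0 : ∀ b, coframe q 0 b = 0 := fun b => by fin_cases b <;> simp [coframe]
  have e : ∀ U W : Spacetime, _ := fun U W => by
    have h1 := H.metric_eq (0, q) hqr U W
    rw [timelikeMetric_spacetimeChange (hd H.smooth_T) (hd H.smooth_r) (hd H.smooth_chi),
      gaussianNullMetric_diagonal hk hγ] at h1
    exact h1
  have hq0 : q 0 = x := rfl
  have x0 := hx.1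
  -- the `dt²`, `dt σ₃`, `σ₁²`, `σ₃²`, `dt dx`, `dx σ₃` and `dx²` components
  have ett := e (1, 0) (1, 0)
  have et3 := e (1, 0) (0, frame 3 q)
  have e11 := e (0, frame 1 q) (0, frame 1 q)
  have e33 := e (0, frame 3 q) (0, frame 3 q)
  have et0 := e (1, 0) (0, frame 0 q)
  have e03 := e (0, frame 0 q) (0, frame 3 q)
  have e00 := e (0, frame 0 q) (0, frame 0 q)
  simp only [hc, hc0, hq0] at ett et3 e11 e33 et0 e03 e00
  simp at ett et3 e11 e33 et0 e03 e00
  clear e hc hc0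
  -- the sign of `f` is that of the `σ₁²` component
  have hf : 0 < f (r x) := by
    by_contra hcon
    have : (f (r x))⁻¹ * A (r x) ≤ 0 :=
      mul_nonpos_of_nonpos_of_nonneg (inv_nonpos.2 (not_lt.1 hcon)) hA
    linarith
  have hfeq : f (r x) = x * Δ x := by
    have h1 : 0 < x * Δ x := mul_pos x0 hΔ
    have h2 : (f (r x) - x * Δ x) * (f (r x) + x * Δ x) = 0 := by linear_combination -ett
    rcases mul_eq_zero.1 h2 with h | h <;> linarith
  have hw : w (r x) = -(k₃ / (x * Δ x ^ 2)) := by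
    rw [hfeq] at et3
    field_simp
    have : x * (k₃ + x * Δ x ^ 2 * w (r x)) = 0 := by linear_combination et3
    rcases mul_eq_zero.1 this with h | h
    · exact absurd h x0.ne'
    · linarith
  have hC : C (r x) = x * (Δ x * (γ₃ + k₃ ^ 2 / Δ x ^ 2)) := by
    rw [hw, hfeq] at e33
    field_simp at e33 ⊢
    linarith
  have hCpos : 0 < C (r x) := by rw [hC]; positivity
  refine ⟨hfeq, ?_, hC, hw, ?_⟩
  · rw [hfeq] at e11
    rw [e11]
    field_simp
  · rw [← hC, eq_div_iff hCpos.ne']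
    -- the `dx²`, `dx σ₃` and `dt dx` components, with `T'` and `χ'` eliminated
    obtain ⟨τ, hτ⟩ : ∃ τ, τ = deriv T x + w (r x) * deriv χ x := ⟨_, rfl⟩
    rw [← hτ] at et0 e03 e00
    have e1 : C (r x) * deriv χ x = -(f (r x) * w (r x)) := by
      field_simp at e03
      linear_combination -e03 + f (r x) * w (r x) * et0
    have e2 : f (r x) * (N (r x) * deriv r x ^ 2 + C (r x) * deriv χ x ^ 2) = 1 := by
      field_simp at e00
      linear_combination -f (r x) * e00 + (f (r x) ^ 2 * τ - 1) * et0
    have e3 : γ₃ * f (r x) = C (r x) - f (r x) ^ 3 * w (r x) ^ 2 := by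
      rw [e33]; field_simp
    have : f (r x) * (N (r x) * deriv r x ^ 2 * C (r x) - γ₃) = 0 := by
      linear_combination C (r x) * e2 - e3
        - f (r x) * (C (r x) * deriv χ x - f (r x) * w (r x)) * e1
    rcases mul_eq_zero.1 this with h | h
    · exact absurd h hf.ne'
    · linarith

/-! ### Consequences of the symmetry -/

theorem eval1_frame (al : OneForm) {p : Base} (hp : Real.sin (p 1) ≠ 0) (a : Fin 4) :
    eval1 al p (frame a p) = al p a := by
  simp [eval1, coframe_frame p hp]

theorem eval2_frame (B : TwoTensor) {p : Base} (hp : Real.sin (p 1) ≠ 0) (a b : Fin 4) :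
    eval2 B p (frame a p) (frame b p) = B p a b := by
  simp [eval2, coframe_frame p hp]

theorem coframe_zero (p : Base) (a : Fin 4) : coframe p 0 a = 0 := by
  fin_cases a <;> simp [coframe]

/-- The supersymmetric data in terms of the Gaussian null data: comparison of the two forms of the
metric. -/
theorem data_of_metric_eq {Δ : ℝ → ℝ} {k : Fin 3 → ℝ → ℝ} {γ : ℝ → Matrix (Fin 3) (Fin 3) ℝ}
    {f : Base → ℝ} {om : OneForm} {h : TwoTensor} {p : Base} (hp : Real.sin (p 1) ≠ 0)
    (hf : 0 < f p)
    (hg : ∀ U W : Spacetime, gaussianNullMetric Δ k γ (0, p) U W =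
      timelikeMetric f om h (0, p) U W) :
    f p ^ 2 = (p 0 * Δ (p 0)) ^ 2 ∧
    (∀ a, om p a = -(1 / f p ^ 2) * (![1, p 0 * k 0 (p 0), p 0 * k 1 (p 0), p 0 * k 2 (p 0)] :
      Fin 4 → ℝ) a) ∧
    (∀ i j : Fin 3, h p i.succ j.succ = f p * γ (p 0) i j + f p ^ 3 * om p i.succ * om p j.succ) ∧
    (∀ a, h p 0 a = f p ^ 3 * om p 0 * om p a) := by
  have hc := coframe_frame p hp
  have hs : ∀ i : Fin 3, (0 : Fin 4) ≠ i.succ := fun i => (Fin.succ_ne_zero i).symm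
  have h00 : frame 0 p 0 = 1 := rfl
  have hi0 : ∀ i : Fin 3, frame i.succ p 0 = 0 := fun i => by
    rw [frame_zero_coord, if_neg (Fin.succ_ne_zero i)]
  have htt := hg (1, 0) (1, 0)
  have ht : ∀ a, _ := fun a => hg (1, 0) (0, frame a p)
  have hab : ∀ a b, _ := fun a b => hg (0, frame a p) (0, frame b p)
  simp only [gaussianNullMetric, timelikeMetric, eval1_frame _ hp, eval2_frame _ hp, hc,
    coframe_zero] at htt ht hab
  have e1 : ∀ q, eval1 om q 0 = 0 := fun q => by simp [eval1, coframe_zero]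
  have e2 : ∀ q u, eval2 h q 0 u = 0 := fun q u => by simp [eval2, coframe_zero]
  simp [e1, e2] at htt ht hab
  have f0 := hf.ne'
  have hom : ∀ a, om p a = -(1 / f p ^ 2) * (![1, p 0 * k 0 (p 0), p 0 * k 1 (p 0),
      p 0 * k 2 (p 0)] : Fin 4 → ℝ) a := by
    intro a
    have := ht a
    field_simp
    rw [Fin.sum_univ_three] at this
    fin_cases a <;> simp [frame] at this ⊢ <;> linarith
  refine ⟨by rw [mul_pow]; linarith, hom, fun i j => ?_, fun a => ?_⟩
  · have := hab i.succ j.succ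
    simp only [Fin.succ_inj, Finset.sum_ite_eq, Finset.mem_univ, if_true] at this
    field_simp at this
    linear_combination -this
  · have := hab 0 a
    simp only [hs, if_false, ite_self, Finset.sum_const_zero] at this
    field_simp at this
    linear_combination -this

/-- A function which is constant along the orbits has vanishing derivative along them. -/
theorem fderiv_orbit_eq_zero {D : Set Base} (hD : IsOpen D) {F : Base → ℝ} {p : Base} (hp : p ∈ D)
    (hF : ∀ q ∈ D, q 0 = p 0 → F q = F p) {u : Base} (hu : u 0 = 0) : fderiv ℝ F p u = 0 := by
  by_cases hd : DifferentiableAt ℝ F p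
  · have hl : HasDerivAt (fun t : ℝ => p + t • u) u 0 := by
      simpa using ((hasDerivAt_id (0 : ℝ)).smul_const u).const_add p
    have h1 : HasFDerivAt F (fderiv ℝ F p) (p + (0 : ℝ) • u) := by
      rw [zero_smul, add_zero]; exact hd.hasFDerivAt
    have h2 := h1.comp_hasDerivAt (0 : ℝ) hl
    have hev : ∀ᶠ t in 𝓝 (0 : ℝ), p + t • u ∈ D :=
      hl.continuousAt.eventually_mem (by simpa using hD.mem_nhds hp)
    have h3 : HasDerivAt (fun _ : ℝ => F p) (fderiv ℝ F p u) 0 := by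
      refine h2.congr_of_eventuallyEq ?_
      filter_upwards [hev] with t ht
      exact (hF _ ht (by simp [hu])).symm
    exact h3.unique (hasDerivAt_const _ _)
  · simp [fderiv_zero_of_not_differentiableAt hd]

theorem bracketCoeff_rightGen {p : Base} (hp : Real.sin (p 1) ≠ 0) (i : Fin 3) (a c : Fin 4) :
    bracketCoeff (rightGen i) p a c = 0 := by
  rw [bracketCoeff, lieBracket_rightGen_frame p hp, coframe_zero]

/-- The rotation generated by `L₃` on the frame. -/
theorem bracketCoeff_frame_three {p : Base} (hp : Real.sin (p 1) ≠ 0) (a c : Fin 4) :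
    bracketCoeff (frame 3) p a c =
      (!![0, 0, 0, 0; 0, 0, 1, 0; 0, -1, 0, 0; 0, 0, 0, 0] : Matrix (Fin 4) (Fin 4) ℝ) a c := by
  obtain ⟨-, h2, h3⟩ := lieBracket_frame p hp
  have hz : ∀ a : Fin 4, a = 0 ∨ a = 3 → VectorField.lieBracket ℝ (frame 3) (frame a) p = 0 := by
    intro a ha
    ext i
    rw [lieBracket_apply _ _ _ (fun i => (fderiv_frame p hp _ i).1)
      (fun i => (fderiv_frame p hp _ i).1), (fderiv_frame p hp _ i).2, (fderiv_frame p hp _ i).2]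
    rcases ha with rfl | rfl <;> fin_cases i <;> simp
  have hneg : ∀ u : Base, coframe p (-u) c = -coframe p u c := fun u => by
    fin_cases c <;> simp [coframe] <;> ring
  unfold bracketCoeff
  fin_cases a
  · simp only [Fin.zero_eta]
    rw [hz 0 (Or.inl rfl), coframe_zero]
    fin_cases c <;> simp
  · simp only [Fin.mk_one]
    rw [h3, coframe_frame p hp]
    fin_cases c <;> simp
  · simp only [Fin.reduceFinMk]
    rw [VectorField.lieBracket_swap, h2]
    refine (hneg _).trans ?_
    rw [coframe_frame p hp]
    fin_cases c <;> simp
  · simp only [Fin.reduceFinMk]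
    rw [hz 3 (Or.inr rfl), coframe_zero]
    fin_cases c <;> simp

theorem frame_three_eq {p : Base} (hp : Real.sin (p 1) ≠ 0) :
    frame 3 p = (Real.sin (p 1) * Real.cos (p 2)) • rightGen 0 p
      + (Real.sin (p 1) * Real.sin (p 2)) • rightGen 1 p + Real.cos (p 1) • rightGen 2 p := by
  have h2 := Real.sin_sq_add_cos_sq (p 2)
  ext i
  fin_cases i <;> simp [frame, rightGen] <;> field_simp
  · ring
  · linear_combination Real.cos (p 1) * h2
  · linear_combination -h2

/-- Over the region covered by Gaussian null coordinates `Δ` does not vanish, since `f = λ |Δ|`. -/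
theorem Delta_pos_of_f_pos {ε : ℝ} {Δ : ℝ → ℝ} (hΔ : ContinuousOn Δ (Ioo (-ε) ε)) (h0 : 0 < Δ 0)
    (hne : ∀ x ∈ Ioo 0 ε, Δ x ≠ 0) {x : ℝ} (hx : x ∈ Ioo 0 ε) : 0 < Δ x := by
  by_contra hcon
  have hsub : Icc 0 x ⊆ Ioo (-ε) ε := fun y hy =>
    ⟨by linarith [hx.1, hx.2, hy.1], by linarith [hx.2, hy.2]⟩
  obtain ⟨y, hy, hy0⟩ := intermediate_value_Icc' hx.1.le (hΔ.mono hsub) ⟨not_lt.1 hcon, h0.le⟩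
  rcases hy.1.eq_or_lt with rfl | h
  · exact h0.ne' hy0
  · exact hne y ⟨h, hy.2.trans_lt hx.2⟩ hy0

/-- Invariance under `L₃` diagonalises an invariant symmetric tensor up to its `dx σ₃` component. -/
theorem lie2_frame_three_eq {D : Set Base} (hD : IsOpen D) {B : TwoTensor} {p : Base} (hp : p ∈ D)
    (hs : Real.sin (p 1) ≠ 0) (hB : ∀ q ∈ D, q 0 = p 0 → B q = B p) (a b : Fin 4) :
    lie2 (frame 3) B p a b =
      -∑ c, (!![0, 0, 0, 0; 0, 0, 1, 0; 0, -1, 0, 0; 0, 0, 0, 0] a c * B p c b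
        + !![0, 0, 0, 0; 0, 0, 1, 0; 0, -1, 0, 0; 0, 0, 0, 0] b c * B p a c) := by
  rw [lie2, lie0, fderiv_orbit_eq_zero hD hp (fun q hq hq0 => by rw [hB q hq hq0])
    (by simp [frame])]
  simp only [bracketCoeff_frame_three hs, zero_sub]

/-- The Gaussian null data of a `U(1) × SU(2)`-invariant solution, and the solution in the Gaussian
null coordinates. -/
theorem invariant_data {n : WithTop ℕ∞} {ℓ ε : ℝ} {Δ : ℝ → ℝ} {k : Fin 3 → ℝ → ℝ}
    {γ : ℝ → Matrix (Fin 3) (Fin 3) ℝ} {f : Base → ℝ} {om : OneForm} {h J : TwoTensor}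
    (hreg : IsRegularHorizon n ε Δ k γ) (h0 : 0 < Δ 0)
    (hsusy : IsTimelikeSusy ℓ (region ε) f om h J) (hsym : IsU1SU2Invariant ℓ (region ε) f om h J)
    (hg : ∀ P : Spacetime, P.2 ∈ region ε → ∀ U W : Spacetime,
      gaussianNullMetric Δ k γ P U W = timelikeMetric f om h P U W) :
    (∀ x ∈ Ioo 0 ε, 0 < Δ x ∧ (fun i => k i x) = ![0, 0, k 2 x] ∧
      γ x = Matrix.diagonal ![γ x 0 0, γ x 0 0, γ x 2 2]) ∧
    (∀ p ∈ region ε, f p = p 0 * Δ (p 0) ∧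
      om p = ![-(1 / (p 0 * Δ (p 0)) ^ 2), 0, 0, -(k 2 (p 0) / (p 0 * Δ (p 0) ^ 2))] ∧
      h p = blockMat (1 / (p 0 * Δ (p 0))) (k 2 (p 0) / Δ (p 0)) (p 0 * Δ (p 0) * γ (p 0) 0 0)
        (p 0 * (Δ (p 0) * (γ (p 0) 2 2 + k 2 (p 0) ^ 2 / Δ (p 0) ^ 2)))) := by
  have hsin : ∀ p ∈ region ε, Real.sin (p 1) ≠ 0 := fun p hp => (sin_pos_of_mem_region hp).ne'
  have hdata := fun p (hp : p ∈ region ε) =>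
    data_of_metric_eq (hsin p hp) (hsusy.f_pos p hp) (fun U W => hg (0, p) hp U W)
  have hΔ : ∀ x ∈ Ioo 0 ε, 0 < Δ x := fun x hx =>
    Delta_pos_of_f_pos hreg.reg_Delta.continuousOn h0 (fun y hy hy0 => by
      have hp := equator_mem_region hy
      have h1 := (hdata _ hp).1
      have h2 := hsusy.f_pos _ hp
      have : (![y, Real.pi / 2, 0, 0] : Base) 0 = y := rfl
      rw [this, hy0, mul_zero] at h1
      nlinarith) hx
  have hf : ∀ p ∈ region ε, f p = p 0 * Δ (p 0) := fun p hp => by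
    have hx := mem_region_coord hp
    exact (pow_left_inj₀ (hsusy.f_pos p hp).le (mul_pos hx.1 (hΔ _ hx)).le two_ne_zero).1
      (hdata p hp).1
  have hom_orbit : ∀ p ∈ region ε, ∀ q ∈ region ε, q 0 = p 0 → om q = om p := by
    intro p hp q hq hqp
    ext a
    rw [(hdata p hp).2.1 a, (hdata q hq).2.1 a, hf p hp, hf q hq, hqp]
  have h_orbit : ∀ p ∈ region ε, ∀ q ∈ region ε, q 0 = p 0 → h q = h p := by
    intro p hp q hq hqp
    have hsymm : ∀ q ∈ region ε, ∀ a b, h q a b = h q b a := fun q hq a b => by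
      have := (hsusy.kahler.posDef q hq).1.apply b a
      simpa using this
    have hc : ∀ i j : Fin 3, h q i.succ j.succ = h p i.succ j.succ := fun i j => by
      rw [(hdata p hp).2.2.1, (hdata q hq).2.2.1, hf p hp, hf q hq, hqp, hom_orbit p hp q hq hqp]
    have hc0 : ∀ a, h q 0 a = h p 0 a := fun a => by
      rw [(hdata p hp).2.2.2, (hdata q hq).2.2.2, hf p hp, hf q hq, hqp, hom_orbit p hp q hq hqp]
    ext a b
    refine Fin.cases (hc0 b) (fun i => ?_) a
    refine Fin.cases ?_ (fun j => hc i j) b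
    rw [hsymm q hq, hsymm p hp, hc0]
  -- `L₃`-invariance of `ω`
  have hom12 : ∀ p ∈ region ε, om p 1 = 0 ∧ om p 2 = 0 := fun p hp => by
    have e := fun a => hsym.2.omega_inv p hp a
    have e1 := e 1
    have e2 := e 2
    have hz : ∀ a, lie0 (frame 3) (fun q => om q a) p = 0 := fun a =>
      fderiv_orbit_eq_zero (isOpen_region ε) hp
        (fun q hq hqp => by rw [hom_orbit p hp q hq hqp]) (by simp [frame])
    simp [lie1, hz, bracketCoeff_frame_three (hsin p hp), Fin.sum_univ_four] at e1 e2
    exact ⟨e2, e1⟩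
  have hk : ∀ x ∈ Ioo 0 ε, k 0 x = 0 ∧ k 1 x = 0 := fun x hx => by
    have hp := equator_mem_region hx
    have h1 := hom12 _ hp
    have h2 := (hdata _ hp).2.1
    have hfp := (hsusy.f_pos _ hp).ne'
    rw [h2 1, h2 2] at h1
    simpa [hfp, hx.1.ne'] using h1
  -- `L₃`-invariance of `h`
  have hh : ∀ p ∈ region ε, h p 1 1 = h p 2 2 ∧ h p 1 2 = 0 ∧ h p 2 1 = 0 ∧ h p 1 3 = 0 ∧
      h p 2 3 = 0 ∧ h p 3 1 = 0 ∧ h p 3 2 = 0 := fun p hp => by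
    have e := fun a b => hsym.2.h_inv p hp a b
    simp only [lie2_frame_three_eq (isOpen_region ε) hp (hsin p hp) (h_orbit p hp)] at e
    have e11 := e 1 1
    have e12 := e 1 2
    have e13 := e 1 3
    have e23 := e 2 3
    have e31 := e 3 1
    have e32 := e 3 2
    have hsymm := (hsusy.kahler.posDef p hp).1.apply 1 2
    simp [Fin.sum_univ_four] at e11 e12 e13 e23 e31 e32 hsymm
    refine ⟨?_, ?_, ?_, e23, e13, e32, e31⟩ <;> linarith
  have hγ : ∀ x ∈ Ioo 0 ε, γ x = Matrix.diagonal ![γ x 0 0, γ x 0 0, γ x 2 2] := fun x hx => by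
    have hp := equator_mem_region hx
    obtain ⟨a1, a2, a3, a4, a5, a6, a7⟩ := hh _ hp
    obtain ⟨b1, b2⟩ := hom12 _ hp
    have hd := (hdata _ hp).2.2.1
    have hfp := (hsusy.f_pos _ hp).ne'
    have d00 := hd 0 0
    have d11 := hd 1 1
    have d01 := hd 0 1
    have d10 := hd 1 0
    have d02 := hd 0 2
    have d20 := hd 2 0
    have d12 := hd 1 2
    have d21 := hd 2 1
    have s0 : (0 : Fin 3).succ = (1 : Fin 4) := rfl
    have s1 : (1 : Fin 3).succ = (2 : Fin 4) := rfl
    have s2 : (2 : Fin 3).succ = (3 : Fin 4) := rfl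
    rw [s0] at d00 d01 d10 d02 d20
    rw [s1] at d01 d10 d11 d12 d21
    rw [s2] at d02 d20 d12 d21
    rw [b1] at d00 d01 d10 d02 d20
    rw [b2] at d11 d12 d21
    have hx0 : (![x, Real.pi / 2, 0, 0] : Base) 0 = x := rfl
    simp only [hx0, a2, a3, a4, a5, a6, a7, mul_zero, zero_mul, add_zero]
      at d00 d11 d01 d10 d02 d20 d12 d21
    have e11 : γ x 1 1 = γ x 0 0 := by
      have : f ![x, Real.pi / 2, 0, 0] * (γ x 1 1 - γ x 0 0) = 0 := by linarith
      rcases mul_eq_zero.1 this with h | h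
      · exact absurd h hfp
      · linarith
    have hz : ∀ {y : ℝ}, 0 = f ![x, Real.pi / 2, 0, 0] * y → y = 0 := fun hy =>
      (mul_eq_zero.1 hy.symm).resolve_left hfp
    ext i j
    fin_cases i <;> fin_cases j <;>
      simp [Matrix.diagonal, e11, hz d01, hz d10, hz d02, hz d20, hz d12, hz d21]
  refine ⟨fun x hx => ⟨hΔ x hx, ?_, hγ x hx⟩, fun p hp => ?_⟩
  · ext i
    fin_cases i <;> simp [hk x hx]
  · have hx := mem_region_coord hp
    have hx0 := hx.1.ne'
    have hΔ0 := (hΔ _ hx).ne'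
    have homp : om p = ![-(1 / (p 0 * Δ (p 0)) ^ 2), 0, 0, -(k 2 (p 0) / (p 0 * Δ (p 0) ^ 2))] := by
      ext a
      rw [(hdata p hp).2.1 a, hf p hp]
      fin_cases a <;> simp [hk _ hx]
      field_simp
    refine ⟨hf p hp, homp, ?_⟩
    obtain ⟨-, -, d, d0⟩ := hdata p hp
    have hsymm : ∀ a, h p a 0 = h p 0 a := fun a => by
      simpa using (hsusy.kahler.posDef p hp).1.apply 0 a
    have hc : ∀ i j : Fin 3, h p i.succ j.succ = blockMat (1 / (p 0 * Δ (p 0)))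
        (k 2 (p 0) / Δ (p 0)) (p 0 * Δ (p 0) * γ (p 0) 0 0)
        (p 0 * (Δ (p 0) * (γ (p 0) 2 2 + k 2 (p 0) ^ 2 / Δ (p 0) ^ 2))) i.succ j.succ := by
      intro i j
      rw [d i j, homp, hf p hp, hγ _ hx]
      fin_cases i <;> fin_cases j <;> simp [blockMat]
      field_simp
    have hc0 : ∀ a, h p 0 a = blockMat (1 / (p 0 * Δ (p 0)))
        (k 2 (p 0) / Δ (p 0)) (p 0 * Δ (p 0) * γ (p 0) 0 0)
        (p 0 * (Δ (p 0) * (γ (p 0) 2 2 + k 2 (p 0) ^ 2 / Δ (p 0) ^ 2))) 0 a := by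
      intro a
      rw [d0 a, homp, hf p hp]
      fin_cases a <;> simp [blockMat] <;> field_simp
    ext a b
    refine Fin.cases (hc0 b) (fun i => ?_) a
    refine Fin.cases ?_ (fun j => hc i j) b
    rw [hsymm, hc0]
    fin_cases i <;> rfl

/-! ### The Kähler form -/

/-- The components of the Maxwell field between the blocks `(x, σ₃)` and `(σ₁, σ₂)` come from `J`
alone: `d(f ω)`, `dω` and `⋆dω` have no such components. -/
theorem maxwellSpatial_off_block {ℓ ε : ℝ} {f : Base → ℝ} {om : OneForm}
    {h J : TwoTensor} {N M A C N' M' A' C' F w₀ w F' w₀' w' : ℝ → ℝ}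
    (H : IsBlockMetric ε h N M A C N' M' A' C')
    (hf : ∀ q ∈ region ε, f q = F (q 0)) (hom : ∀ q ∈ region ε, om q = ![w₀ (q 0), 0, 0, w (q 0)])
    (dF : ∀ x ∈ Ioo 0 ε, HasDerivAt F (F' x) x) (dw₀ : ∀ x ∈ Ioo 0 ε, HasDerivAt w₀ (w₀' x) x)
    (dw : ∀ x ∈ Ioo 0 ε, HasDerivAt w (w' x) x)
    {p : Base} (hp : p ∈ region ε) (hJ : (J p).transpose = -J p) {a b : Fin 4}
    (hab : (a, b) ∈ ({(0, 1), (0, 2), (1, 3), (2, 3)} : Finset (Fin 4 × Fin 4))) :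
    maxwellSpatial ℓ f om h J p a b = -(Real.sqrt 3 / (ℓ * f p)) * J p a b := by
  have hx := mem_region_coord hp
  have hsymm : ∀ i j, J p j i = -J p i j := fun i j => congrFun (congrFun hJ i) j
  have hd : ∀ i, J p i i = 0 := fun i => by linarith [hsymm i i]
  have e1 : ext1 om p = formMat (w' (p 0)) (w (p 0)) :=
    ext1_radial (isOpen_region ε) hp hom (dw₀ _ hx) (dw _ hx)
  have e2 := ext1_radial (isOpen_region ε) hp (om := fun q a => f q * om q a)
    (w₀ := fun x => F x * w₀ x) (w := fun x => F x * w x) (fun q hq => by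
      ext i
      rw [hf q hq, hom q hq]
      fin_cases i <;> simp) ((dF _ hx).mul (dw₀ _ hx)) ((dF _ hx).mul (dw _ hx))
  have hA := H.A_ne _ hx
  have hdet := H.det_ne _ hx
  have e3 : star h J (ext1 om) p a b = 0 := by
    simp only [star, Matrix.of_apply, raise_formMat (H.eq p hp) e1 hA hdet, Fin.sum_univ_four]
    simp only [Finset.mem_insert, Finset.mem_singleton, Prod.mk.injEq] at hab
    rcases hab with ⟨rfl, rfl⟩ | ⟨rfl, rfl⟩ | ⟨rfl, rfl⟩ | ⟨rfl, rfl⟩ <;>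
      simp [formMat, volForm, hd, hsymm 0 1, hsymm 0 2, hsymm 0 3, hsymm 1 2, hsymm 1 3,
        hsymm 2 3] <;> ring
  simp only [maxwellSpatial, Gplus, Matrix.sub_apply, Matrix.smul_apply, Matrix.add_apply,
    smul_eq_mul, e3]
  rw [e1, e2]
  simp only [Finset.mem_insert, Finset.mem_singleton, Prod.mk.injEq] at hab
  rcases hab with ⟨rfl, rfl⟩ | ⟨rfl, rfl⟩ | ⟨rfl, rfl⟩ | ⟨rfl, rfl⟩ <;> simp [formMat]

/-- The Kähler form of an invariant solution is `± d(A σ₃)`. The components of the Maxwell field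
which are not `U(1)`-invariant are proportional to those of `J`, so that they vanish; the norm of
`J` and its closedness fix the remaining two. -/
theorem invariant_kahlerForm {ℓ ε : ℝ} (hℓ : 0 < ℓ) {f : Base → ℝ} {om : OneForm}
    {h J : TwoTensor} {N M A C N' M' A' C' F w₀ w F' w₀' w' : ℝ → ℝ}
    (H : IsBlockMetric ε h N M A C N' M' A' C')
    (hsusy : IsTimelikeSusy ℓ (region ε) f om h J) (hsym : IsU1SU2Invariant ℓ (region ε) f om h J)
    (hf : ∀ q ∈ region ε, f q = F (q 0)) (hom : ∀ q ∈ region ε, om q = ![w₀ (q 0), 0, 0, w (q 0)])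
    (dF : ∀ x ∈ Ioo 0 ε, HasDerivAt F (F' x) x) (dw₀ : ∀ x ∈ Ioo 0 ε, HasDerivAt w₀ (w₀' x) x)
    (dw : ∀ x ∈ Ioo 0 ε, HasDerivAt w (w' x) x) :
    ∃ s : ℝ, (s = 1 ∨ s = -1) ∧ ∀ p ∈ region ε, J p = formMat (s * A' (p 0)) (s * A (p 0)) ∧
      N (p 0) * C (p 0) - M (p 0) ^ 2 = A' (p 0) ^ 2 := by
  have hopen := isOpen_region ε
  have hsin : ∀ p ∈ region ε, Real.sin (p 1) ≠ 0 := fun p hp => (sin_pos_of_mem_region hp).ne'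
  have hanti := hsusy.kahler.antisymm
  have hM := fun p (hp : p ∈ region ε) a b => maxwellSpatial_off_block (ℓ := ℓ) H hf hom dF dw₀ dw
    hp (hanti p hp) (a := a) (b := b)
  -- `L₃` is a combination of the `Rᵢ`, along which the Maxwell field is constant
  have hz : ∀ p ∈ region ε, ∀ a b,
      lie0 (frame 3) (fun q => maxwellSpatial ℓ f om h J q a b) p = 0 := fun p hp a b => by
    have hR : ∀ i, fderiv ℝ (fun q => maxwellSpatial ℓ f om h J q a b) p (rightGen i p) = 0 :=
      fun i => by
        have := (hsym.1 i).maxwell_inv p hp a b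
        simpa [lie2, lie0, bracketCoeff_rightGen (hsin p hp)] using this
    rw [lie0, frame_three_eq (hsin p hp), map_add, map_add, map_smul, map_smul, map_smul, hR, hR,
      hR]
    simp
  have hL := fun p (hp : p ∈ region ε) a b => hsym.2.maxwell_inv p hp a b
  have hJ0 : ∀ p ∈ region ε, J p 0 1 = 0 ∧ J p 0 2 = 0 ∧ J p 1 3 = 0 ∧ J p 2 3 = 0 := fun p hp => by
    have e01 := hL p hp 0 1
    have e02 := hL p hp 0 2
    have e13 := hL p hp 1 3
    have e23 := hL p hp 2 3
    simp only [lie2, hz p hp, bracketCoeff_frame_three (hsin p hp)] at e01 e02 e13 e23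
    simp [Fin.sum_univ_four] at e01 e02 e13 e23
    have hκ : Real.sqrt 3 / (ℓ * f p) ≠ 0 := by
      have := hsusy.f_pos p hp
      positivity
    rw [hM p hp 0 2 (by simp)] at e01
    rw [hM p hp 0 1 (by simp)] at e02
    rw [hM p hp 2 3 (by simp)] at e13
    rw [hM p hp 1 3 (by simp)] at e23
    have hc : ∀ {y : ℝ}, -(Real.sqrt 3 / (ℓ * f p)) * y = 0 → y = 0 := fun hy =>
      (mul_eq_zero.1 hy).resolve_left (neg_ne_zero.2 hκ)
    exact ⟨hc e02, hc e01, hc e23, hc e13⟩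
  have hJ : ∀ p ∈ region ε, J p = formMat (J p 0 3) (-J p 1 2) := fun p hp => by
    have hs : ∀ i j, J p j i = -J p i j := fun i j => congrFun (congrFun (hanti p hp) i) j
    have hd : ∀ i, J p i i = 0 := fun i => by linarith [hs i i]
    obtain ⟨a1, a2, a3, a4⟩ := hJ0 p hp
    ext i j
    fin_cases i <;> fin_cases j <;>
      simp [formMat, hd, hs 0 1, hs 0 2, hs 0 3, hs 1 2, hs 1 3, hs 2 3, a1, a2, a3, a4]
  have hnorm : ∀ p ∈ region ε, J p 0 3 ^ 2 = N (p 0) * C (p 0) - M (p 0) ^ 2 ∧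
      J p 1 2 ^ 2 = A (p 0) ^ 2 := fun p hp => by
    have hx := mem_region_coord hp
    have := hsusy.kahler.almost_complex p hp
    rw [hJ p hp, H.eq p hp] at this
    have := formMat_sq_of_almost_complex (H.A_ne _ hx) (H.det_ne _ hx) this
    rwa [neg_sq] at this
  have hpre : IsPreconnected (region ε) := by
    refine Convex.isPreconnected ?_
    have hl : ∀ i : Fin 4, IsLinearMap ℝ (fun p : Base => p i) := fun i =>
      ⟨fun _ _ => rfl, fun _ _ => rfl⟩
    unfold region
    simp only [ofPred_and]
    exact (convex_halfSpace_gt (hl 0) 0).inter ((convex_halfSpace_lt (hl 0) ε).inter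
      ((convex_halfSpace_gt (hl 1) 0).inter (convex_halfSpace_lt (hl 1) Real.pi)))
  have hAc : ContinuousOn (fun p : Base => A (p 0)) (region ε) := fun p hp =>
    ((H.derivA _ (mem_region_coord hp)).continuousAt.comp
      (f := fun p : Base => p 0) (continuous_apply 0).continuousAt).continuousWithinAt
  have hsign := hpre.eq_or_eq_neg_of_sq_eq (f := fun p => J p 1 2) (g := fun p => A (p 0))
    (hsusy.kahler.smooth_form 1 2).continuousOn hAc (fun p hp => (hnorm p hp).2)
    (fun hp => H.A_ne _ (mem_region_coord hp))
  obtain ⟨s, hs, hsJ⟩ : ∃ s : ℝ, (s = 1 ∨ s = -1) ∧ ∀ p ∈ region ε, J p 1 2 = -s * A (p 0) := by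
    rcases hsign with hs | hs
    · exact ⟨-1, Or.inr rfl, fun p hp => by simpa using hs hp⟩
    · exact ⟨1, Or.inl rfl, fun p hp => by simpa using hs hp⟩
  have hs2 : s ^ 2 = 1 := by rcases hs with rfl | rfl <;> norm_num
  refine ⟨s, hs, fun p hp => ?_⟩
  have hx := mem_region_coord hp
  have hJ03 : J p 0 3 = s * A' (p 0) := by
    have hc := hsusy.kahler.closed p hp 0 1 2
    have hs3 : J p 3 0 = -J p 0 3 := congrFun (congrFun (hanti p hp) 0) 3
    have d1 : der 0 (fun q => J q 1 2) p = -s * A' (p 0) := by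
      rw [der_radial hopen hp (g := fun x => -s * A x) hsJ ((H.derivA _ hx).const_mul _)]
      simp
    have d2 : der 1 (fun q => J q 2 0) p = 0 := by
      rw [der_radial hopen hp (g := fun _ => 0) (fun q hq => ?_) (hasDerivAt_const _ _)]
      · simp
      · rw [hJ q hq]; simp [formMat]
    have d3 : der 2 (fun q => J q 0 1) p = 0 := by
      rw [der_radial hopen hp (g := fun _ => 0) (fun q hq => ?_) (hasDerivAt_const _ _)]
      · simp
      · rw [hJ q hq]; simp [formMat]
    rw [ext2, d1, d2, d3] at hc
    simp [strucConst, hs3] at hc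
    linarith
  refine ⟨?_, ?_⟩
  · rw [hJ p hp, hJ03, hsJ p hp]; simp
  · rw [← (hnorm p hp).1, hJ03, mul_pow, hs2, one_mul]

/-! ### The solution near the horizon -/

theorem eq_at_zero_of_eventually_eq {F G : ℝ → ℝ} (hF : ContinuousAt F 0) (hG : ContinuousAt G 0)
    (h : ∀ᶠ x in 𝓝[>] (0 : ℝ), F x = G x) : F 0 = G 0 :=
  tendsto_nhds_unique (hF.tendsto.mono_left nhdsWithin_le_nhds)
    ((hG.tendsto.mono_left nhdsWithin_le_nhds).congr' (h.mono fun _ hx => hx.symm))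

theorem Ioo_mem_nhdsGT_zero {δ : ℝ} (hδ : 0 < δ) : Ioo 0 δ ∈ 𝓝[>] (0 : ℝ) :=
  Ioo_mem_nhdsGT hδ

/-- Diagonal Gaussian null data, regular and non-degenerate for `|λ| < η`. -/
structure HorizonData (n : WithTop ℕ∞) (η : ℝ) (Δ k₃ γ₁ γ₃ : ℝ → ℝ) : Prop where
  pos : 0 < η
  reg_Δ : ContDiffOn ℝ n Δ (Ioo (-η) η)
  reg_k : ContDiffOn ℝ n k₃ (Ioo (-η) η)
  reg_γ₁ : ContDiffOn ℝ n γ₁ (Ioo (-η) η)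
  reg_γ₃ : ContDiffOn ℝ n γ₃ (Ioo (-η) η)
  Δ_pos : ∀ x ∈ Ioo (-η) η, 0 < Δ x
  γ₁_pos : ∀ x ∈ Ioo (-η) η, 0 < γ₁ x
  γ₃_pos : ∀ x ∈ Ioo (-η) η, 0 < γ₃ x

/-- The base metric has `σ₃²` component `λ H(λ)`; this is `H`. -/
def fiberCoeff (Δ k₃ γ₃ : ℝ → ℝ) (x : ℝ) : ℝ := Δ x * (γ₃ x + k₃ x ^ 2 / Δ x ^ 2)

namespace HorizonData

variable {n : WithTop ℕ∞} {η : ℝ} {Δ k₃ γ₁ γ₃ : ℝ → ℝ}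

theorem mono (D : HorizonData n η Δ k₃ γ₁ γ₃) {η' : ℝ} (h0 : 0 < η') (hle : η' ≤ η) :
    HorizonData n η' Δ k₃ γ₁ γ₃ := by
  have hsub : Ioo (-η') η' ⊆ Ioo (-η) η := Ioo_subset_Ioo (by linarith) hle
  exact ⟨h0, D.reg_Δ.mono hsub, D.reg_k.mono hsub, D.reg_γ₁.mono hsub, D.reg_γ₃.mono hsub,
    fun x hx => D.Δ_pos x (hsub hx), fun x hx => D.γ₁_pos x (hsub hx),
    fun x hx => D.γ₃_pos x (hsub hx)⟩

theorem zero_mem (D : HorizonData n η Δ k₃ γ₁ γ₃) : (0 : ℝ) ∈ Ioo (-η) η :=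
  ⟨by linarith [D.pos], D.pos⟩

theorem reg_H (D : HorizonData n η Δ k₃ γ₁ γ₃) :
    ContDiffOn ℝ n (fiberCoeff Δ k₃ γ₃) (Ioo (-η) η) :=
  D.reg_Δ.mul (D.reg_γ₃.add ((D.reg_k.pow 2).div (D.reg_Δ.pow 2)
    fun x hx => (pow_pos (D.Δ_pos x hx) 2).ne'))

theorem H_pos (D : HorizonData n η Δ k₃ γ₁ γ₃) {x : ℝ} (hx : x ∈ Ioo (-η) η) :
    0 < fiberCoeff Δ k₃ γ₃ x := by
  have h1 := D.Δ_pos x hx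
  have h2 := D.γ₃_pos x hx
  unfold fiberCoeff
  positivity

end HorizonData

/-- `Δ` is positive near the horizon. Only the diagonal of `γ` enters, so that no symmetry is
needed. -/
theorem exists_horizonData {n : WithTop ℕ∞} {ℓ ε : ℝ} (hℓ : 0 < ℓ) {Δ : ℝ → ℝ} {k : Fin 3 → ℝ → ℝ}
    {γ : ℝ → Matrix (Fin 3) (Fin 3) ℝ} (hreg : IsRegularHorizon n ε Δ k γ)
    (hGR : IsGutowskiReallNH ℓ Δ k γ) :
    ∃ η, 0 < η ∧ η ≤ ε ∧ HorizonData n η Δ (k 2) (fun x => γ x 0 0) (fun x => γ x 2 2) := by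
  have h0 : 0 < Δ 0 := lt_trans (by positivity) hGR.Delta_gt
  have h0m : (0 : ℝ) ∈ Ioo (-ε) ε := ⟨by linarith [hreg.pos], hreg.pos⟩
  have hc := (hreg.reg_Delta.continuousOn.continuousAt (isOpen_Ioo.mem_nhds h0m)).eventually
    (lt_mem_nhds h0)
  obtain ⟨b, hb, hball⟩ := Metric.eventually_nhds_iff_ball.1 hc
  rw [Real.ball_zero_eq_Ioo] at hball
  have hsub : Ioo (-min b ε) (min b ε) ⊆ Ioo (-ε) ε :=
    Ioo_subset_Ioo (by linarith [min_le_right b ε]) (min_le_right _ _)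
  refine ⟨min b ε, lt_min hb hreg.pos, min_le_right _ _, lt_min hb hreg.pos,
    hreg.reg_Delta.mono hsub, (hreg.reg_k 2).mono hsub, (hreg.reg_gamma 0 0).mono hsub,
    (hreg.reg_gamma 2 2).mono hsub, fun x hx => hball x ?_, fun x hx => ?_, fun x hx => ?_⟩
  · exact ⟨by linarith [hx.1, min_le_left b ε], by linarith [hx.2, min_le_left b ε]⟩
  · exact (hreg.posDef x (hsub hx)).diag_pos
  · exact (hreg.posDef x (hsub hx)).diag_pos

/-- In the Gaussian null coordinates the Kähler form is `d(A σ₃)`, with `A = λ Δ γ₁₁` the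
coefficient of `σ₁² + σ₂²` in the base metric. The sign is that of the leading term of the
equation for `G⁺` at the horizon. -/
theorem kahlerForm_eq {n : WithTop ℕ∞} (hn : n = ∞ ∨ n = ω) {ℓ ε : ℝ} (hℓ : 0 < ℓ) {Δ : ℝ → ℝ}
    {k : Fin 3 → ℝ → ℝ} {γ : ℝ → Matrix (Fin 3) (Fin 3) ℝ} {f : Base → ℝ} {om : OneForm}
    {h J : TwoTensor} (hreg : IsRegularHorizon n ε Δ k γ) (hGR : IsGutowskiReallNH ℓ Δ k γ)
    (hsusy : IsTimelikeSusy ℓ (region ε) f om h J) (hsym : IsU1SU2Invariant ℓ (region ε) f om h J)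
    (hg : ∀ P : Spacetime, P.2 ∈ region ε → ∀ U W : Spacetime,
      gaussianNullMetric Δ k γ P U W = timelikeMetric f om h P U W) :
    ∀ p ∈ region ε,
      J p = formMat (deriv (fun x => x * Δ x * γ x 0 0) (p 0)) (p 0 * Δ (p 0) * γ (p 0) 0 0) ∧
      γ (p 0) 2 2 = deriv (fun x => x * Δ x * γ x 0 0) (p 0) ^ 2 := by
  have h0 : 0 < Δ 0 := lt_trans (by positivity) hGR.Delta_gt
  have hn1 : (1 : WithTop ℕ∞) ≤ n := by rcases hn with rfl | rfl <;> simp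
  obtain ⟨hdiag, hdata⟩ := invariant_data hreg h0 hsusy hsym hg
  have hsub : Ioo 0 ε ⊆ Ioo (-ε) ε := fun x hx => ⟨by linarith [hx.1, hx.2], hx.2⟩
  have d1 := hreg.reg_Delta.differentiableOn (ne_of_gt (lt_of_lt_of_le one_pos hn1)) |>.mono hsub
  have d2 := (hreg.reg_k 2).differentiableOn (ne_of_gt (lt_of_lt_of_le one_pos hn1)) |>.mono hsub
  have d3 := (hreg.reg_gamma 0 0).differentiableOn (ne_of_gt (lt_of_lt_of_le one_pos hn1))
    |>.mono hsub
  have d4 := (hreg.reg_gamma 2 2).differentiableOn (ne_of_gt (lt_of_lt_of_le one_pos hn1))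
    |>.mono hsub
  have hderiv : ∀ {g : ℝ → ℝ}, DifferentiableOn ℝ g (Ioo 0 ε) → ∀ x ∈ Ioo 0 ε,
      HasDerivAt g (deriv g x) x := fun hg x hx =>
    (hg.differentiableAt (isOpen_Ioo.mem_nhds hx)).hasDerivAt
  have hxne : ∀ x ∈ Ioo (0 : ℝ) ε, x ≠ 0 := fun x hx => hx.1.ne'
  have hΔne : ∀ x ∈ Ioo (0 : ℝ) ε, Δ x ≠ 0 := fun x hx => (hdiag x hx).1.ne'
  have hγ1 : ∀ x ∈ Ioo 0 ε, 0 < γ x 0 0 := fun x hx => (hreg.posDef x (hsub hx)).diag_pos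
  have hγ3 : ∀ x ∈ Ioo 0 ε, 0 < γ x 2 2 := fun x hx => (hreg.posDef x (hsub hx)).diag_pos
  have hdet : ∀ x ∈ Ioo 0 ε, 1 / (x * Δ x) * (x * (Δ x * (γ x 2 2 + k 2 x ^ 2 / Δ x ^ 2)))
      - (k 2 x / Δ x) ^ 2 = γ x 2 2 := fun x hx => by
    have := hxne x hx
    have := hΔne x hx
    field_simp
    ring
  set N : ℝ → ℝ := fun x => 1 / (x * Δ x) with hN
  set M : ℝ → ℝ := fun x => k 2 x / Δ x with hM
  set A : ℝ → ℝ := fun x => x * Δ x * γ x 0 0 with hA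
  set C : ℝ → ℝ := fun x => x * (Δ x * (γ x 2 2 + k 2 x ^ 2 / Δ x ^ 2)) with hC
  set w₀ : ℝ → ℝ := fun x => -(1 / (x * Δ x) ^ 2) with hw₀
  set w : ℝ → ℝ := fun x => -(k 2 x / (x * Δ x ^ 2)) with hw
  have dF : DifferentiableOn ℝ (fun x => x * Δ x) (Ioo 0 ε) := differentiableOn_id.mul d1
  have H : IsBlockMetric ε h N M A C (deriv N) (deriv M) (deriv A) (deriv C) := by
    refine ⟨fun p hp => (hdata p hp).2.2, hderiv ?_, hderiv ?_, hderiv ?_, hderiv ?_,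
      fun x hx => ?_, fun x hx => ?_⟩
    · exact (differentiableOn_const _).div dF fun x hx => mul_ne_zero (hxne x hx) (hΔne x hx)
    · exact d2.div d1 hΔne
    · exact dF.mul d3
    · exact differentiableOn_id.mul (d1.mul (d4.add ((d2.pow 2).div (d1.pow 2)
        fun x hx => pow_ne_zero 2 (hΔne x hx))))
    · exact mul_ne_zero (mul_ne_zero (hxne x hx) (hΔne x hx)) (hγ1 x hx).ne'
    · rw [hdet x hx]; exact (hγ3 x hx).ne'
  have dw₀ : DifferentiableOn ℝ w₀ (Ioo 0 ε) := ((differentiableOn_const _).div (dF.pow 2)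
    fun x hx => pow_ne_zero 2 (mul_ne_zero (hxne x hx) (hΔne x hx))).neg
  have dw : DifferentiableOn ℝ w (Ioo 0 ε) := (d2.div (differentiableOn_id.mul (d1.pow 2))
    fun x hx => mul_ne_zero (hxne x hx) (pow_ne_zero 2 (hΔne x hx))).neg
  have hom : ∀ q ∈ region ε, om q = ![w₀ (q 0), 0, 0, w (q 0)] := fun q hq => (hdata q hq).2.1
  obtain ⟨s, hs, hJ⟩ := invariant_kahlerForm hℓ H hsusy hsym (F := fun x => x * Δ x)
    (fun q hq => (hdata q hq).1) hom (hderiv dF) (hderiv dw₀) (hderiv dw)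
  have hs2 : s ^ 2 = 1 := by rcases hs with rfl | rfl <;> norm_num
  have hA' : ∀ x ∈ Ioo 0 ε, γ x 2 2 = deriv A x ^ 2 := fun x hx => by
    rw [← hdet x hx]
    exact (hJ _ (equator_mem_region hx)).2
  suffices hs1 : s = 1 by
    intro p hp
    refine ⟨?_, hA' _ (mem_region_coord hp)⟩
    rw [(hJ p hp).1, hs1, one_mul, one_mul]
  -- the equation for `G⁺`, with all coefficients regular at the horizon
  obtain ⟨η, hη, hηε, D⟩ := exists_horizonData hℓ hreg hGR
  set u : ℝ → ℝ := fun x => k 2 x / Δ x ^ 2 with hu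
  set a : ℝ → ℝ := fun x => Δ x * γ x 0 0 with ha
  set G : ℝ → ℝ := fiberCoeff Δ (k 2) (fun x => γ x 2 2) with hG
  have ru : ContDiffOn ℝ n u (Ioo (-η) η) := D.reg_k.div (D.reg_Δ.pow 2)
    fun x hx => pow_ne_zero 2 (D.Δ_pos x hx).ne'
  have ra : ContDiffOn ℝ n a (Ioo (-η) η) := D.reg_Δ.mul D.reg_γ₁
  have rG : ContDiffOn ℝ n G (Ioo (-η) η) := D.reg_H
  have c0 : ∀ {g : ℝ → ℝ}, ContDiffOn ℝ n g (Ioo (-η) η) → ContinuousAt g 0 := fun hg =>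
    hg.continuousOn.continuousAt (isOpen_Ioo.mem_nhds D.zero_mem)
  have c0' : ∀ {g : ℝ → ℝ}, ContDiffOn ℝ n g (Ioo (-η) η) → ContinuousAt (deriv g) 0 := fun hg =>
    (hg.continuousOn_deriv_of_isOpen isOpen_Ioo hn1).continuousAt (isOpen_Ioo.mem_nhds D.zero_mem)
  have a0 : 0 < a 0 := mul_pos (D.Δ_pos 0 D.zero_mem) (D.γ₁_pos 0 D.zero_mem)
  have key := eq_at_zero_of_eventually_eq
    (F := fun x => Δ x / 2 * (a x * (u x - x * deriv u x) / (a x + x * deriv a x) + u x))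
    (G := fun x => -(ℓ * s / 2) * (G x / (2 * a x)
      + (G x + x * deriv G x) / (2 * (a x + x * deriv a x)) - 1 - 6 * γ x 0 0 / ℓ ^ 2)) ?_ ?_ ?_
  · simp only [zero_mul, add_zero, sub_zero] at key
    have hD : 0 < Δ 0 ^ 2 - 3 / ℓ ^ 2 := by
      have h1 : (Real.sqrt 3 / ℓ) ^ 2 < Δ 0 ^ 2 := by
        have := hGR.Delta_gt
        gcongr
      rw [div_pow, Real.sq_sqrt (by norm_num)] at h1
      linarith
    have hk2 := congrFun hGR.k_eq 2
    have hg0 := congrFun (congrFun hGR.gamma_eq 0) 0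
    have hg2 := congrFun (congrFun hGR.gamma_eq 2) 2
    simp at hk2 hg0 hg2
    simp only [hu, ha, hG, fiberCoeff, hk2, hg0, hg2] at key
    obtain ⟨d, hd⟩ : ∃ d, d = Δ 0 ^ 2 - 3 / ℓ ^ 2 := ⟨_, rfl⟩
    rw [← hd] at hD key
    have e1 : -(3 * Δ 0 / (ℓ * d)) / Δ 0 ^ 2 = -(3 / (ℓ * d * Δ 0)) := by field_simp
    have e2 : Δ 0 * (Δ 0 ^ 2 / d ^ 2 + (-(3 * Δ 0 / (ℓ * d))) ^ 2 / Δ 0 ^ 2)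
        = Δ 0 * (d + 12 / ℓ ^ 2) / d ^ 2 := by
      field_simp
      rw [hd]
      field_simp
      ring
    rw [e1, e2] at key
    field_simp at key
    linarith
  · exact ((c0 D.reg_Δ).div_const 2).mul ((((c0 ra).mul ((c0 ru).sub
      (continuousAt_id.mul (c0' ru)))).div ((c0 ra).add (continuousAt_id.mul (c0' ra)))
        (by simpa using a0.ne')).add (c0 ru))
  · exact continuousAt_const.mul (((((c0 rG).div (continuousAt_const.mul (c0 ra))
      (by simpa using a0.ne')).add (((c0 rG).add (continuousAt_id.mul (c0' rG))).div
        (continuousAt_const.mul ((c0 ra).add (continuousAt_id.mul (c0' ra))))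
        (by simpa using a0.ne'))).sub continuousAt_const).sub
        ((continuousAt_const.mul (c0 D.reg_γ₁)).div_const _))
  · filter_upwards [Ioo_mem_nhdsGT_zero hη] with x hx
    have hxη : x ∈ Ioo (-η) η := ⟨by linarith [hx.1, hx.2], hx.2⟩
    have hxε : x ∈ Ioo 0 ε := ⟨hx.1, hx.2.trans_le hηε⟩
    have hp := equator_mem_region hxε
    have hx0 := hxne x hxε
    have hΔ0 := hΔne x hxε
    have hγ0 := (hγ1 x hxε).ne'
    have hdA : deriv A x ≠ 0 := fun hz => by
      have := hA' x hxε
      rw [hz] at this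
      have := hγ3 x hxε
      simp at *
      linarith
    have hd : ∀ {g : ℝ → ℝ}, ContDiffOn ℝ n g (Ioo (-η) η) → HasDerivAt g (deriv g x) x :=
      fun hg => ((hg.contDiffAt (isOpen_Ioo.mem_nhds hxη)).differentiableAt
        (ne_of_gt (lt_of_lt_of_le one_pos hn1))).hasDerivAt
    have hext := ext1_radial (isOpen_region ε) hp hom (hderiv dw₀ _ hxε) (hderiv dw _ hxε)
    have e := (hsusy.Gplus_components hℓ hp hs2 (H.eq _ hp) (hJ _ hp).1 hext
      (H.A_ne _ hxε) hdA (hJ _ hp).2).1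
    rw [H.ricciForm_1_2 hp (hJ _ hp).1 (hJ _ hp).2, (hdata _ hp).1] at e
    have hp0 : (![x, Real.pi / 2, 0, 0] : Base) 0 = x := rfl
    rw [hp0] at e
    have eA : deriv A x = a x + x * deriv a x := by
      have h1 : A = fun y => y * a y := by funext y; simp only [hA, ha]; ring
      rw [h1]
      refine HasDerivAt.deriv (((hasDerivAt_id x).mul (hd ra)).congr_deriv ?_)
      simp
    have eC : deriv C x = G x + x * deriv G x := by
      have h1 : C = fun y => y * G y := rfl
      rw [h1]
      refine HasDerivAt.deriv (((hasDerivAt_id x).mul (hd rG)).congr_deriv ?_)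
      simp
    have ew : deriv w x = u x / x ^ 2 - deriv u x / x := by
      have h1 : w = fun y => -(u y / y) := by
        funext y; simp only [hw, hu]; rw [div_div]; ring
      rw [h1]
      refine HasDerivAt.deriv (((hd ru).div (hasDerivAt_id x) hx0).neg.congr_deriv ?_)
      simp
      field_simp
      ring
    have eA0 : A x = x * a x := by simp only [hA, ha]; ring
    have eC0 : C x = x * G x := rfl
    have ew0 : w x = -(u x / x) := by simp only [hw, hu]; rw [div_div]; ring
    have hax : a x ≠ 0 := mul_ne_zero hΔ0 hγ0
    have eγ : γ x 0 0 = a x / Δ x := by simp only [ha]; field_simp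
    rw [eA] at hdA
    rw [eA, eC, ew, eA0, eC0, ew0] at e
    rw [eγ]
    clear_value u a G
    generalize deriv a x = a' at *
    generalize a x + x * a' = b at *
    field_simp at e ⊢
    linear_combination e

/-! ### Radial coordinates -/

theorem exists_Ioo_forall_pos {η : ℝ} (hη : 0 < η) {g : ℝ → ℝ} (hg : ContinuousAt g 0)
    (h0 : 0 < g 0) : ∃ η', 0 < η' ∧ η' ≤ η ∧ ∀ x ∈ Ioo (-η') η', 0 < g x := by
  obtain ⟨b, hb, hball⟩ := Metric.eventually_nhds_iff_ball.1 (hg.eventually (lt_mem_nhds h0))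
  rw [Real.ball_zero_eq_Ioo] at hball
  exact ⟨min b η, lt_min hb hη, min_le_right _ _, fun x hx => hball x
    ⟨by linarith [hx.1, min_le_left b η], by linarith [hx.2, min_le_left b η]⟩⟩

theorem Ioo_zero_subset {η : ℝ} : Ioo 0 η ⊆ Ioo (-η) η := fun _ hx =>
  ⟨by linarith [hx.1, hx.2], hx.2⟩

theorem regularity_ne_zero {n : WithTop ℕ∞} (hn : n = ∞ ∨ n = ω) : n ≠ 0 := by
  rcases hn with rfl | rfl <;> simp

theorem infty_le_regularity {n : WithTop ℕ∞} (hn : n = ∞ ∨ n = ω) : ∞ ≤ n := by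
  rcases hn with rfl | rfl <;> simp

theorem one_le_regularity {n : WithTop ℕ∞} (hn : n = ∞ ∨ n = ω) : 1 ≤ n := by
  rcases hn with rfl | rfl <;> simp

theorem hasDerivAt_of_regular {n : WithTop ℕ∞} (hn : n = ∞ ∨ n = ω) {η x : ℝ} {g : ℝ → ℝ}
    (hg : ContDiffOn ℝ n g (Ioo (-η) η)) (hx : x ∈ Ioo (-η) η) : HasDerivAt g (deriv g x) x :=
  ((hg.contDiffAt (isOpen_Ioo.mem_nhds hx)).differentiableAt (regularity_ne_zero hn)).hasDerivAt

theorem continuousAt_of_regular {n : WithTop ℕ∞} {η : ℝ} {g : ℝ → ℝ} (hη : 0 < η)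
    (hg : ContDiffOn ℝ n g (Ioo (-η) η)) : ContinuousAt g 0 :=
  hg.continuousOn.continuousAt (isOpen_Ioo.mem_nhds ⟨by linarith, hη⟩)

/-- If `q > 0` is regular, then `s = λ q(λ)`, the square of a radial coordinate, is a regular
coordinate near `λ = 0`. -/
theorem exists_sq_coordinate {n : WithTop ℕ∞} (hn : n = ∞ ∨ n = ω) {η : ℝ} (hη : 0 < η)
    {q : ℝ → ℝ} (hq : ContDiffOn ℝ n q (Ioo (-η) η)) (hpos : 0 < q 0) :
    ∃ (δ σ : ℝ) (R : ℝ → ℝ), 0 < δ ∧ δ ≤ η ∧ 0 < σ ∧ ContDiffOn ℝ n R (Ioo (-σ) σ) ∧ R 0 = 0 ∧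
      (∀ x ∈ Ioo 0 δ, x * q x ∈ Ioo 0 σ ∧ 0 < q x + x * deriv q x ∧ R (x * q x) = x) ∧
      (∀ s ∈ Ioo (-σ) σ, R s ∈ Ioo (-η) η ∧ R s * q (R s) = s) ∧
      (∀ s ∈ Ioo 0 σ, R s ∈ Ioo 0 η) := by
  have hd : ∀ x ∈ Ioo (-η) η, HasDerivAt (fun x => x * q x) (q x + x * deriv q x) x :=
    fun x hx => ((hasDerivAt_id x).mul (hasDerivAt_of_regular hn hq hx)).congr_deriv (by simp)
  obtain ⟨δ, σ, R, h1, h2, h3, h4, h5, h6, h7, h8, h9⟩ := exists_regular_inverse hn hη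
    (S := fun x => x * q x) (contDiffOn_id.mul hq) (by simp)
    (by rw [(hd 0 ⟨by linarith, hη⟩).deriv]; simpa using hpos)
  refine ⟨δ, σ, R, h1, h2, h3, h4, h5, fun x hx => ?_, fun s hs => ⟨(h8 s hs).1, (h8 s hs).2.2⟩,
    fun s hs => ⟨h9 s hs, (h8 s (Ioo_zero_subset hs)).1.2⟩⟩
  obtain ⟨a1, a2, a3⟩ := h6 x (Ioo_zero_subset hx)
  refine ⟨⟨h7 x hx, a2.2⟩, ?_, a3⟩
  rwa [(hd x ⟨by linarith [hx.1, hx.2], hx.2.trans_le h2⟩).deriv] at a1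

theorem hasDerivAt_sqrt_mul {q : ℝ → ℝ} {q' x : ℝ} (hx : 0 < x) (hq : 0 < q x)
    (hd : HasDerivAt q q' x) :
    HasDerivAt (fun y => Real.sqrt (y * q y)) ((q x + x * q') / (2 * Real.sqrt (x * q x))) x := by
  have h1 : HasDerivAt (fun y => y * q y) (q x + x * q') x :=
    ((hasDerivAt_id x).mul hd).congr_deriv (by simp)
  exact h1.sqrt (mul_pos hx hq).ne'

/-- `√x Q` is a primitive of `g / √x` when `x Q' + Q / 2 = g`. -/
theorem hasDerivAt_sqrt_mul_sq {Q : ℝ → ℝ} {Q' g x : ℝ} (hx : 0 < x) (hQ : 0 < Q x)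
    (hd : HasDerivAt Q Q' x) (hg : x * Q' + Q x / 2 = g) :
    HasDerivAt (fun y => Real.sqrt (y * Q y ^ 2)) (g / Real.sqrt x) x := by
  refine (hasDerivAt_sqrt_mul (q := fun x => Q x ^ 2) hx (pow_pos hQ 2) (hd.pow 2)).congr_deriv ?_
  have h1 := (Real.sqrt_pos.2 hx).ne'
  rw [Real.sqrt_mul hx.le, Real.sqrt_sq hQ.le, ← hg]
  field_simp
  simp
  ring

theorem contDiffOn_sqrt_mul {n : WithTop ℕ∞} (hn : n = ∞ ∨ n = ω) {δ : ℝ} {q : ℝ → ℝ}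
    (hq : ContDiffOn ℝ n q (Ioo (-δ) δ)) (hpos : ∀ x ∈ Ioo (-δ) δ, 0 < q x) :
    ContDiffOn ℝ ∞ (fun y => Real.sqrt (y * q y)) (Ioo 0 δ) :=
  ((contDiffOn_id.mul (hq.mono Ioo_zero_subset)).of_le (infty_le_regularity hn)).sqrt
    fun x hx => (mul_pos hx.1 (hpos x (Ioo_zero_subset hx))).ne'

/-- The proper distance from the horizon in the base metric is `√λ Q(λ)`, with `Q` regular. -/
theorem HorizonData.exists_properDistance {n : WithTop ℕ∞} (hn : n = ∞ ∨ n = ω) {η : ℝ}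
    {Δ k₃ γ₁ γ₃ : ℝ → ℝ} (D : HorizonData n η Δ k₃ γ₁ γ₃) :
    ∃ (η' : ℝ) (Q : ℝ → ℝ), 0 < η' ∧ η' ≤ η ∧ ContDiffOn ℝ n Q (Ioo (-η') η') ∧
      (∀ x ∈ Ioo (-η') η', 0 < Q x) ∧
      (∀ x ∈ Ioo (-η') η', x * deriv Q x + Q x / 2 = Real.sqrt (γ₃ x / fiberCoeff Δ k₃ γ₃ x)) ∧
      Q 0 = 2 * Real.sqrt (γ₃ 0 / fiberCoeff Δ k₃ γ₃ 0) := by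
  have hpos : ∀ x ∈ Ioo (-η) η, 0 < γ₃ x / fiberCoeff Δ k₃ γ₃ x := fun x hx =>
    div_pos (D.γ₃_pos x hx) (D.H_pos hx)
  obtain ⟨η₁, Q, h1, h2, h3, h4⟩ := exists_regular_solution hn D.pos
    ((D.reg_γ₃.div D.reg_H fun x hx => (D.H_pos hx).ne').sqrt fun x hx => (hpos x hx).ne') 0
  have hQ0 : Q 0 = 2 * Real.sqrt (γ₃ 0 / fiberCoeff Δ k₃ γ₃ 0) := by
    have := h4 0 ⟨by linarith, h1⟩
    norm_num at this
    linarith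
  obtain ⟨η₂, g1, g2, g3⟩ := exists_Ioo_forall_pos h1 (continuousAt_of_regular h1 h3)
    (by rw [hQ0]; have := Real.sqrt_pos.2 (hpos 0 D.zero_mem); linarith)
  have hsub : Ioo (-η₂) η₂ ⊆ Ioo (-η₁) η₁ := Ioo_subset_Ioo (by linarith) g2
  refine ⟨η₂, Q, g1, g2.trans h2, h3.mono hsub, g3, fun x hx => ?_, hQ0⟩
  refine Eq.trans ?_ (h4 x (hsub hx))
  simp
  ring

/-- `J = d(A σ₃)` in the Gaussian null coordinates is the pull-back of `d(B σ₃)` when `B ∘ r = A`.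
-/
theorem formMatches_of_eq {δ : ℝ} {J : TwoTensor} {r χ B A A' B' : ℝ → ℝ}
    (hJ : ∀ p ∈ region δ, J p = formMat (A' (p 0)) (A (p 0)))
    (dr : ∀ x ∈ Ioo 0 δ, DifferentiableAt ℝ r x) (dχ : ∀ x ∈ Ioo 0 δ, DifferentiableAt ℝ χ x)
    (hB : ∀ x ∈ Ioo 0 δ, B (r x) = A x) (dB : ∀ x ∈ Ioo 0 δ, HasDerivAt B (B' x) (r x))
    (hA' : ∀ x ∈ Ioo 0 δ, B' x * deriv r x = A' x) : FormMatches δ J r χ B := by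
  intro p hp u w
  have hx := mem_region_coord hp
  have h1 := hasFDerivAt_baseChange (dr _ hx).hasDerivAt (dχ _ hx).hasDerivAt
  have h2 : ext1 (sigma3Form B) (baseChange r χ p) = formMat (B' (p 0)) (B (r (p 0))) :=
    ext1_sigma3Form (dB _ hx)
  have hsc := Real.sin_sq_add_cos_sq (χ (p 0))
  simp only [eval2, (h1 _).2, coframe_baseChange, h2, hJ p hp, hB _ hx, ← hA' _ hx,
    Fin.sum_univ_four]
  simp [formMat]
  linear_combination (A (p 0) * (coframe p u 1 * coframe p w 2
    - coframe p u 2 * coframe p w 1)) * hsc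

/-! ### A solution with a horizon in standard charts -/

theorem HorizonData.contDiffOn_coeff {n : WithTop ℕ∞} {η : ℝ} {Δ k₃ γ₁ γ₃ : ℝ → ℝ}
    (D : HorizonData n η Δ k₃ γ₁ γ₃) :
    ContDiffOn ℝ n (fun x => x * Δ x * γ₁ x) (Ioo (-η) η) :=
  (contDiffOn_id.mul D.reg_Δ).mul D.reg_γ₁

theorem HorizonData.deriv_coeff_zero {n : WithTop ℕ∞} (hn : n = ∞ ∨ n = ω) {η : ℝ}
    {Δ k₃ γ₁ γ₃ : ℝ → ℝ} (D : HorizonData n η Δ k₃ γ₁ γ₃) :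
    deriv (fun x => x * Δ x * γ₁ x) 0 = Δ 0 * γ₁ 0 := by
  have h1 := hasDerivAt_of_regular hn D.reg_Δ D.zero_mem
  have h2 := hasDerivAt_of_regular hn D.reg_γ₁ D.zero_mem
  refine HasDerivAt.deriv ((((hasDerivAt_id (0 : ℝ)).mul h1).mul h2).congr_deriv ?_)
  simp

theorem tendsto_sqrt_mul {q : ℝ → ℝ} (hq : ContinuousAt q 0) :
    Tendsto (fun x => Real.sqrt (x * q x)) (𝓝[>] 0) (𝓝 0) := by
  have h : ContinuousAt (fun x => Real.sqrt (x * q x)) 0 :=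
    (continuousAt_id.mul hq).sqrt
  have := h.tendsto
  simp only [zero_mul, Real.sqrt_zero] at this
  exact this.mono_left nhdsWithin_le_nhds

/-- The chart with `ρ` the proper distance from the horizon in the base metric. -/
theorem exists_properDistance_chart {n : WithTop ℕ∞} (hn : n = ∞ ∨ n = ω) {η : ℝ}
    {Δ k₃ γ₁ γ₃ : ℝ → ℝ} {k : Fin 3 → ℝ → ℝ} {γ : ℝ → Matrix (Fin 3) (Fin 3) ℝ} {J : TwoTensor}
    (D : HorizonData n η Δ k₃ γ₁ γ₃)
    (hk : ∀ x ∈ Ioo 0 η, (fun i => k i x) = ![0, 0, k₃ x])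
    (hγ : ∀ x ∈ Ioo 0 η, γ x = Matrix.diagonal ![γ₁ x, γ₁ x, γ₃ x])
    (hJ : ∀ p ∈ region η,
      J p = formMat (deriv (fun x => x * Δ x * γ₁ x) (p 0)) (p 0 * Δ (p 0) * γ₁ (p 0)))
    (hA' : ∀ x ∈ Ioo 0 η, γ₃ x = deriv (fun x => x * Δ x * γ₁ x) x ^ 2) :
    ∃ (δ : ℝ) (T ρ χ a c f w : ℝ → ℝ), 0 < δ ∧ δ ≤ η ∧
      IsStandardChart δ Δ k γ T ρ χ (fun _ => 1) (fun x => a x ^ 2) (fun x => c x ^ 2) f w ∧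
      Tendsto ρ (𝓝[>] 0) (𝓝 0) ∧
      (∀ x ∈ Ioo 0 δ, c (ρ x) = deriv (fun y => a y ^ 2) (ρ x)) ∧
      FormMatches δ J ρ χ (fun x => a x ^ 2) := by
  set A : ℝ → ℝ := fun x => x * Δ x * γ₁ x with hA
  have rA : ContDiffOn ℝ n A (Ioo (-η) η) := D.contDiffOn_coeff
  -- `A'` is positive near the horizon, so that it is the positive root of `γ₃`
  obtain ⟨η₁, p1, p2, p3⟩ := exists_Ioo_forall_pos D.pos
    ((rA.continuousOn_deriv_of_isOpen isOpen_Ioo (one_le_regularity hn)).continuousAt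
      (isOpen_Ioo.mem_nhds D.zero_mem)) (by
      rw [D.deriv_coeff_zero hn]
      exact mul_pos (D.Δ_pos 0 D.zero_mem) (D.γ₁_pos 0 D.zero_mem))
  obtain ⟨η₂, Q, q1, q2, rQ, hQ, hode, -⟩ := (D.mono p1 p2).exists_properDistance hn
  obtain ⟨δ, σ, R, d1, d2, d3, rR, -, hR, -, -⟩ := exists_sq_coordinate hn q1 (rQ.pow 2)
    (pow_pos (hQ 0 ⟨by linarith, q1⟩) 2)
  have hδη : δ ≤ η := d2.trans (q2.trans p2)
  have hsub : ∀ {x}, x ∈ Ioo 0 δ → x ∈ Ioo 0 η := fun hx => ⟨hx.1, hx.2.trans_le hδη⟩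
  have hsub' : ∀ {x}, x ∈ Ioo 0 δ → x ∈ Ioo (-η) η := fun hx => Ioo_zero_subset (hsub hx)
  have hsub₂ : ∀ {x}, x ∈ Ioo 0 δ → x ∈ Ioo (-η₂) η₂ := fun hx =>
    Ioo_zero_subset ⟨hx.1, hx.2.trans_le d2⟩
  set ρ : ℝ → ℝ := fun x => Real.sqrt (x * Q x ^ 2) with hρ
  have hρpos : ∀ x ∈ Ioo 0 δ, 0 < ρ x := fun x hx =>
    Real.sqrt_pos.2 (mul_pos hx.1 (pow_pos (hQ x (hsub₂ hx)) 2))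
  have hρsq : ∀ x ∈ Ioo 0 δ, ρ x ^ 2 = x * Q x ^ 2 := fun x hx =>
    Real.sq_sqrt (mul_pos hx.1 (pow_pos (hQ x (hsub₂ hx)) 2)).le
  have hRρ : ∀ x ∈ Ioo 0 δ, R (ρ x ^ 2) = x := fun x hx => by
    rw [hρsq x hx]; exact (hR x hx).2.2
  have rρ : ContDiffOn ℝ ∞ ρ (Ioo 0 δ) := by
    have hs : Ioo (-δ) δ ⊆ Ioo (-η₂) η₂ := Ioo_subset_Ioo (by linarith) d2
    exact contDiffOn_sqrt_mul hn ((rQ.pow 2).mono hs) fun x hx => pow_pos (hQ x (hs hx)) 2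
  set g : ℝ → ℝ := fun x => Real.sqrt (γ₃ x / fiberCoeff Δ k₃ γ₃ x) with hg
  have hgpos : ∀ x ∈ Ioo 0 δ, 0 < g x := fun x hx =>
    Real.sqrt_pos.2 (div_pos (D.γ₃_pos x (hsub' hx)) (D.H_pos (hsub' hx)))
  have hgsq : ∀ x ∈ Ioo 0 δ, g x ^ 2 = γ₃ x / fiberCoeff Δ k₃ γ₃ x := fun x hx =>
    Real.sq_sqrt (div_pos (D.γ₃_pos x (hsub' hx)) (D.H_pos (hsub' hx))).le
  have dρ : ∀ x ∈ Ioo 0 δ, HasDerivAt ρ (g x / Real.sqrt x) x := fun x hx =>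
    hasDerivAt_sqrt_mul_sq hx.1 (hQ x (hsub₂ hx)) (hasDerivAt_of_regular hn rQ (hsub₂ hx))
      (hode x (hsub₂ hx))
  have hρ' : ∀ x ∈ Ioo 0 δ, deriv ρ x ^ 2 = γ₃ x / (x * fiberCoeff Δ k₃ γ₃ x) := fun x hx => by
    rw [(dρ x hx).deriv, div_pow, hgsq x hx, Real.sq_sqrt hx.1.le, div_div, mul_comm x]
  have hApos : ∀ x ∈ Ioo 0 δ, 0 < A x := fun x hx =>
    mul_pos (mul_pos hx.1 (D.Δ_pos x (hsub' hx))) (D.γ₁_pos x (hsub' hx))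
  have hCpos : ∀ x ∈ Ioo 0 δ, 0 < x * fiberCoeff Δ k₃ γ₃ x := fun x hx =>
    mul_pos hx.1 (D.H_pos (hsub' hx))
  set a : ℝ → ℝ := fun y => Real.sqrt (A (R (y ^ 2))) with ha
  set c : ℝ → ℝ := fun y => Real.sqrt (R (y ^ 2) * fiberCoeff Δ k₃ γ₃ (R (y ^ 2))) with hc
  have ha2 : ∀ x ∈ Ioo 0 δ, a (ρ x) ^ 2 = A x := fun x hx => by
    simp only [ha, hRρ x hx]; exact Real.sq_sqrt (hApos x hx).le
  have hc2 : ∀ x ∈ Ioo 0 δ, c (ρ x) ^ 2 = x * fiberCoeff Δ k₃ γ₃ x := fun x hx => by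
    simp only [hc, hRρ x hx]; exact Real.sq_sqrt (hCpos x hx).le
  -- `a² ∘ ρ = A` gives the derivative of `a²`
  have da : ∀ x ∈ Ioo 0 δ, DifferentiableAt ℝ (fun y => a y ^ 2) (ρ x) := fun x hx => by
    have hs : ρ x ^ 2 ∈ Ioo (-σ) σ := by
      rw [hρsq x hx]; exact Ioo_zero_subset (hR x hx).1
    have h1 : DifferentiableAt ℝ R (ρ x ^ 2) := (hasDerivAt_of_regular hn rR hs).differentiableAt
    have h2 : DifferentiableAt ℝ A (R (ρ x ^ 2)) := by
      rw [hRρ x hx]; exact (hasDerivAt_of_regular hn rA (hsub' hx)).differentiableAt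
    have h3 : DifferentiableAt ℝ (fun y => A (R (y ^ 2))) (ρ x) :=
      DifferentiableAt.comp (ρ x) (g := A) (f := fun y => R (y ^ 2)) h2
        (DifferentiableAt.comp (ρ x) (g := R) (f := fun y => y ^ 2) h1 (by fun_prop))
    have h4 : 0 < A (R (ρ x ^ 2)) := by rw [hRρ x hx]; exact hApos x hx
    refine h3.congr_of_eventuallyEq ?_
    filter_upwards [h3.continuousAt.eventually (lt_mem_nhds h4)] with y hy
    exact Real.sq_sqrt hy.le
  have hda : ∀ x ∈ Ioo 0 δ, deriv (fun y => a y ^ 2) (ρ x) * deriv ρ x = deriv A x :=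
    fun x hx => by
      have h1 := (da x hx).hasDerivAt.comp x (dρ x hx)
      have h2 : (fun y => a y ^ 2) ∘ ρ =ᶠ[𝓝 x] A := by
        filter_upwards [isOpen_Ioo.mem_nhds hx] with y hy using ha2 y hy
      rw [(dρ x hx).deriv, ← h2.deriv_eq, h1.deriv]
  have hρ'pos : ∀ x ∈ Ioo 0 δ, 0 < deriv ρ x := fun x hx => by
    rw [(dρ x hx).deriv]
    exact div_pos (hgpos x hx) (Real.sqrt_pos.2 hx.1)
  obtain ⟨T, χ, H⟩ := exists_standardChart d1 (k := k) (γ := γ) (Δ := Δ) (k₃ := k₃) (γ₁ := γ₁)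
    (γ₃ := γ₃) (r := ρ) (N := fun _ => 1) (A := fun x => a x ^ 2) (C := fun x => c x ^ 2)
    (f := fun y => R (y ^ 2) * Δ (R (y ^ 2)))
    (w := fun y => -(k₃ (R (y ^ 2)) / (R (y ^ 2) * Δ (R (y ^ 2)) ^ 2)))
    (fun x hx => hk x (hsub hx)) (fun x hx => hγ x (hsub hx))
    (fun x hx => D.Δ_pos x (hsub' hx)) (fun x hx => D.γ₃_pos x (hsub' hx))
    ((D.reg_Δ.mono fun x hx => hsub' hx).of_le (infty_le_regularity hn))
    ((D.reg_k.mono fun x hx => hsub' hx).of_le (infty_le_regularity hn))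
    ((D.reg_γ₃.mono fun x hx => hsub' hx).of_le (infty_le_regularity hn))
    rρ hρpos (fun x hx => (hρ'pos x hx).ne') (fun x hx => by
      refine ⟨?_, ha2 x hx, hc2 x hx, ?_, ?_⟩
      · rw [hRρ x hx]
      · rw [hRρ x hx]
      · rw [one_mul]; exact hρ' x hx)
  refine ⟨δ, T, ρ, χ, a, c, _, _, d1, hδη, H, tendsto_sqrt_mul ?_, fun x hx => ?_, ?_⟩
  · exact (continuousAt_of_regular q1 rQ).pow 2
  · have h1 : c (ρ x) * deriv ρ x = deriv A x := by
      have hcpos : 0 ≤ c (ρ x) := Real.sqrt_nonneg _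
      refine (pow_left_inj₀ (mul_nonneg hcpos (hρ'pos x hx).le)
        (p3 x (Ioo_zero_subset ⟨hx.1, hx.2.trans_le (d2.trans q2)⟩)).le two_ne_zero).1 ?_
      rw [mul_pow, hc2 x hx, hρ' x hx, ← hA' x (hsub hx)]
      rw [← mul_div_assoc, mul_div_cancel_left₀ _ (hCpos x hx).ne']
    exact mul_right_cancel₀ (hρ'pos x hx).ne' (h1.trans (hda x hx).symm)
  · refine formMatches_of_eq (A := A) (A' := deriv A) (fun p hp => hJ p ?_)
      (fun x hx => (dρ x hx).differentiableAt) (fun x hx => ?_) ha2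
      (fun x hx => (da x hx).hasDerivAt) hda
    · exact ⟨hp.1, hp.2.1.trans_le hδη, hp.2.2⟩
    · exact ((H.smooth_chi.contDiffAt (isOpen_Ioo.mem_nhds hx)).differentiableAt (by simp))

/-- The chart with `r²/4` the coefficient of `σ₁² + σ₂²` in the base metric. -/
theorem exists_areal_chart {n : WithTop ℕ∞} (hn : n = ∞ ∨ n = ω) {η : ℝ}
    {Δ k₃ γ₁ γ₃ : ℝ → ℝ} {k : Fin 3 → ℝ → ℝ} {γ : ℝ → Matrix (Fin 3) (Fin 3) ℝ} {J : TwoTensor}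
    (D : HorizonData n η Δ k₃ γ₁ γ₃)
    (hk : ∀ x ∈ Ioo 0 η, (fun i => k i x) = ![0, 0, k₃ x])
    (hγ : ∀ x ∈ Ioo 0 η, γ x = Matrix.diagonal ![γ₁ x, γ₁ x, γ₃ x])
    (hJ : ∀ p ∈ region η,
      J p = formMat (deriv (fun x => x * Δ x * γ₁ x) (p 0)) (p 0 * Δ (p 0) * γ₁ (p 0)))
    (hA' : ∀ x ∈ Ioo 0 η, γ₃ x = deriv (fun x => x * Δ x * γ₁ x) x ^ 2) :
    ∃ (δ : ℝ) (T r χ V f w : ℝ → ℝ), 0 < δ ∧ δ ≤ η ∧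
      IsStandardChart δ Δ k γ T r χ
        (fun x => 1 / V x) (fun x => x ^ 2 / 4) (fun x => x ^ 2 * V x / 4) f w ∧
      FormMatches δ J r χ (fun x => x ^ 2 / 4) := by
  set A : ℝ → ℝ := fun x => x * Δ x * γ₁ x with hA
  set q : ℝ → ℝ := fun x => 4 * (Δ x * γ₁ x) with hq
  have rq : ContDiffOn ℝ n q (Ioo (-η) η) := contDiffOn_const.mul (D.reg_Δ.mul D.reg_γ₁)
  have hqpos : ∀ x ∈ Ioo (-η) η, 0 < q x := fun x hx =>
    mul_pos four_pos (mul_pos (D.Δ_pos x hx) (D.γ₁_pos x hx))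
  obtain ⟨δ, σ, R, d1, d2, -, -, -, hR, -, -⟩ :=
    exists_sq_coordinate hn D.pos rq (hqpos 0 D.zero_mem)
  have hsub : ∀ {x}, x ∈ Ioo 0 δ → x ∈ Ioo 0 η := fun hx => ⟨hx.1, hx.2.trans_le d2⟩
  have hsub' : ∀ {x}, x ∈ Ioo 0 δ → x ∈ Ioo (-η) η := fun hx => Ioo_zero_subset (hsub hx)
  set r : ℝ → ℝ := fun x => Real.sqrt (x * q x) with hr
  have hrpos : ∀ x ∈ Ioo 0 δ, 0 < r x := fun x hx =>
    Real.sqrt_pos.2 (mul_pos hx.1 (hqpos x (hsub' hx)))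
  have hrsq : ∀ x ∈ Ioo 0 δ, r x ^ 2 = x * q x := fun x hx =>
    Real.sq_sqrt (mul_pos hx.1 (hqpos x (hsub' hx))).le
  have hr4 : ∀ x ∈ Ioo 0 δ, r x ^ 2 / 4 = A x := fun x hx => by
    rw [hrsq x hx]; simp only [hq, hA]; ring
  have hRr : ∀ x ∈ Ioo 0 δ, R (r x ^ 2) = x := fun x hx => by
    rw [hrsq x hx]; exact (hR x hx).2.2
  have rr : ContDiffOn ℝ ∞ r (Ioo 0 δ) := by
    have hs : Ioo (-δ) δ ⊆ Ioo (-η) η := Ioo_subset_Ioo (by linarith) d2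
    exact contDiffOn_sqrt_mul hn (rq.mono hs) fun x hx => hqpos x (hs hx)
  have dA : ∀ x ∈ Ioo 0 δ, deriv A x = (q x + x * deriv q x) / 4 := fun x hx => by
    have h1 : A = fun y => y * q y / 4 := by funext y; simp only [hq, hA]; ring
    rw [h1]
    exact ((((hasDerivAt_id x).mul (hasDerivAt_of_regular hn rq (hsub' hx))).div_const
      4).congr_deriv (by simp)).deriv
  have dr : ∀ x ∈ Ioo 0 δ, HasDerivAt r (2 * deriv A x / r x) x := fun x hx => by
    refine (hasDerivAt_sqrt_mul hx.1 (hqpos x (hsub' hx))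
      (hasDerivAt_of_regular hn rq (hsub' hx))).congr_deriv ?_
    rw [dA x hx]
    change _ / (2 * r x) = _
    have := (hrpos x hx).ne'
    field_simp
    ring
  have hApos : ∀ x ∈ Ioo 0 δ, 0 < A x := fun x hx =>
    mul_pos (mul_pos hx.1 (D.Δ_pos x (hsub' hx))) (D.γ₁_pos x (hsub' hx))
  have hCpos : ∀ x ∈ Ioo 0 δ, 0 < x * fiberCoeff Δ k₃ γ₃ x := fun x hx =>
    mul_pos hx.1 (D.H_pos (hsub' hx))
  obtain ⟨T, χ, H⟩ := exists_standardChart d1 (k := k) (γ := γ) (Δ := Δ) (k₃ := k₃) (γ₁ := γ₁)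
    (γ₃ := γ₃) (r := r)
    (N := fun y => 1 / (fun y => R (y ^ 2) * fiberCoeff Δ k₃ γ₃ (R (y ^ 2)) / A (R (y ^ 2))) y)
    (A := fun y => y ^ 2 / 4)
    (C := fun y => y ^ 2 *
      (fun y => R (y ^ 2) * fiberCoeff Δ k₃ γ₃ (R (y ^ 2)) / A (R (y ^ 2))) y / 4)
    (f := fun y => R (y ^ 2) * Δ (R (y ^ 2)))
    (w := fun y => -(k₃ (R (y ^ 2)) / (R (y ^ 2) * Δ (R (y ^ 2)) ^ 2)))
    (fun x hx => hk x (hsub hx)) (fun x hx => hγ x (hsub hx))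
    (fun x hx => D.Δ_pos x (hsub' hx)) (fun x hx => D.γ₃_pos x (hsub' hx))
    ((D.reg_Δ.mono fun x hx => hsub' hx).of_le (infty_le_regularity hn))
    ((D.reg_k.mono fun x hx => hsub' hx).of_le (infty_le_regularity hn))
    ((D.reg_γ₃.mono fun x hx => hsub' hx).of_le (infty_le_regularity hn))
    rr hrpos (fun x hx => by
      rw [(dr x hx).deriv, dA x hx]
      have h1 := (hR x hx).2.1
      have h2 := hrpos x hx
      positivity) (fun x hx => by
      have h1 := (hApos x hx).ne'
      have h2 := (hCpos x hx).ne'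
      refine ⟨?_, hr4 x hx, ?_, ?_, ?_⟩
      · rw [hRr x hx]
      · change r x ^ 2 * (R (r x ^ 2) * _ / A (R (r x ^ 2))) / 4 = x * fiberCoeff Δ k₃ γ₃ x
        rw [hRr x hx, mul_div_right_comm, hr4 x hx, mul_div_cancel₀ _ h1]
      · rw [hRr x hx]
      · change 1 / (R (r x ^ 2) * _ / A (R (r x ^ 2))) * deriv r x ^ 2
          = γ₃ x / (x * fiberCoeff Δ k₃ γ₃ x)
        rw [hRr x hx, (dr x hx).deriv, div_pow, mul_pow, ← hA' x (hsub hx), one_div_div,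
          show r x ^ 2 = 4 * A x by rw [← hr4 x hx]; ring]
        rw [div_mul_div_comm, div_eq_div_iff (by positivity) h2]
        ring)
  refine ⟨δ, T, r, χ, _, _, _, d1, d2, H, ?_⟩
  refine formMatches_of_eq (A := A) (A' := deriv A) (B' := fun x => r x / 2)
    (fun p hp => hJ p ⟨hp.1, hp.2.1.trans_le d2, hp.2.2⟩)
    (fun x hx => (dr x hx).differentiableAt) (fun x hx => ?_) hr4 (fun x hx => ?_) (fun x hx => ?_)
  · exact ((H.smooth_chi.contDiffAt (isOpen_Ioo.mem_nhds hx)).differentiableAt (by simp))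
  · refine (((hasDerivAt_pow 2 (r x)).div_const 4)).congr_deriv ?_
    simp
    ring
  · rw [(dr x hx).deriv]
    have := (hrpos x hx).ne'
    field_simp

theorem isBigO_sq_of_differentiableAt {B : ℝ → ℝ} (hB : DifferentiableAt ℝ B 0) :
    (fun x : ℝ => B (x ^ 2) - B 0) =O[𝓝[>] 0] (fun x : ℝ => x ^ 2) := by
  have h : Tendsto (fun x : ℝ => x ^ 2) (𝓝[>] 0) (𝓝 0) := by
    have : ContinuousAt (fun x : ℝ => x ^ 2) 0 := by fun_prop
    have := this.tendsto
    simp only [ne_eq, OfNat.ofNat_ne_zero, not_false_eq_true, zero_pow] at this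
    exact this.mono_left nhdsWithin_le_nhds
  simpa [Function.comp_def] using hB.isBigO_sub.comp_tendsto h

theorem isBigO_fourth_of_eq {B F : ℝ → ℝ} {σ : ℝ} (hσ : 0 < σ) (hB : DifferentiableAt ℝ B 0)
    (hF : ∀ x, 0 < x → x ^ 2 < σ → F x = x ^ 2 * B (x ^ 2)) :
    (fun x : ℝ => F x - B 0 * x ^ 2) =O[𝓝[>] 0] (fun x : ℝ => x ^ 4) := by
  have h := (isBigO_refl (fun x : ℝ => x ^ 2) (𝓝[>] 0)).mul (isBigO_sq_of_differentiableAt hB)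
  refine h.congr' ?_ (Eventually.of_forall fun x => by ring)
  have h1 : ∀ᶠ x in 𝓝[>] (0 : ℝ), x ^ 2 < σ := by
    have : ContinuousAt (fun x : ℝ => x ^ 2) 0 := by fun_prop
    exact (this.eventually (gt_mem_nhds (by simpa using hσ))).filter_mono nhdsWithin_le_nhds
  filter_upwards [self_mem_nhdsWithin, h1] with x hx hxσ
  rw [hF x hx hxσ]
  ring

/-! ### Every standard chart of a solution with a horizon -/

/-- Two positive functions on `(0, δ)` which tend to `0` at `0` and whose derivatives agree up to
sign, without zeros, are equal. -/
theorem eq_of_sq_deriv_eq {δ : ℝ} {F G F' G' : ℝ → ℝ}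
    (dF : ∀ x ∈ Ioo 0 δ, HasDerivAt F (F' x) x) (dG : ∀ x ∈ Ioo 0 δ, HasDerivAt G (G' x) x)
    (cF : ContinuousOn F' (Ioo 0 δ)) (cG : ContinuousOn G' (Ioo 0 δ))
    (hne : ∀ x ∈ Ioo 0 δ, G' x ≠ 0) (hsq : ∀ x ∈ Ioo 0 δ, F' x ^ 2 = G' x ^ 2)
    (hF : Tendsto F (𝓝[>] 0) (𝓝 0)) (hG : Tendsto G (𝓝[>] 0) (𝓝 0))
    (pF : ∀ x ∈ Ioo 0 δ, 0 < F x) (pG : ∀ x ∈ Ioo 0 δ, 0 < G x) :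
    ∀ x ∈ Ioo 0 δ, F x = G x := by
  intro x hx
  have hδ : 0 < δ := hx.1.trans hx.2
  have hconst : ∀ {K : ℝ → ℝ}, (∀ y ∈ Ioo 0 δ, HasDerivAt K 0 y) → Tendsto K (𝓝[>] 0) (𝓝 0) →
      K x = 0 := fun {K} hK hlim => by
    obtain ⟨a, ha⟩ := isOpen_Ioo.exists_is_const_of_deriv_eq_zero isPreconnected_Ioo
      (fun y hy => (hK y hy).differentiableAt.differentiableWithinAt)
      (fun y hy => (hK y hy).deriv)
    rw [ha x hx]
    refine tendsto_nhds_unique (tendsto_const_nhds.congr' ?_) hlim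
    filter_upwards [Ioo_mem_nhdsGT_zero hδ] with y hy using (ha y hy).symm
  rcases isPreconnected_Ioo.eq_or_eq_neg_of_sq_eq cF cG hsq (fun hy => hne _ hy) with h | h
  · have := hconst (K := fun y => F y - G y) (fun y hy => by
      have := (dF y hy).sub (dG y hy)
      rwa [h hy, sub_self] at this) (by simpa using hF.sub hG)
    linarith
  · have := hconst (K := fun y => F y + G y) (fun y hy => by
      have := (dF y hy).add (dG y hy)
      rwa [h hy, Pi.neg_apply, neg_add_cancel] at this) (by simpa using hF.add hG)
    linarith [pF x hx, pG x hx]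

/-- In every chart with `N = 1` the coordinate is the proper distance `√λ Q(λ)`, hence `λ` is a
regular function of its square. The last four hypotheses identify the leading coefficients. -/
theorem isConical_of_standardChart {n : WithTop ℕ∞} (hn : n = ∞ ∨ n = ω) {η : ℝ}
    {Δ k₃ γ₁ γ₃ : ℝ → ℝ} {k : Fin 3 → ℝ → ℝ} {γ : ℝ → Matrix (Fin 3) (Fin 3) ℝ}
    (D : HorizonData n η Δ k₃ γ₁ γ₃)
    (hk : ∀ x ∈ Ioo 0 η, (fun i => k i x) = ![0, 0, k₃ x])
    (hγ : ∀ x ∈ Ioo 0 η, γ x = Matrix.diagonal ![γ₁ x, γ₁ x, γ₃ x])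
    {δ : ℝ} {T ρ χ a c f w : ℝ → ℝ} (hδ : 0 < δ)
    (H : IsStandardChart δ Δ k γ T ρ χ (fun _ => 1) (fun x => a x ^ 2) (fun x => c x ^ 2) f w)
    (hlim : Tendsto ρ (𝓝[>] 0) (𝓝 0)) {α2 f₀ w₀ : ℝ}
    (hα : 4 * γ₃ 0 * α2 = Δ 0 * γ₁ 0 * fiberCoeff Δ k₃ γ₃ 0)
    (hα2 : 16 * γ₃ 0 * α2 ^ 2 = fiberCoeff Δ k₃ γ₃ 0 ^ 2)
    (hf₀ : 4 * γ₃ 0 * f₀ = Δ 0 * fiberCoeff Δ k₃ γ₃ 0)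
    (hw₀ : w₀ = -(4 * γ₃ 0 / fiberCoeff Δ k₃ γ₃ 0 * (k₃ 0 / Δ 0 ^ 2))) :
    IsConical n α2 f₀ w₀ a c f w := by
  obtain ⟨η₁, Q, p1, p2, rQ, hQ, hode, hQ0⟩ := D.exists_properDistance hn
  have hm0 : 0 < min δ η₁ := lt_min hδ p1
  have hsubm : ∀ {x}, x ∈ Ioo (-min δ η₁) (min δ η₁) → x ∈ Ioo (-η₁) η₁ := fun hx =>
    ⟨by linarith [hx.1, min_le_right δ η₁], hx.2.trans_le (min_le_right _ _)⟩
  have hsubη : ∀ {x}, x ∈ Ioo (-min δ η₁) (min δ η₁) → x ∈ Ioo (-η) η := fun hx =>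
    ⟨by linarith [(hsubm hx).1], (hsubm hx).2.trans_le p2⟩
  obtain ⟨-, σ, R, -, -, d3, rR, hR0, -, hS, hSpos⟩ := exists_sq_coordinate hn hm0
    ((rQ.pow 2).mono fun x hx => hsubm hx) (pow_pos (hQ 0 ⟨by linarith, p1⟩) 2)
  have hsδ : ∀ {x}, x ∈ Ioo 0 (min δ η₁) → x ∈ Ioo 0 δ := fun hx =>
    ⟨hx.1, hx.2.trans_le (min_le_left _ _)⟩
  have hsη : ∀ {x}, x ∈ Ioo 0 (min δ η₁) → x ∈ Ioo 0 η := fun hx =>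
    ⟨hx.1, hx.2.trans_le ((min_le_right _ _).trans p2)⟩
  have rel := fun x (hx : x ∈ Ioo 0 (min δ η₁)) =>
    H.relations (hsδ hx) (hk x (hsη hx)) (hγ x (hsη hx)) (D.Δ_pos x (Ioo_zero_subset (hsη hx)))
      (D.γ₁_pos x (Ioo_zero_subset (hsη hx))) (D.γ₃_pos x (Ioo_zero_subset (hsη hx))) (sq_nonneg _)
  have hgpos : ∀ x ∈ Ioo (-η) η, 0 < γ₃ x / fiberCoeff Δ k₃ γ₃ x := fun x hx =>
    div_pos (D.γ₃_pos x hx) (D.H_pos hx)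
  -- `ρ` is the proper distance
  have hρ : ∀ x ∈ Ioo 0 (min δ η₁), ρ x = Real.sqrt (x * Q x ^ 2) := by
    refine eq_of_sq_deriv_eq (F' := deriv ρ)
      (G' := fun x => Real.sqrt (γ₃ x / fiberCoeff Δ k₃ γ₃ x) / Real.sqrt x)
      (fun x hx => ?_) (fun x hx => ?_) ?_ ?_ (fun x hx => ?_) (fun x hx => ?_) hlim
      (tendsto_sqrt_mul ((continuousAt_of_regular p1 rQ).pow 2)) (fun x hx => H.r_pos x (hsδ hx))
      (fun x hx => ?_)
    · exact ((H.smooth_r.contDiffAt (isOpen_Ioo.mem_nhds (hsδ hx))).differentiableAt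
        (by simp)).hasDerivAt
    · have hx' := hsubm (Ioo_zero_subset hx)
      exact hasDerivAt_sqrt_mul_sq hx.1 (hQ x hx') (hasDerivAt_of_regular hn rQ hx') (hode x hx')
    · exact (H.smooth_r.continuousOn_deriv_of_isOpen isOpen_Ioo (by simp)).mono fun x hx => hsδ hx
    · refine ContinuousOn.div (ContinuousOn.sqrt ?_) (Real.continuous_sqrt.continuousOn)
        (fun x hx => (Real.sqrt_pos.2 hx.1).ne')
      exact (D.reg_γ₃.continuousOn.div D.reg_H.continuousOn fun x hx => (D.H_pos hx).ne').mono
        fun x hx => Ioo_zero_subset (hsη hx)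
    · exact (div_pos (Real.sqrt_pos.2 (hgpos x (Ioo_zero_subset (hsη hx))))
        (Real.sqrt_pos.2 hx.1)).ne'
    · have := (rel x hx).N_eq
      rw [one_mul] at this
      rw [this, div_pow, Real.sq_sqrt (hgpos x (Ioo_zero_subset (hsη hx))).le,
        Real.sq_sqrt hx.1.le, div_div, mul_comm x]
      rfl
    · exact Real.sqrt_pos.2 (mul_pos hx.1 (pow_pos (hQ x (hsubm (Ioo_zero_subset hx))) 2))
  have hy : ∀ y : ℝ, 0 < y → y ^ 2 < σ → R (y ^ 2) ∈ Ioo 0 (min δ η₁) ∧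
      R (y ^ 2) * Q (R (y ^ 2)) ^ 2 = y ^ 2 ∧ ρ (R (y ^ 2)) = y := fun y hy hyσ => by
    have hm : y ^ 2 ∈ Ioo 0 σ := ⟨by positivity, hyσ⟩
    have h1 := hSpos _ hm
    have h2 := (hS _ (Ioo_zero_subset hm)).2
    refine ⟨h1, h2, ?_⟩
    rw [hρ _ h1, h2, Real.sqrt_sq hy.le]
  have hRQ : ∀ s ∈ Ioo (-σ) σ, Q (R s) ≠ 0 := fun s hs => (hQ _ (hsubm (hS s hs).1)).ne'
  have rcomp : ∀ {G : ℝ → ℝ}, ContDiffOn ℝ n G (Ioo (-η) η) →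
      ContDiffOn ℝ n (fun s => G (R s)) (Ioo (-σ) σ) := fun hG =>
    hG.comp rR fun s hs => hsubη (hS s hs).1
  have rQR : ContDiffOn ℝ n (fun s => Q (R s)) (Ioo (-σ) σ) :=
    rQ.comp rR fun s hs => hsubm (hS s hs).1
  have r1 : ContDiffOn ℝ n (fun s => Δ (R s) * γ₁ (R s) / Q (R s) ^ 2) (Ioo (-σ) σ) :=
    ((rcomp D.reg_Δ).mul (rcomp D.reg_γ₁)).div (rQR.pow 2) fun s hs => pow_ne_zero 2 (hRQ s hs)
  have r2 : ContDiffOn ℝ n (fun s => fiberCoeff Δ k₃ γ₃ (R s) / Q (R s) ^ 2) (Ioo (-σ) σ) :=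
    (rcomp D.reg_H).div (rQR.pow 2) fun s hs => pow_ne_zero 2 (hRQ s hs)
  have r3 : ContDiffOn ℝ n (fun s => Δ (R s) / Q (R s) ^ 2) (Ioo (-σ) σ) :=
    (rcomp D.reg_Δ).div (rQR.pow 2) fun s hs => pow_ne_zero 2 (hRQ s hs)
  have r4 : ContDiffOn ℝ n (fun s => -(Q (R s) ^ 2 * (k₃ (R s) / Δ (R s) ^ 2))) (Ioo (-σ) σ) :=
    ((rQR.pow 2).mul ((rcomp D.reg_k).div ((rcomp D.reg_Δ).pow 2)
      fun s hs => pow_ne_zero 2 (D.Δ_pos _ (hsubη (hS s hs).1)).ne')).neg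
  have e1 : ∀ y, 0 < y → y ^ 2 < σ →
      a y ^ 2 = y ^ 2 * (fun s => Δ (R s) * γ₁ (R s) / Q (R s) ^ 2) (y ^ 2) := fun y h0 hyσ => by
    obtain ⟨h1, h2, h3⟩ := hy y h0 hyσ
    have := (rel _ h1).A_eq
    rw [h3] at this
    have hq := hRQ _ (Ioo_zero_subset ⟨by positivity, hyσ⟩)
    beta_reduce
    rw [this, mul_div_assoc', eq_div_iff (pow_ne_zero 2 hq)]
    linear_combination (Δ (R (y ^ 2)) * γ₁ (R (y ^ 2))) * h2
  have e2 : ∀ y, 0 < y → y ^ 2 < σ →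
      c y ^ 2 = y ^ 2 * (fun s => fiberCoeff Δ k₃ γ₃ (R s) / Q (R s) ^ 2) (y ^ 2) :=
    fun y h0 hyσ => by
      obtain ⟨h1, h2, h3⟩ := hy y h0 hyσ
      have := (rel _ h1).C_eq
      rw [h3] at this
      have hq := hRQ _ (Ioo_zero_subset ⟨by positivity, hyσ⟩)
      beta_reduce
      rw [this, mul_div_assoc', eq_div_iff (pow_ne_zero 2 hq)]
      simp only [fiberCoeff]
      linear_combination (Δ (R (y ^ 2)) *
        (γ₃ (R (y ^ 2)) + k₃ (R (y ^ 2)) ^ 2 / Δ (R (y ^ 2)) ^ 2)) * h2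
  have e3 : ∀ y, 0 < y → y ^ 2 < σ →
      f y = y ^ 2 * (fun s => Δ (R s) / Q (R s) ^ 2) (y ^ 2) := fun y h0 hyσ => by
    obtain ⟨h1, h2, h3⟩ := hy y h0 hyσ
    have := (rel _ h1).f_eq
    rw [h3] at this
    have hq := hRQ _ (Ioo_zero_subset ⟨by positivity, hyσ⟩)
    beta_reduce
    rw [this, mul_div_assoc', eq_div_iff (pow_ne_zero 2 hq), mul_right_comm, h2]
  have e4 : ∀ y, 0 < y → y ^ 2 < σ →
      y ^ 2 * w y = -(Q (R (y ^ 2)) ^ 2 * (k₃ (R (y ^ 2)) / Δ (R (y ^ 2)) ^ 2)) :=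
    fun y h0 hyσ => by
    obtain ⟨h1, h2, h3⟩ := hy y h0 hyσ
    have := (rel _ h1).w_eq
    rw [h3] at this
    have hΔ := (D.Δ_pos _ (hsubη (hS _ (Ioo_zero_subset ⟨by positivity, hyσ⟩)).1)).ne'
    have hx := h1.1.ne'
    rw [this, mul_neg, neg_inj]
    field_simp
    linear_combination (-k₃ (R (y ^ 2))) * h2
  have hσ0 : (0 : ℝ) ∈ Ioo (-σ) σ := ⟨by linarith, d3⟩
  have hdiff : ∀ {G : ℝ → ℝ}, ContDiffOn ℝ n G (Ioo (-σ) σ) → DifferentiableAt ℝ G 0 := fun hG =>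
    (hasDerivAt_of_regular hn hG hσ0).differentiableAt
  have hQsq : Q 0 ^ 2 = 4 * (γ₃ 0 / fiberCoeff Δ k₃ γ₃ 0) := by
    rw [hQ0, mul_pow, Real.sq_sqrt (hgpos 0 D.zero_mem).le]
    norm_num
  have hH0 := (D.H_pos D.zero_mem).ne'
  have hγ0 := (D.γ₃_pos 0 D.zero_mem).ne'
  refine ⟨⟨σ, fun s => s * (Δ (R s) * γ₁ (R s) / Q (R s) ^ 2),
    fun s => s * (fiberCoeff Δ k₃ γ₃ (R s) / Q (R s) ^ 2), fun s => s * (Δ (R s) / Q (R s) ^ 2),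
    fun s => -(Q (R s) ^ 2 * (k₃ (R s) / Δ (R s) ^ 2)), d3, contDiffOn_id.mul r1,
    contDiffOn_id.mul r2, contDiffOn_id.mul r3, r4,
    fun y h0 hyσ => ⟨e1 y h0 hyσ, e2 y h0 hyσ, e3 y h0 hyσ, e4 y h0 hyσ⟩⟩, ?_, ?_, ?_, ?_⟩
  · have h := isBigO_fourth_of_eq d3 (hdiff r1) e1
    have h0 : Δ (R 0) * γ₁ (R 0) / Q (R 0) ^ 2 = α2 := by
      rw [hR0, hQsq, div_eq_iff (by positivity)]
      field_simp
      linarith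
    simpa only [h0] using h
  · have h := isBigO_fourth_of_eq d3 (hdiff r2) e2
    have h0 : fiberCoeff Δ k₃ γ₃ (R 0) / Q (R 0) ^ 2 = 4 * α2 ^ 2 := by
      rw [hR0, hQsq, div_eq_iff (by positivity)]
      field_simp
      linarith
    simpa only [h0] using h
  · have h := isBigO_fourth_of_eq d3 (hdiff r3) e3
    have h0 : Δ (R 0) / Q (R 0) ^ 2 = f₀ := by
      rw [hR0, hQsq, div_eq_iff (by positivity)]
      field_simp
      linarith
    simpa only [h0] using h
  · have h0 : -(Q (R 0) ^ 2 * (k₃ (R 0) / Δ (R 0) ^ 2)) = w₀ := by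
      rw [hR0, hQsq, hw₀]
      ring
    have h := (isBigO_sq_of_differentiableAt (hdiff r4)).mul
      (isBigO_refl (fun x : ℝ => (x ^ 2)⁻¹) (𝓝[>] 0))
    have hev : ∀ᶠ x in 𝓝[>] (0 : ℝ), x ^ 2 < σ := by
      have : ContinuousAt (fun x : ℝ => x ^ 2) 0 := by fun_prop
      exact (this.eventually (gt_mem_nhds (by simpa using d3))).filter_mono nhdsWithin_le_nhds
    refine h.congr' ?_ ?_
    · filter_upwards [self_mem_nhdsWithin, hev] with x hx hxσ
      have hx0 : x ≠ 0 := (mem_Ioi.1 hx).ne'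
      rw [h0, ← e4 x hx hxσ]
      field_simp
    · filter_upwards [self_mem_nhdsWithin] with x hx
      have hx0 : x ≠ 0 := (mem_Ioi.1 hx).ne'
      field_simp

/-- In every chart with `r²/4` the coefficient of `σ₁² + σ₂²`, the coordinate is `r² = 4 λ Δ γ₁`. -/
theorem isRegular_of_standardChart {n : WithTop ℕ∞} (hn : n = ∞ ∨ n = ω) {η : ℝ}
    {Δ k₃ γ₁ γ₃ : ℝ → ℝ} {k : Fin 3 → ℝ → ℝ} {γ : ℝ → Matrix (Fin 3) (Fin 3) ℝ}
    (D : HorizonData n η Δ k₃ γ₁ γ₃)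
    (hk : ∀ x ∈ Ioo 0 η, (fun i => k i x) = ![0, 0, k₃ x])
    (hγ : ∀ x ∈ Ioo 0 η, γ x = Matrix.diagonal ![γ₁ x, γ₁ x, γ₃ x])
    {δ : ℝ} {T r χ V f w : ℝ → ℝ} (hδ : 0 < δ)
    (H : IsStandardChart δ Δ k γ T r χ
      (fun x => 1 / V x) (fun x => x ^ 2 / 4) (fun x => x ^ 2 * V x / 4) f w) :
    Tendsto r (𝓝[>] 0) (𝓝 0) ∧
    IsRegularInRSquared n (fiberCoeff Δ k₃ γ₃ 0 / (Δ 0 * γ₁ 0)) V f w := by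
  have hm0 : 0 < min δ η := lt_min hδ D.pos
  have D' := D.mono hm0 (min_le_right _ _)
  have hsδ : ∀ {x}, x ∈ Ioo 0 (min δ η) → x ∈ Ioo 0 δ := fun hx =>
    ⟨hx.1, hx.2.trans_le (min_le_left _ _)⟩
  have hsη : ∀ {x}, x ∈ Ioo 0 (min δ η) → x ∈ Ioo 0 η := fun hx =>
    ⟨hx.1, hx.2.trans_le (min_le_right _ _)⟩
  have rel := fun x (hx : x ∈ Ioo 0 (min δ η)) =>
    H.relations (hsδ hx) (hk x (hsη hx)) (hγ x (hsη hx)) (D'.Δ_pos x (Ioo_zero_subset hx))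
      (D'.γ₁_pos x (Ioo_zero_subset hx)) (D'.γ₃_pos x (Ioo_zero_subset hx)) (by positivity)
  obtain ⟨-, σ, R, -, -, d3, rR, hR0, -, hS, hSpos⟩ := exists_sq_coordinate hn hm0
    (q := fun x => 4 * (Δ x * γ₁ x)) (contDiffOn_const.mul (D'.reg_Δ.mul D'.reg_γ₁))
    (mul_pos four_pos (mul_pos (D.Δ_pos 0 D.zero_mem) (D.γ₁_pos 0 D.zero_mem)))
  have hr : ∀ x ∈ Ioo 0 (min δ η), r x = Real.sqrt (x * (4 * (Δ x * γ₁ x))) := fun x hx => by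
    have h1 := (rel x hx).A_eq
    rw [← Real.sqrt_sq (H.r_pos x (hsδ hx)).le]
    congr 1
    linear_combination 4 * h1
  have hrlim : Tendsto r (𝓝[>] 0) (𝓝 0) := by
    refine (tendsto_sqrt_mul (q := fun x => 4 * (Δ x * γ₁ x)) ?_).congr' ?_
    · exact continuousAt_const.mul ((continuousAt_of_regular D.pos D.reg_Δ).mul
        (continuousAt_of_regular D.pos D.reg_γ₁))
    · filter_upwards [Ioo_mem_nhdsGT_zero hm0] with x hx using (hr x hx).symm
  have hpos : ∀ s ∈ Ioo (-σ) σ, 0 < Δ (R s) ∧ 0 < γ₁ (R s) ∧ 0 < fiberCoeff Δ k₃ γ₃ (R s) :=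
    fun s hs => ⟨D'.Δ_pos _ (hS s hs).1, D'.γ₁_pos _ (hS s hs).1, D'.H_pos (hS s hs).1⟩
  have rcomp : ∀ {G : ℝ → ℝ}, ContDiffOn ℝ n G (Ioo (-min δ η) (min δ η)) →
      ContDiffOn ℝ n (fun s => G (R s)) (Ioo (-σ) σ) := fun hG => hG.comp rR fun s hs => (hS s hs).1
  refine ⟨hrlim, σ, fun s => fiberCoeff Δ k₃ γ₃ (R s) / (Δ (R s) * γ₁ (R s)),
    fun s => 1 / (4 * γ₁ (R s)), fun s => -(4 * γ₁ (R s) * k₃ (R s) / Δ (R s)), d3, ?_, ?_, ?_,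
    fun s hs => ?_, by simp only [hR0], fun y h0 hyσ => ?_⟩
  · exact (rcomp D'.reg_H).div ((rcomp D'.reg_Δ).mul (rcomp D'.reg_γ₁))
      fun s hs => (mul_pos (hpos s hs).1 (hpos s hs).2.1).ne'
  · exact contDiffOn_const.div (contDiffOn_const.mul (rcomp D'.reg_γ₁))
      fun s hs => (mul_pos four_pos (hpos s hs).2.1).ne'
  · exact (((contDiffOn_const.mul (rcomp D'.reg_γ₁)).mul (rcomp D'.reg_k)).div (rcomp D'.reg_Δ)
      fun s hs => (hpos s hs).1.ne').neg
  · obtain ⟨h1, h2, h3⟩ := hpos s ⟨by linarith [hs.1], hs.2⟩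
    exact ⟨by positivity, by positivity⟩
  · have hm : y ^ 2 ∈ Ioo 0 σ := ⟨by positivity, hyσ⟩
    have hx := hSpos _ hm
    have h2 := (hS _ (Ioo_zero_subset hm)).2
    obtain ⟨q1, q2, q3⟩ := hpos _ (Ioo_zero_subset hm)
    have hry : r (R (y ^ 2)) = y := by rw [hr _ hx, h2, Real.sqrt_sq h0.le]
    obtain ⟨r1, r2, r3, r4, -⟩ := rel _ hx
    rw [hry] at r1 r2 r3 r4
    have hx0 := hx.1
    beta_reduce
    generalize R (y ^ 2) = x at *
    have hy2 : y ^ 2 = x * (4 * (Δ x * γ₁ x)) := h2.symm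
    refine ⟨?_, ?_, ?_⟩
    · rw [eq_div_iff (by positivity)]
      refine mul_left_cancel₀ hx0.ne' (Eq.trans ?_ r3)
      linear_combination (-(V y / 4)) * hy2
    · rw [r1, hy2]
      field_simp
    · rw [r4, hy2]
      field_simp

/-! ### Solutions with a conical singularity -/

theorem region_subset {x₁ x₂ : ℝ} (h : x₂ ≤ x₁) : region x₂ ⊆ region x₁ := fun _ hp =>
  ⟨hp.1, hp.2.1.trans_le h, hp.2.2⟩

theorem IsTimelikeSusy.mono {ℓ : ℝ} {D D' : Set Base} {f : Base → ℝ} {om : OneForm}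
    {h J : TwoTensor} (H : IsTimelikeSusy ℓ D f om h J) (hD : D' ⊆ D) :
    IsTimelikeSusy ℓ D' f om h J where
  kahler :=
    { smooth_metric := fun a b => (H.kahler.smooth_metric a b).mono hD
      smooth_form := fun a b => (H.kahler.smooth_form a b).mono hD
      posDef := fun p hp => H.kahler.posDef p (hD hp)
      antisymm := fun p hp => H.kahler.antisymm p (hD hp)
      almost_complex := fun p hp => H.kahler.almost_complex p (hD hp)
      closed := fun p hp => H.kahler.closed p (hD hp)
      parallel := fun p hp => H.kahler.parallel p (hD hp) }
  smooth_f := H.smooth_f.mono hD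
  smooth_omega := fun a => (H.smooth_omega a).mono hD
  f_pos := fun p hp => H.f_pos p (hD hp)
  f_eq := fun p hp => H.f_eq p (hD hp)
  Gplus_eq := fun p hp => H.Gplus_eq p (hD hp)
  Gminus_eq := fun p hp => H.Gminus_eq p (hD hp)

/-- The functions `N`, `x⁻² A`, `x⁻² C`, `x⁻² f` and `x² w` of the radial coordinate `x` are regular
functions `Ns`, …, `Ws` of `x²`, the first four of them positive. -/
structure ConicalData (n : WithTop ℕ∞) (η : ℝ) (Ns As Cs Fs Ws N A C f w : ℝ → ℝ) : Prop where
  pos : 0 < η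
  reg_N : ContDiffOn ℝ n Ns (Ioo (-η) η)
  reg_A : ContDiffOn ℝ n As (Ioo (-η) η)
  reg_C : ContDiffOn ℝ n Cs (Ioo (-η) η)
  reg_F : ContDiffOn ℝ n Fs (Ioo (-η) η)
  reg_W : ContDiffOn ℝ n Ws (Ioo (-η) η)
  N_pos : ∀ s ∈ Ioo (-η) η, 0 < Ns s
  A_pos : ∀ s ∈ Ioo (-η) η, 0 < As s
  C_pos : ∀ s ∈ Ioo (-η) η, 0 < Cs s
  F_pos : ∀ s ∈ Ioo (-η) η, 0 < Fs s
  N_eq : ∀ x, 0 < x → x ^ 2 < η → N x = Ns (x ^ 2)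
  A_eq : ∀ x, 0 < x → x ^ 2 < η → A x = x ^ 2 * As (x ^ 2)
  C_eq : ∀ x, 0 < x → x ^ 2 < η → C x = x ^ 2 * Cs (x ^ 2)
  f_eq : ∀ x, 0 < x → x ^ 2 < η → f x = x ^ 2 * Fs (x ^ 2)
  w_eq : ∀ x, 0 < x → x ^ 2 < η → w x = Ws (x ^ 2) / x ^ 2

namespace ConicalData

variable {n : WithTop ℕ∞} {η : ℝ} {Ns As Cs Fs Ws N A C f w : ℝ → ℝ}

theorem mono (D : ConicalData n η Ns As Cs Fs Ws N A C f w) {η' : ℝ} (h0 : 0 < η') (hle : η' ≤ η) :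
    ConicalData n η' Ns As Cs Fs Ws N A C f w := by
  have hsub : Ioo (-η') η' ⊆ Ioo (-η) η := Ioo_subset_Ioo (by linarith) hle
  exact ⟨h0, D.reg_N.mono hsub, D.reg_A.mono hsub, D.reg_C.mono hsub, D.reg_F.mono hsub,
    D.reg_W.mono hsub, fun s hs => D.N_pos s (hsub hs), fun s hs => D.A_pos s (hsub hs),
    fun s hs => D.C_pos s (hsub hs), fun s hs => D.F_pos s (hsub hs),
    fun x hx h => D.N_eq x hx (h.trans_le hle), fun x hx h => D.A_eq x hx (h.trans_le hle),
    fun x hx h => D.C_eq x hx (h.trans_le hle), fun x hx h => D.f_eq x hx (h.trans_le hle),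
    fun x hx h => D.w_eq x hx (h.trans_le hle)⟩

theorem zero_mem (D : ConicalData n η Ns As Cs Fs Ws N A C f w) : (0 : ℝ) ∈ Ioo (-η) η :=
  ⟨by linarith [D.pos], D.pos⟩

theorem mem_of_mem_Ioo_sqrt {x : ℝ} (hx : x ∈ Ioo 0 (Real.sqrt η)) : x ^ 2 < η :=
  (Real.lt_sqrt hx.1.le).1 hx.2

theorem sq_mem {x : ℝ} (hx : x ∈ Ioo 0 (Real.sqrt η)) : x ^ 2 ∈ Ioo 0 η :=
  ⟨pow_pos hx.1 2, mem_of_mem_Ioo_sqrt hx⟩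

theorem hasDerivAt_comp_sq (hn : n = ∞ ∨ n = ω) {g : ℝ → ℝ} (hg : ContDiffOn ℝ n g (Ioo (-η) η))
    {x : ℝ} (hx : x ∈ Ioo 0 (Real.sqrt η)) :
    HasDerivAt (fun y => g (y ^ 2)) (2 * x * deriv g (x ^ 2)) x := by
  have h1 := hasDerivAt_of_regular hn hg (Ioo_zero_subset (sq_mem hx))
  refine (HasDerivAt.comp x (h₂ := g) (h := fun y => y ^ 2) h1 (hasDerivAt_pow 2 x)).congr_deriv ?_
  simp
  ring

/-- The derivative of `G(x) = x² g(x²)`. -/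
theorem hasDerivAt_sq_mul (hn : n = ∞ ∨ n = ω) {g G : ℝ → ℝ}
    (hg : ContDiffOn ℝ n g (Ioo (-η) η)) (hG : ∀ x, 0 < x → x ^ 2 < η → G x = x ^ 2 * g (x ^ 2))
    {x : ℝ} (hx : x ∈ Ioo 0 (Real.sqrt η)) :
    HasDerivAt G (2 * x * (g (x ^ 2) + x ^ 2 * deriv g (x ^ 2))) x := by
  refine HasDerivAt.congr_of_eventuallyEq (f := fun y => y ^ 2 * g (y ^ 2)) ?_ ?_
  · refine ((hasDerivAt_pow 2 x).mul (hasDerivAt_comp_sq hn hg hx)).congr_deriv ?_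
    simp
    ring
  · filter_upwards [isOpen_Ioo.mem_nhds hx] with y hy using hG y hy.1 (mem_of_mem_Ioo_sqrt hy)

theorem reg_deriv (hn : n = ∞ ∨ n = ω) {g : ℝ → ℝ} (hg : ContDiffOn ℝ n g (Ioo (-η) η)) :
    ContDiffOn ℝ n (deriv g) (Ioo (-η) η) :=
  hg.deriv_of_isOpen isOpen_Ioo (by rcases hn with rfl | rfl <;> simp)

/-- The leading terms at the conical singularity of the equations for the complex structure and for
the components of `G⁺` along `dx ∧ σ₃` and `σ₁ ∧ σ₂`. -/
theorem values_at_zero (hn : n = ∞ ∨ n = ω) (D : ConicalData n η Ns As Cs Fs Ws N A C f w)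
    {ℓ : ℝ} (hℓ : 0 < ℓ) (hsusy : IsTimelikeSusy ℓ (region (Real.sqrt η)) (fun p => f (p 0))
      (sigma3Form w) (radialMetric N A C) (ext1 (sigma3Form A))) :
    Ns 0 * Cs 0 = 4 * As 0 ^ 2 ∧ Fs 0 ^ 2 * Ws 0 = 3 * As 0 / ℓ ∧
      Cs 0 / As 0 - 1 = 12 * As 0 / (ℓ ^ 2 * Fs 0) := by
  set B : ℝ → ℝ := fun s => As s + s * deriv As s with hB
  set G : ℝ → ℝ := fun s => Cs s + s * deriv Cs s with hG
  have rB : ContDiffOn ℝ n B (Ioo (-η) η) := D.reg_A.add (contDiffOn_id.mul (reg_deriv hn D.reg_A))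
  have rG : ContDiffOn ℝ n G (Ioo (-η) η) := D.reg_C.add (contDiffOn_id.mul (reg_deriv hn D.reg_C))
  have c0 : ∀ {g : ℝ → ℝ}, ContDiffOn ℝ n g (Ioo (-η) η) → ContinuousAt g 0 := fun hg =>
    continuousAt_of_regular D.pos hg
  have cN := c0 D.reg_N
  have cA := c0 D.reg_A
  have cC := c0 D.reg_C
  have cF := c0 D.reg_F
  have cW := c0 D.reg_W
  have cB := c0 rB
  have cG := c0 rG
  have cN' := c0 (reg_deriv hn D.reg_N)
  have cW' := c0 (reg_deriv hn D.reg_W)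
  have cG' := c0 (reg_deriv hn rG)
  have hs : ∀ {x}, x ∈ Ioo 0 (Real.sqrt η) → x ^ 2 ∈ Ioo (-η) η := fun hx =>
    Ioo_zero_subset (sq_mem hx)
  have H : IsBlockMetric (Real.sqrt η) (radialMetric N A C) N (fun _ => 0) A C
      (fun x => 2 * x * deriv Ns (x ^ 2)) (fun _ => 0) (fun x => 2 * x * B (x ^ 2))
      (fun x => 2 * x * G (x ^ 2)) := by
    refine ⟨fun p hp => ?_, fun x hx => ?_, fun x hx => hasDerivAt_const _ _,
      fun x hx => hasDerivAt_sq_mul hn D.reg_A D.A_eq hx,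
      fun x hx => hasDerivAt_sq_mul hn D.reg_C D.C_eq hx, fun x hx => ?_, fun x hx => ?_⟩
    · ext i j
      fin_cases i <;> fin_cases j <;> simp [radialMetric, blockMat]
    · refine (hasDerivAt_comp_sq hn D.reg_N hx).congr_of_eventuallyEq ?_
      filter_upwards [isOpen_Ioo.mem_nhds hx] with y hy using D.N_eq y hy.1 (mem_of_mem_Ioo_sqrt hy)
    · rw [D.A_eq x hx.1 (mem_of_mem_Ioo_sqrt hx)]
      exact (mul_pos (pow_pos hx.1 2) (D.A_pos _ (hs hx))).ne'
    · rw [D.N_eq x hx.1 (mem_of_mem_Ioo_sqrt hx), D.C_eq x hx.1 (mem_of_mem_Ioo_sqrt hx)]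
      have := mul_pos (D.N_pos _ (hs hx)) (mul_pos (pow_pos hx.1 2) (D.C_pos _ (hs hx)))
      linarith
  have hJ : ∀ p ∈ region (Real.sqrt η),
      ext1 (sigma3Form A) p = formMat (1 * (2 * p 0 * B (p 0 ^ 2))) (1 * A (p 0)) := fun p hp => by
    rw [one_mul, one_mul]
    exact ext1_sigma3Form (H.derivA _ (mem_region_coord hp))
  have hdet : ∀ x ∈ Ioo 0 (Real.sqrt η), N x * C x = (2 * x * B (x ^ 2)) ^ 2 := fun x hx => by
    have hp := equator_mem_region hx
    have h1 := hsusy.kahler.almost_complex _ hp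
    rw [H.eq _ hp, hJ _ hp] at h1
    have h2 := (formMat_sq_of_almost_complex (H.A_ne _ hx) (H.det_ne _ hx) h1).1
    simpa using h2.symm
  have hdetB : ∀ x ∈ Ioo 0 (Real.sqrt η), Ns (x ^ 2) * Cs (x ^ 2) = 4 * B (x ^ 2) ^ 2 :=
    fun x hx => by
      have h1 := hdet x hx
      rw [D.N_eq x hx.1 (mem_of_mem_Ioo_sqrt hx), D.C_eq x hx.1 (mem_of_mem_Ioo_sqrt hx)] at h1
      refine mul_left_cancel₀ (pow_pos hx.1 2).ne' ?_
      linear_combination h1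
  have hBne : ∀ x ∈ Ioo 0 (Real.sqrt η), B (x ^ 2) ≠ 0 := fun x hx h => by
    have h1 := hdetB x hx
    rw [h] at h1
    have := mul_pos (D.N_pos _ (hs hx)) (D.C_pos _ (hs hx))
    norm_num at h1
    rcases h1 with h1 | h1 <;> simp [h1] at this
  have dw : ∀ x ∈ Ioo 0 (Real.sqrt η),
      HasDerivAt w (2 * x * (x ^ 2 * deriv Ws (x ^ 2) - Ws (x ^ 2)) / (x ^ 2) ^ 2) x :=
    fun x hx => by
      have h0 := hx.1.ne'
      refine HasDerivAt.congr_of_eventuallyEq (f := fun y => Ws (y ^ 2) / y ^ 2) ?_ ?_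
      · refine ((hasDerivAt_comp_sq hn D.reg_W hx).div (hasDerivAt_pow 2 x)
          (pow_ne_zero 2 h0)).congr_deriv ?_
        simp
        ring
      · filter_upwards [isOpen_Ioo.mem_nhds hx] with y hy
          using D.w_eq y hy.1 (mem_of_mem_Ioo_sqrt hy)
  -- both equations for `G⁺`, with all functions written in terms of `x²`
  have hgp : ∀ x ∈ Ioo 0 (Real.sqrt η), _ ∧ _ := fun x hx => by
    have hx2 := mem_of_mem_Ioo_sqrt hx
    have hp := equator_mem_region hx
    have dC' : HasDerivAt (fun x => 2 * x * G (x ^ 2))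
        (2 * G (x ^ 2) + 2 * x * (2 * x * deriv G (x ^ 2))) x :=
      (((hasDerivAt_id x).const_mul 2).mul (hasDerivAt_comp_sq hn rG hx)).congr_deriv (by simp)
    have e := hsusy.Gplus_components hℓ hp (one_pow 2) (H.eq _ hp) (hJ _ hp)
      (ext1_sigma3Form (dw x hx)) (H.A_ne _ hx)
      (mul_ne_zero (mul_ne_zero two_ne_zero hx.1.ne') (hBne x hx))
      (by simpa using hdet x hx)
    rw [H.ricciForm_1_2 hp (hJ _ hp) (by simpa using hdet x hx),
      H.ricciForm_0_3 hp (hJ _ hp) (hdet x hx) dC'] at e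
    have hp0 : (![x, Real.pi / 2, 0, 0] : Base) 0 = x := rfl
    simp only [hp0, one_mul] at e
    rw [D.N_eq x hx.1 hx2, D.A_eq x hx.1 hx2, D.C_eq x hx.1 hx2, D.f_eq x hx.1 hx2,
      D.w_eq x hx.1 hx2] at e
    exact e
  have hev : ∀ {F₁ F₂ : ℝ → ℝ}, (∀ x ∈ Ioo 0 (Real.sqrt η), F₁ (x ^ 2) = F₂ (x ^ 2)) →
      ∀ᶠ s in 𝓝[>] (0 : ℝ), F₁ s = F₂ s := fun {F₁ F₂} h => by
    filter_upwards [Ioo_mem_nhdsGT_zero D.pos] with s hs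
    have := h (Real.sqrt s) ⟨Real.sqrt_pos.2 hs.1, Real.sqrt_lt_sqrt hs.1.le hs.2⟩
    rwa [Real.sq_sqrt hs.1.le] at this
  have hB0 : B 0 = As 0 := by simp [hB]
  have hG0 : G 0 = Cs 0 := by simp [hG]
  have pN := D.N_pos 0 D.zero_mem
  have pA := D.A_pos 0 D.zero_mem
  have pC := D.C_pos 0 D.zero_mem
  have pF := D.F_pos 0 D.zero_mem
  -- the equations hold for `s = x² > 0` and have limits at `s = 0`; the second equation for `G⁺`
  -- has been multiplied by `x`
  have k1 := eq_at_zero_of_eventually_eq (F := fun s => Ns s * Cs s) (G := fun s => 4 * B s ^ 2)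
    (cN.mul cC) (continuousAt_const.mul (cB.pow 2)) (hev hdetB)
  have k2 := eq_at_zero_of_eventually_eq
    (F := fun s => Fs s / 2 * (As s * (s * deriv Ws s - Ws s) / B s - Ws s))
    (G := fun s => -(ℓ / 2) * (Cs s / (2 * As s) + G s / (2 * B s) - 1
      - 6 * As s / (ℓ ^ 2 * Fs s))) ?_ ?_ (hev fun x hx => ?_)
  have k3 := eq_at_zero_of_eventually_eq
    (F := fun s => Fs s * (s * deriv Ws s - Ws s - B s * Ws s / As s))
    (G := fun s => -(ℓ / 2) * ((G s ^ 2 / Cs s + s * deriv Ns s * G s / Ns s - G s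
      - 2 * s * deriv G s) / (2 * B s) - (G s - Cs s * B s / As s) / As s
      + 12 * B s / (ℓ ^ 2 * Fs s))) ?_ ?_ (hev fun x hx => ?_)
  · simp only [zero_mul, hB0, hG0, zero_sub, mul_zero, sub_zero] at k1 k2 k3
    have e2 : Fs 0 * Ws 0 = ℓ / 2 * (Cs 0 / As 0 - 1 - 6 * As 0 / (ℓ ^ 2 * Fs 0)) := by
      have h1 : As 0 * -Ws 0 / As 0 = -Ws 0 := by field_simp
      have h2 : Cs 0 / (2 * As 0) = Cs 0 / As 0 / 2 := by ring
      rw [h1, h2] at k2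
      linear_combination -k2
    have e3 : Fs 0 * Ws 0 = ℓ / 4 * (12 * As 0 / (ℓ ^ 2 * Fs 0)) := by
      have h1 : As 0 * Ws 0 / As 0 = Ws 0 := by field_simp
      have h2 : Cs 0 * As 0 / As 0 = Cs 0 := by field_simp
      have h3 : Cs 0 ^ 2 / Cs 0 = Cs 0 := by field_simp
      rw [h1, h2, h3, zero_div, add_zero, sub_self, zero_div, zero_div, sub_zero, zero_add] at k3
      linear_combination -(1 / 2) * k3
    refine ⟨k1, ?_, ?_⟩
    · rw [sq, mul_assoc, e3]
      field_simp
      norm_num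
    · refine mul_left_cancel₀ (half_pos hℓ).ne' ?_
      have h3 : ℓ / 2 * (12 * As 0 / (ℓ ^ 2 * Fs 0)) = ℓ / 4 * (12 * As 0 / (ℓ ^ 2 * Fs 0))
        + ℓ / 2 * (6 * As 0 / (ℓ ^ 2 * Fs 0)) := by ring
      rw [h3]
      linear_combination e3 - e2
  · exact cF.mul (((continuousAt_id.mul cW').sub cW).sub ((cB.mul cW).div cA pA.ne'))
  · have h2B : (2 : ℝ) * B 0 ≠ 0 := by simpa [hB0] using pA.ne'
    have hF : ℓ ^ 2 * Fs 0 ≠ 0 := by positivity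
    have c1 := (((cG.pow 2).div cC pC.ne').add
      (((continuousAt_id.mul cN').mul cG).div cN pN.ne')).sub cG
    have c2 : ContinuousAt (fun s => 2 * s * deriv G s) 0 :=
      (continuousAt_const.mul continuousAt_id).mul cG'
    have c3 := ((c1.sub c2).div (continuousAt_const.mul cB) h2B).sub
      ((cG.sub ((cC.mul cB).div cA pA.ne')).div cA pA.ne')
    have c4 : ContinuousAt (fun s => 12 * B s / (ℓ ^ 2 * Fs s)) 0 :=
      (continuousAt_const.mul cB).div (continuousAt_const.mul cF) hF
    exact continuousAt_const.mul (c3.add c4)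
  · obtain ⟨-, e⟩ := hgp x hx
    have q0 := hBne x hx
    have q1 := (D.A_pos _ (hs hx)).ne'
    have q2 := (D.F_pos _ (hs hx)).ne'
    have q3 := (D.C_pos _ (hs hx)).ne'
    have q4 := (D.N_pos _ (hs hx)).ne'
    have hx0 := hx.1.ne'
    have e' := congrArg (x * ·) e
    refine Eq.trans ?_ (e'.trans ?_)
    · field_simp
    · field_simp
      ring
  · exact (cF.div_const 2).mul (((cA.mul ((continuousAt_id.mul cW').sub cW)).div cB
      (by simpa [hB0] using pA.ne')).sub cW)
  · have h2A : (2 : ℝ) * As 0 ≠ 0 := by positivity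
    have h2B : (2 : ℝ) * B 0 ≠ 0 := by simpa [hB0] using pA.ne'
    have hF : ℓ ^ 2 * Fs 0 ≠ 0 := by positivity
    have c1 := ((cC.div (continuousAt_const.mul cA) h2A).add
      (cG.div (continuousAt_const.mul cB) h2B)).sub (continuousAt_const (y := 1))
    have c2 : ContinuousAt (fun s => 6 * As s / (ℓ ^ 2 * Fs s)) 0 :=
      (continuousAt_const.mul cA).div (continuousAt_const.mul cF) hF
    exact continuousAt_const.mul (c1.sub c2)
  · obtain ⟨e, -⟩ := hgp x hx
    have q0 := hBne x hx
    have q1 := (D.A_pos _ (hs hx)).ne'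
    have q2 := (D.F_pos _ (hs hx)).ne'
    have hx0 := hx.1.ne'
    refine Eq.trans ?_ (e.trans ?_)
    · field_simp
    · field_simp

/-- The horizon at a conical singularity. The coordinate `λ` is a regular function of `s = x²`
vanishing at `s = 0`, with `dλ/ds` fixed by `g(∂_v, ∂_λ) = 1`. -/
theorem hasHorizonAtZero (hn : n = ∞ ∨ n = ω) (D : ConicalData n η Ns As Cs Fs Ws N A C f w)
    {ℓ x₁ : ℝ} (hℓ : 0 < ℓ) (hx₁ : 0 < x₁) (hη : η ≤ x₁ ^ 2) (h1 : Ns 0 * Cs 0 = 4 * As 0 ^ 2)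
    (h2 : Fs 0 ^ 2 * Ws 0 = 3 * As 0 / ℓ) (h3 : Cs 0 / As 0 - 1 = 12 * As 0 / (ℓ ^ 2 * Fs 0)) :
    HasHorizonAtZero ℓ n x₁ N A C f w := by
  have pN := D.N_pos 0 D.zero_mem
  have pA := D.A_pos 0 D.zero_mem
  have pC := D.C_pos 0 D.zero_mem
  have pF := D.F_pos 0 D.zero_mem
  -- `C K` is the `σ₃²` component of the spacetime metric
  set K : ℝ → ℝ := fun s => 1 / Fs s - Fs s ^ 2 * Ws s ^ 2 / Cs s with hK
  have rK : ContDiffOn ℝ n K (Ioo (-η) η) :=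
    (contDiffOn_const.div D.reg_F fun s hs => (D.F_pos s hs).ne').sub
      (((D.reg_F.pow 2).mul (D.reg_W.pow 2)).div D.reg_C fun s hs => (D.C_pos s hs).ne')
  have hC0 : Cs 0 = As 0 + 12 * As 0 ^ 2 / (ℓ ^ 2 * Fs 0) := by
    field_simp at h3 ⊢
    linarith
  have hW0 : Ws 0 = 3 * As 0 / (ℓ * Fs 0 ^ 2) := by
    field_simp at h2 ⊢
    linarith
  have hCK : Cs 0 * K 0 = As 0 / Fs 0 * (1 + 3 * As 0 / (ℓ ^ 2 * Fs 0)) := by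
    simp only [hK]
    rw [mul_sub, mul_div_cancel₀ _ pC.ne', hC0, hW0]
    field_simp
    ring
  have hK0 : 0 < K 0 := by
    refine pos_of_mul_pos_right (a := Cs 0) ?_ pC.le
    rw [hCK]
    positivity
  obtain ⟨η₁, p1, p2, hKpos⟩ := exists_Ioo_forall_pos D.pos (continuousAt_of_regular D.pos rK) hK0
  have D₁ := D.mono p1 p2
  have rK₁ := rK.mono (Ioo_subset_Ioo (neg_le_neg p2) p2)
  -- the derivative of `s` with respect to `λ`
  set Φ : ℝ → ℝ := fun s => 2 * Real.sqrt (K s / Ns s) with hΦ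
  have hKN : ∀ s ∈ Ioo (-η₁) η₁, 0 < K s / Ns s := fun s hs => div_pos (hKpos s hs) (D₁.N_pos s hs)
  have hΦpos : ∀ s ∈ Ioo (-η₁) η₁, 0 < Φ s := fun s hs =>
    mul_pos two_pos (Real.sqrt_pos.2 (hKN s hs))
  have hΦsq : ∀ s ∈ Ioo (-η₁) η₁, Φ s ^ 2 = 4 * (K s / Ns s) := fun s hs => by
    simp only [hΦ]
    rw [mul_pow, Real.sq_sqrt (hKN s hs).le]
    norm_num
  have rΦ : ContDiffOn ℝ n Φ (Ioo (-η₁) η₁) := contDiffOn_const.mul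
    ((rK₁.div D₁.reg_N fun s hs => (D₁.N_pos s hs).ne').sqrt fun s hs => (hKN s hs).ne')
  obtain ⟨η₂, Q, q1, q2, rQ, hode⟩ := exists_regular_solution hn p1
    (contDiffOn_const (c := (1 : ℝ)).div rΦ fun s hs => (hΦpos s hs).ne') 1
  have hode' : ∀ s ∈ Ioo (-η₂) η₂, Q s + s * deriv Q s = 1 / Φ s := fun s hs => by
    refine Eq.trans ?_ (hode s hs)
    norm_num
    ring
  have hQ0 : Q 0 = 1 / Φ 0 := by
    have := hode' 0 ⟨by linarith, q1⟩
    simpa using this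
  obtain ⟨η₃, s1, s2, hQpos⟩ := exists_Ioo_forall_pos q1 (continuousAt_of_regular q1 rQ)
    (by rw [hQ0]; exact one_div_pos.2 (hΦpos 0 D₁.zero_mem))
  have hle : η₃ ≤ η₁ := s2.trans q2
  have D₃ := D₁.mono s1 hle
  have rQ₃ := rQ.mono (Ioo_subset_Ioo (neg_le_neg s2) s2)
  have sub₃ : Ioo (-η₃) η₃ ⊆ Ioo (-η₁) η₁ := Ioo_subset_Ioo (neg_le_neg hle) hle
  obtain ⟨-, σ, R, -, -, d3, rR, hR0, -, hS, hSpos⟩ := exists_sq_coordinate hn s1 rQ₃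
    (hQpos 0 D₃.zero_mem)
  have hm : ∀ x ∈ Ioo (-σ) σ, R x ∈ Ioo (-η₃) η₃ := fun x hx => (hS x hx).1
  have dR : ∀ x ∈ Ioo (-σ) σ, HasDerivAt R (Φ (R x)) x := fun x hx => by
    have e1 := hasDerivAt_of_regular hn rR hx
    have e2 := hasDerivAt_of_regular hn rQ₃ (hm x hx)
    have e3 : HasDerivAt (fun y => R y * Q (R y)) 1 x :=
      (hasDerivAt_id x).congr_of_eventuallyEq (by
        filter_upwards [isOpen_Ioo.mem_nhds hx] with y hy using (hS y hy).2)
    have e4 := (e1.mul (HasDerivAt.comp x (h₂ := Q) (h := R) e2 e1)).unique e3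
    have e5 := hode' (R x) (Ioo_subset_Ioo (neg_le_neg s2) s2 (hm x hx))
    have e6 := hΦpos (R x) (sub₃ (hm x hx))
    have e7 : deriv R x * (1 / Φ (R x)) = 1 := by
      rw [← e5, ← e4]
      simp only [Function.comp_def]
      ring
    rw [mul_one_div, div_eq_one_iff_eq e6.ne'] at e7
    rwa [e7] at e1
  have rcomp : ∀ {G : ℝ → ℝ}, ContDiffOn ℝ n G (Ioo (-η₃) η₃) →
      ContDiffOn ℝ n (fun x => G (R x)) (Ioo (-σ) σ) := fun hG => hG.comp rR hm
  have hRlt : ∀ x ∈ Ioo 0 σ, Real.sqrt (R x) ∈ Ioo 0 (Real.sqrt η₃) := fun x hx =>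
    ⟨Real.sqrt_pos.2 (hSpos x hx).1, Real.sqrt_lt_sqrt (hSpos x hx).1.le (hSpos x hx).2⟩
  set Δ : ℝ → ℝ := fun x => Fs (R x) / Q (R x) with hΔ
  set k₃ : ℝ → ℝ := fun x => -(Fs (R x) ^ 2 * Ws (R x) / Q (R x)) with hk₃
  set γ₁ : ℝ → ℝ := fun x => As (R x) / Fs (R x) with hγ₁
  set γ₃ : ℝ → ℝ := fun x => Cs (R x) * K (R x) with hγ₃
  have rΔ : ContDiffOn ℝ n Δ (Ioo (-σ) σ) := (rcomp D₃.reg_F).div (rcomp rQ₃)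
    fun x hx => (hQpos _ (hm x hx)).ne'
  have rk : ContDiffOn ℝ n k₃ (Ioo (-σ) σ) := ((((rcomp D₃.reg_F).pow 2).mul (rcomp D₃.reg_W)).div
    (rcomp rQ₃) fun x hx => (hQpos _ (hm x hx)).ne').neg
  have rγ₁ : ContDiffOn ℝ n γ₁ (Ioo (-σ) σ) := (rcomp D₃.reg_A).div (rcomp D₃.reg_F)
    fun x hx => (D₃.F_pos _ (hm x hx)).ne'
  have rγ₃ : ContDiffOn ℝ n γ₃ (Ioo (-σ) σ) := (rcomp D₃.reg_C).mul (rcomp (rK₁.mono sub₃))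
  have pΔ : ∀ x ∈ Ioo (-σ) σ, 0 < Δ x := fun x hx =>
    div_pos (D₃.F_pos _ (hm x hx)) (hQpos _ (hm x hx))
  have pγ₁ : ∀ x ∈ Ioo (-σ) σ, 0 < γ₁ x := fun x hx =>
    div_pos (D₃.A_pos _ (hm x hx)) (D₃.F_pos _ (hm x hx))
  have pγ₃ : ∀ x ∈ Ioo (-σ) σ, 0 < γ₃ x := fun x hx =>
    mul_pos (D₃.C_pos _ (hm x hx)) (hKpos _ (sub₃ (hm x hx)))
  have dr : ∀ x ∈ Ioo 0 σ, HasDerivAt (fun x => Real.sqrt (R x))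
      (Φ (R x) / (2 * Real.sqrt (R x))) x := fun x hx =>
    (dR x (Ioo_zero_subset hx)).sqrt (hSpos x hx).1.ne'
  have sr : ContDiffOn ℝ ∞ (fun x => Real.sqrt (R x)) (Ioo 0 σ) :=
    ((rR.mono Ioo_zero_subset).of_le (infty_le_regularity hn)).sqrt fun x hx => (hSpos x hx).1.ne'
  obtain ⟨T, χ, H⟩ := exists_standardChart d3 (k := ![fun _ => 0, fun _ => 0, k₃])
    (γ := fun x => Matrix.diagonal ![γ₁ x, γ₁ x, γ₃ x]) (Δ := Δ) (k₃ := k₃) (γ₁ := γ₁) (γ₃ := γ₃)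
    (r := fun x => Real.sqrt (R x)) (N := N) (A := A) (C := C) (f := f) (w := w)
    (fun x hx => by funext i; fin_cases i <;> rfl) (fun x hx => rfl)
    (fun x hx => pΔ x (Ioo_zero_subset hx)) (fun x hx => pγ₃ x (Ioo_zero_subset hx))
    ((rΔ.mono Ioo_zero_subset).of_le (infty_le_regularity hn))
    ((rk.mono Ioo_zero_subset).of_le (infty_le_regularity hn))
    ((rγ₃.mono Ioo_zero_subset).of_le (infty_le_regularity hn)) sr
    (fun x hx => (hRlt x hx).1)
    (fun x hx => by
      rw [(dr x hx).deriv]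
      exact (div_pos (hΦpos _ (sub₃ (hm x (Ioo_zero_subset hx))))
        (mul_pos two_pos (hRlt x hx).1)).ne')
    (fun x hx => by
      have hx' := hm x (Ioo_zero_subset hx)
      have e0 := (hSpos x hx).1
      have e1 := (hRlt x hx).1
      have e2 : Real.sqrt (R x) ^ 2 = R x := Real.sq_sqrt e0.le
      have e3 : Real.sqrt (R x) ^ 2 < η₃ := by rw [e2]; exact hx'.2
      have e4 := (hS x (Ioo_zero_subset hx)).2
      have q1 := D₃.N_pos _ hx'
      have q2 := D₃.A_pos _ hx'
      have q3 := D₃.C_pos _ hx'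
      have q4 := D₃.F_pos _ hx'
      have q5 := hQpos _ hx'
      have q6 := hKpos _ (sub₃ hx')
      have q7 : γ₃ x + k₃ x ^ 2 / Δ x ^ 2 = Cs (R x) / Fs (R x) := by
        simp only [hγ₃, hk₃, hΔ, hK]
        field_simp
        ring
      have q8 : x * Δ x = R x * Fs (R x) := by
        simp only [hΔ]
        rw [mul_div_assoc', div_eq_iff q5.ne']
        linear_combination (-Fs (R x)) * e4
      have q9 : x * (Δ x * (γ₃ x + k₃ x ^ 2 / Δ x ^ 2)) = R x * Cs (R x) := by
        rw [q7, ← mul_assoc, q8]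
        field_simp
      refine ⟨?_, ?_, ?_, ?_, ?_⟩
      · rw [D₃.f_eq _ e1 e3, e2, q8]
      · rw [D₃.A_eq _ e1 e3, e2, q8]
        simp only [hγ₁]
        field_simp
      · rw [D₃.C_eq _ e1 e3, e2, q9]
      · rw [D₃.w_eq _ e1 e3, e2, sq (Δ x), ← mul_assoc, q8]
        simp only [hk₃, hΔ]
        field_simp
      · rw [D₃.N_eq _ e1 e3, e2, q9, (dr x hx).deriv, div_pow, hΦsq _ (sub₃ hx'), mul_pow, e2]
        simp only [hγ₃]
        field_simp
        norm_num)
  -- the near-horizon data depend on `A` and `f` through `Fs 0 / As 0` only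
  have hdata : Δ 0 ^ 2 = Fs 0 / As 0 + 3 / ℓ ^ 2 := by
    have e1 : Δ 0 = Fs 0 * Φ 0 := by simp only [hΔ, hR0, hQ0]; field_simp
    rw [e1, mul_pow, hΦsq 0 D₁.zero_mem]
    have e2 : K 0 = As 0 / Fs 0 * (1 + 3 * As 0 / (ℓ ^ 2 * Fs 0)) / Cs 0 := by
      rw [← hCK]; field_simp
    have e3 : Ns 0 = 4 * As 0 ^ 2 / Cs 0 := by rw [← h1]; field_simp
    rw [e2, e3]
    field_simp
  have hΔ0 := pΔ 0 ⟨by linarith, d3⟩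
  have hdiff : Δ 0 ^ 2 - 3 / ℓ ^ 2 = Fs 0 / As 0 := by rw [hdata]; ring
  refine ⟨σ, Δ, ![fun _ => 0, fun _ => 0, k₃], fun x => Matrix.diagonal ![γ₁ x, γ₁ x, γ₃ x], T,
    fun x => Real.sqrt (R x), χ, ⟨d3, rΔ, fun i => ?_, fun i j => ?_, fun x hx => ?_⟩,
    ⟨?_, ?_, ?_⟩, H, ?_, fun x hx => ?_⟩
  · fin_cases i
    · exact contDiffOn_const
    · exact contDiffOn_const
    · exact rk
  · fin_cases i <;> fin_cases j <;> simp
    · exact rγ₁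
    · exact contDiffOn_const
    · exact contDiffOn_const
    · exact contDiffOn_const
    · exact rγ₁
    · exact contDiffOn_const
    · exact contDiffOn_const
    · exact contDiffOn_const
    · exact rγ₃
  · refine Matrix.PosDef.diagonal fun i => ?_
    fin_cases i
    · exact pγ₁ x hx
    · exact pγ₁ x hx
    · exact pγ₃ x hx
  · refine lt_of_pow_lt_pow_left₀ 2 hΔ0.le ?_
    rw [div_pow, Real.sq_sqrt (by norm_num), hdata]
    have : 0 < Fs 0 / As 0 := div_pos pF pA
    linarith
  · have e1 : k₃ 0 = -(3 * Δ 0 / (ℓ * (Δ 0 ^ 2 - 3 / ℓ ^ 2))) := by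
      rw [hdiff]
      simp only [hk₃, hΔ, hR0]
      rw [h2]
      field_simp
    funext i
    fin_cases i
    · rfl
    · rfl
    · exact e1
  · have e1 : γ₁ 0 = 1 / (Δ 0 ^ 2 - 3 / ℓ ^ 2) := by
      rw [hdiff]
      simp only [hγ₁, hR0]
      field_simp
    have e3 : γ₃ 0 = Δ 0 ^ 2 / (Δ 0 ^ 2 - 3 / ℓ ^ 2) ^ 2 := by
      rw [hdiff, hdata]
      simp only [hγ₃, hR0]
      rw [hCK]
      field_simp
    rw [← e1, ← e3]
  · have hc : ContinuousAt (fun x => Real.sqrt (R x)) 0 := (continuousAt_of_regular d3 rR).sqrt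
    have := hc.tendsto
    rw [hR0, Real.sqrt_zero] at this
    exact this.mono_left nhdsWithin_le_nhds
  · refine (hRlt x hx).2.trans_le ?_
    rw [Real.sqrt_le_left hx₁.le]
    exact (hle.trans p2).trans hη

end ConicalData

/-- A supersymmetric solution with a conical singularity has a horizon. -/
theorem ConicalData.hasHorizonAtZero_of_susy {n : WithTop ℕ∞} (hn : n = ∞ ∨ n = ω) {η : ℝ}
    {Ns As Cs Fs Ws N A C f w : ℝ → ℝ} (D : ConicalData n η Ns As Cs Fs Ws N A C f w) {ℓ x₁ : ℝ}
    (hℓ : 0 < ℓ) (hx₁ : 0 < x₁) (hsusy : IsTimelikeSusy ℓ (region x₁) (fun p => f (p 0))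
      (sigma3Form w) (radialMetric N A C) (ext1 (sigma3Form A))) :
    HasHorizonAtZero ℓ n x₁ N A C f w := by
  have D' := D.mono (lt_min D.pos (pow_pos hx₁ 2)) (min_le_left η (x₁ ^ 2))
  have hle : Real.sqrt (min η (x₁ ^ 2)) ≤ x₁ := by
    rw [Real.sqrt_le_left hx₁.le]
    exact min_le_right _ _
  obtain ⟨h1, h2, h3⟩ := D'.values_at_zero hn hℓ (hsusy.mono (region_subset hle))
  exact D'.hasHorizonAtZero hn hℓ hx₁ (min_le_right _ _) h1 h2 h3

/-! ### Boundary conditions at a conical singularity -/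

/-- The one-sided expansion `g(x²) = m x² + O(x⁴)` gives the value and the two-sided derivative of a
differentiable function at `0`. -/
theorem value_and_deriv_of_isBigO {g F : ℝ → ℝ} {m η : ℝ} (hη : 0 < η)
    (hg : DifferentiableAt ℝ g 0) (hF : ∀ x, 0 < x → x ^ 2 < η → F x = g (x ^ 2))
    (h : (fun x => F x - m * x ^ 2) =O[𝓝[>] 0] (fun x : ℝ => x ^ 4)) :
    g 0 = 0 ∧ deriv g 0 = m := by
  have hsqrt : Tendsto Real.sqrt (𝓝[>] 0) (𝓝[>] 0) := by
    refine tendsto_nhdsWithin_of_tendsto_nhds_of_eventually_within _ ?_ ?_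
    · have := (Real.continuous_sqrt.tendsto 0)
      rw [Real.sqrt_zero] at this
      exact this.mono_left nhdsWithin_le_nhds
    · filter_upwards [self_mem_nhdsWithin] with s hs using Real.sqrt_pos.2 hs
  have h1 : (fun s => g s - m * s) =O[𝓝[>] 0] (fun s : ℝ => s ^ 2) := by
    refine (h.comp_tendsto hsqrt).congr' ?_ ?_
    · filter_upwards [Ioo_mem_nhdsGT_zero hη] with s hs
      have := hF (Real.sqrt s) (Real.sqrt_pos.2 hs.1) (by rw [Real.sq_sqrt hs.1.le]; exact hs.2)
      simp only [Function.comp, this, Real.sq_sqrt hs.1.le]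
    · filter_upwards [self_mem_nhdsWithin] with s hs
      have h2 := Real.sq_sqrt (mem_Ioi.1 hs).le
      simp only [Function.comp]
      rw [show Real.sqrt s ^ 4 = (Real.sqrt s ^ 2) ^ 2 by ring, h2]
  have h0 : g 0 = 0 := by
    have t1 : Tendsto (fun s : ℝ => s ^ 2) (𝓝[>] 0) (𝓝 0) := by
      have := (continuous_pow 2 : Continuous fun s : ℝ => s ^ 2).tendsto 0
      simp only [ne_eq, OfNat.ofNat_ne_zero, not_false_eq_true, zero_pow] at this
      exact this.mono_left nhdsWithin_le_nhds
    have t2 : Tendsto (fun s => g s - m * s) (𝓝[>] 0) (𝓝 (g 0 - m * 0)) :=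
      (hg.continuousAt.sub (continuousAt_const.mul continuousAt_id)).tendsto.mono_left
        nhdsWithin_le_nhds
    simpa using tendsto_nhds_unique t2 (h1.trans_tendsto t1)
  refine ⟨h0, ?_⟩
  have h2 : HasDerivWithinAt g m (Ioi 0) 0 := by
    rw [hasDerivWithinAt_iff_isLittleO]
    simp only [h0, sub_zero, smul_eq_mul]
    refine IsBigO.trans_isLittleO (g := fun s : ℝ => s ^ 2) (h1.congr_left fun s => by ring) ?_
    exact (isLittleO_pow_id one_lt_two).mono nhdsWithin_le_nhds
  exact (uniqueDiffWithinAt_Ioi 0).eq_deriv _ hg.hasDerivAt.hasDerivWithinAt h2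

theorem hasHorizonAtZero_of_isConical {n : WithTop ℕ∞} (hn : n = ∞ ∨ n = ω) {ℓ x₁ : ℝ}
    (hℓ : 0 < ℓ) (hx₁ : 0 < x₁) {a c f w : ℝ → ℝ} {α f₀ w₀ : ℝ} (hα : 0 < α) (hf₀ : 0 < f₀)
    (hsusy : IsTimelikeSusy ℓ (region x₁) (fun p => f (p 0)) (sigma3Form w)
      (radialMetric (fun _ => 1) (fun x => a x ^ 2) (fun x => c x ^ 2))
      (ext1 (sigma3Form fun x => a x ^ 2)))
    (h : IsConical n (α ^ 2) f₀ w₀ a c f w) :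
    HasHorizonAtZero ℓ n x₁ (fun _ => 1) (fun x => a x ^ 2) (fun x => c x ^ 2) f w := by
  obtain ⟨⟨η, A, C, F, W, hη, rA, rC, rF, rW, heq⟩, oA, oC, oF, -⟩ := h
  -- each of `a²`, `c²`, `f` is `x²` times a regular function of `x²`, with known value at `0`
  have key : ∀ {g G : ℝ → ℝ} {m : ℝ}, 0 < m → ContDiffOn ℝ n g (Ioo (-η) η) →
      (∀ x, 0 < x → x ^ 2 < η → G x = g (x ^ 2)) →
      (fun x => G x - m * x ^ 2) =O[𝓝[>] 0] (fun x : ℝ => x ^ 4) →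
      ∃ (η' : ℝ) (q : ℝ → ℝ), 0 < η' ∧ η' ≤ η ∧ ContDiffOn ℝ n q (Ioo (-η') η') ∧
        (∀ s ∈ Ioo (-η') η', 0 < q s) ∧ ∀ x, 0 < x → x ^ 2 < η' → G x = x ^ 2 * q (x ^ 2) := by
    intro g G m hm rg hG hO
    obtain ⟨e0, e1⟩ := value_and_deriv_of_isBigO hη
      (hasDerivAt_of_regular hn rg ⟨by linarith, hη⟩).differentiableAt hG hO
    obtain ⟨η₁, q, p1, p2, rq, q0, hq⟩ := exists_regular_quotient hn hη rg e0
    obtain ⟨η₂, s1, s2, s3⟩ := exists_Ioo_forall_pos p1 (continuousAt_of_regular p1 rq)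
      (by rw [q0, e1]; exact hm)
    have hsub : Ioo (-η₂) η₂ ⊆ Ioo (-η₁) η₁ := Ioo_subset_Ioo (neg_le_neg s2) s2
    refine ⟨η₂, q, s1, s2.trans p2, rq.mono hsub, s3, fun x hx hxη => ?_⟩
    rw [hG x hx (hxη.trans_le (s2.trans p2))]
    exact hq _ (hsub (Ioo_zero_subset ⟨pow_pos hx 2, hxη⟩))
  obtain ⟨η₁, As, a1, a2, a3, a4, a5⟩ := key (pow_pos hα 2) rA
    (fun x hx hxη => (heq x hx hxη).1) oA
  obtain ⟨η₂, Cs, c1, c2, c3, c4, c5⟩ := key (m := 4 * (α ^ 2) ^ 2) (by positivity) rC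
    (fun x hx hxη => (heq x hx hxη).2.1) oC
  obtain ⟨η₃, Fs, f1, f2, f3, f4, f5⟩ := key hf₀ rF (fun x hx hxη => (heq x hx hxη).2.2.1) oF
  set η' := min η₁ (min η₂ η₃) with hη'
  have l1 : η' ≤ η₁ := min_le_left _ _
  have l2 : η' ≤ η₂ := (min_le_right _ _).trans (min_le_left _ _)
  have l3 : η' ≤ η₃ := (min_le_right _ _).trans (min_le_right _ _)
  have hsub : ∀ {b}, η' ≤ b → Ioo (-η') η' ⊆ Ioo (-b) b := fun hb =>
    Ioo_subset_Ioo (neg_le_neg hb) hb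
  have D : ConicalData n η' (fun _ => 1) As Cs Fs W (fun _ => 1) (fun x => a x ^ 2)
      (fun x => c x ^ 2) f w :=
    { pos := lt_min a1 (lt_min c1 f1)
      reg_N := contDiffOn_const
      reg_A := a3.mono (hsub l1)
      reg_C := c3.mono (hsub l2)
      reg_F := f3.mono (hsub l3)
      reg_W := rW.mono (hsub (l1.trans a2))
      N_pos := fun _ _ => one_pos
      A_pos := fun s hs => a4 s (hsub l1 hs)
      C_pos := fun s hs => c4 s (hsub l2 hs)
      F_pos := fun s hs => f4 s (hsub l3 hs)
      N_eq := fun _ _ _ => rfl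
      A_eq := fun x hx hxη => a5 x hx (hxη.trans_le l1)
      C_eq := fun x hx hxη => c5 x hx (hxη.trans_le l2)
      f_eq := fun x hx hxη => f5 x hx (hxη.trans_le l3)
      w_eq := fun x hx hxη => by
        rw [← (heq x hx (hxη.trans_le (l1.trans a2))).2.2.2,
          mul_div_cancel_left₀ _ (pow_pos hx 2).ne'] }
  exact D.hasHorizonAtZero_of_susy hn hℓ hx₁ hsusy

theorem hasHorizonAtZero_of_isRegular {n : WithTop ℕ∞} (hn : n = ∞ ∨ n = ω) {ℓ x₁ : ℝ}
    (hℓ : 0 < ℓ) (hx₁ : 0 < x₁) {V f w : ℝ → ℝ} {V₀ : ℝ}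
    (hsusy : IsTimelikeSusy ℓ (region x₁) (fun p => f (p 0)) (sigma3Form w)
      (radialMetric (fun x => 1 / V x) (fun x => x ^ 2 / 4) (fun x => x ^ 2 * V x / 4))
      (ext1 (sigma3Form fun x => x ^ 2 / 4)))
    (h : IsRegularInRSquared n V₀ V f w) :
    HasHorizonAtZero ℓ n x₁
      (fun x => 1 / V x) (fun x => x ^ 2 / 4) (fun x => x ^ 2 * V x / 4) f w := by
  obtain ⟨η, Vs, Fs, Ws, hη, rV, rF, rW, hpos, -, heq⟩ := h
  obtain ⟨η₁, v1, v2, v3⟩ := exists_Ioo_forall_pos hη (continuousAt_of_regular hη rV)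
    (hpos 0 ⟨le_rfl, hη⟩).1
  obtain ⟨η₂, f1, f2, f3⟩ := exists_Ioo_forall_pos v1
    (continuousAt_of_regular hη rF) (hpos 0 ⟨le_rfl, hη⟩).2
  have s1 : Ioo (-η₂) η₂ ⊆ Ioo (-η₁) η₁ := Ioo_subset_Ioo (neg_le_neg f2) f2
  have s2 : Ioo (-η₂) η₂ ⊆ Ioo (-η) η :=
    Ioo_subset_Ioo (neg_le_neg (f2.trans v2)) (f2.trans v2)
  have D : ConicalData n η₂ (fun s => 1 / Vs s) (fun _ => 1 / 4) (fun s => Vs s / 4) Fs Ws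
      (fun x => 1 / V x) (fun x => x ^ 2 / 4) (fun x => x ^ 2 * V x / 4) f w :=
    { pos := f1
      reg_N := contDiffOn_const.div (rV.mono s2) fun s hs => (v3 s (s1 hs)).ne'
      reg_A := contDiffOn_const
      reg_C := (rV.mono s2).div_const 4
      reg_F := rF.mono s2
      reg_W := rW.mono s2
      N_pos := fun s hs => one_div_pos.2 (v3 s (s1 hs))
      A_pos := fun _ _ => by norm_num
      C_pos := fun s hs => div_pos (v3 s (s1 hs)) four_pos
      F_pos := f3
      N_eq := fun x hx hxη => by
        rw [(heq x hx (hxη.trans_le (f2.trans v2))).1]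
      A_eq := fun x hx hxη => by ring
      C_eq := fun x hx hxη => by
        rw [(heq x hx (hxη.trans_le (f2.trans v2))).1]
        ring
      f_eq := fun x hx hxη => by
        rw [← (heq x hx (hxη.trans_le (f2.trans v2))).2.1,
          mul_div_cancel₀ _ (pow_pos hx 2).ne']
      w_eq := fun x hx hxη => by
        rw [← (heq x hx (hxη.trans_le (f2.trans v2))).2.2,
          mul_div_cancel_left₀ _ (pow_pos hx 2).ne'] }
  exact D.hasHorizonAtZero_of_susy hn hℓ hx₁ hsusy

/-! ### The near-horizon constants -/

/-- The coefficients at `λ = 0` in terms of `Δ(0)`. -/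
theorem IsGutowskiReallNH.values {ℓ : ℝ} (hℓ : 0 < ℓ) {Δ : ℝ → ℝ} {k : Fin 3 → ℝ → ℝ}
    {γ : ℝ → Matrix (Fin 3) (Fin 3) ℝ} (h : IsGutowskiReallNH ℓ Δ k γ) :
    0 < Δ 0 ∧ 0 < Δ 0 ^ 2 - 3 / ℓ ^ 2 ∧
    k 2 0 = -(3 * Δ 0 / (ℓ * (Δ 0 ^ 2 - 3 / ℓ ^ 2))) ∧
    γ 0 0 0 = 1 / (Δ 0 ^ 2 - 3 / ℓ ^ 2) ∧ γ 0 2 2 = Δ 0 ^ 2 / (Δ 0 ^ 2 - 3 / ℓ ^ 2) ^ 2 ∧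
    fiberCoeff Δ (k 2) (fun x => γ x 2 2) 0
      = Δ 0 * (Δ 0 ^ 2 + 9 / ℓ ^ 2) / (Δ 0 ^ 2 - 3 / ℓ ^ 2) ^ 2 := by
  have h0 : 0 < Δ 0 := lt_trans (by positivity) h.Delta_gt
  have hD : 0 < Δ 0 ^ 2 - 3 / ℓ ^ 2 := by
    have h1 : (Real.sqrt 3 / ℓ) ^ 2 < Δ 0 ^ 2 := by
      have := h.Delta_gt
      gcongr
    rw [div_pow, Real.sq_sqrt (by norm_num)] at h1
    linarith
  have hk2 := congrFun h.k_eq 2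
  have hg0 := congrFun (congrFun h.gamma_eq 0) 0
  have hg2 := congrFun (congrFun h.gamma_eq 2) 2
  rw [Matrix.diagonal_apply_eq] at hg0 hg2
  refine ⟨h0, hD, hk2, hg0, hg2, ?_⟩
  have e2 : k 2 0 = -(3 * Δ 0 / (ℓ * (Δ 0 ^ 2 - 3 / ℓ ^ 2))) := hk2
  have e3 : γ 0 2 2 = Δ 0 ^ 2 / (Δ 0 ^ 2 - 3 / ℓ ^ 2) ^ 2 := hg2
  simp only [fiberCoeff, e2, e3]
  generalize Δ 0 ^ 2 - 3 / ℓ ^ 2 = d at *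
  field_simp
  ring

/-- The leading coefficients in the standard charts. -/
theorem IsGutowskiReallNH.coefficients {ℓ : ℝ} (hℓ : 0 < ℓ) {Δ : ℝ → ℝ} {k : Fin 3 → ℝ → ℝ}
    {γ : ℝ → Matrix (Fin 3) (Fin 3) ℝ} (h : IsGutowskiReallNH ℓ Δ k γ) {H α2 : ℝ}
    (hH : H = fiberCoeff Δ (k 2) (fun x => γ x 2 2) 0) (hα2 : α2 = alphaSq ℓ (Δ 0)) :
    1 < 4 * α2 ∧ 4 * γ 0 2 2 * α2 = Δ 0 * γ 0 0 0 * H ∧ 16 * γ 0 2 2 * α2 ^ 2 = H ^ 2 ∧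
    4 * γ 0 2 2 * fZero ℓ α2 = Δ 0 * H ∧
    omegaZero ℓ α2 = -(4 * γ 0 2 2 / H * (k 2 0 / Δ 0 ^ 2)) ∧ H / (Δ 0 * γ 0 0 0) = 4 * α2 := by
  obtain ⟨h0, hD, e1, e2, e3, e4⟩ := h.values hℓ
  rw [e1, e2, e3, hH, e4, hα2]
  simp only [fZero, omegaZero, alphaSq]
  obtain ⟨d, hd⟩ : ∃ d, d = Δ 0 ^ 2 - 3 / ℓ ^ 2 := ⟨_, rfl⟩
  have h9 : Δ 0 ^ 2 + 9 / ℓ ^ 2 = d + 12 / ℓ ^ 2 := by rw [hd]; ring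
  rw [← hd] at hD ⊢
  rw [h9]
  have h41 : 4 * ((d + 12 / ℓ ^ 2) / (4 * d)) - 1 = 12 / (ℓ ^ 2 * d) := by
    field_simp
    ring
  have hp : 0 < d + 12 / ℓ ^ 2 := by positivity
  have hpos : 0 < 12 / (ℓ ^ 2 * d) := by positivity
  rw [h41]
  refine ⟨by linarith, ?_, ?_, ?_, ?_, ?_⟩
  · field_simp
  · field_simp
    norm_num
  · field_simp
  · field_simp
    norm_num
  · field_simp

end

end SusyHorizon

theorem mainTheorem7 (ℓ : ℝ) (hℓ : 0 < ℓ) (n : WithTop ℕ∞) (hn : n = ∞ ∨ n = ω) :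
    -- a solution with a horizon has the stated form
    (∀ (ε : ℝ) (Δ : ℝ → ℝ) (k : Fin 3 → ℝ → ℝ) (γ : ℝ → Matrix (Fin 3) (Fin 3) ℝ)
        (f : SusyHorizon.Base → ℝ) (om : SusyHorizon.OneForm) (h J : SusyHorizon.TwoTensor),
      SusyHorizon.IsRegularHorizon n ε Δ k γ →
      SusyHorizon.IsGutowskiReallNH ℓ Δ k γ →
      SusyHorizon.IsTimelikeSusy ℓ (SusyHorizon.region ε) f om h J →
      SusyHorizon.IsU1SU2Invariant ℓ (SusyHorizon.region ε) f om h J →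
      (∀ P : SusyHorizon.Spacetime, P.2 ∈ SusyHorizon.region ε → ∀ U W : SusyHorizon.Spacetime,
        SusyHorizon.gaussianNullMetric Δ k γ P U W = SusyHorizon.timelikeMetric f om h P U W) →
      1 < 4 * SusyHorizon.alphaSq ℓ (Δ 0) ∧
      -- the chart with base metric `dρ² + a² (σ₁² + σ₂²) + c² σ₃²`
      (∃ (δ : ℝ) (T ρ χ a c f' w : ℝ → ℝ), 0 < δ ∧ δ ≤ ε ∧
        SusyHorizon.IsStandardChart δ Δ k γ T ρ χ
          (fun _ => 1) (fun x => a x ^ 2) (fun x => c x ^ 2) f' w ∧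
        Tendsto ρ (𝓝[>] 0) (𝓝 0) ∧
        (∀ x ∈ Ioo 0 δ, c (ρ x) = deriv (fun y => a y ^ 2) (ρ x)) ∧
        SusyHorizon.FormMatches δ J ρ χ (fun x => a x ^ 2)) ∧
      (∀ (δ : ℝ) (T ρ χ a c f' w : ℝ → ℝ), 0 < δ → δ ≤ ε →
        SusyHorizon.IsStandardChart δ Δ k γ T ρ χ
          (fun _ => 1) (fun x => a x ^ 2) (fun x => c x ^ 2) f' w →
        Tendsto ρ (𝓝[>] 0) (𝓝 0) →
        SusyHorizon.IsConical n (SusyHorizon.alphaSq ℓ (Δ 0))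
          (SusyHorizon.fZero ℓ (SusyHorizon.alphaSq ℓ (Δ 0)))
          (SusyHorizon.omegaZero ℓ (SusyHorizon.alphaSq ℓ (Δ 0))) a c f' w) ∧
      -- the chart with base metric `dr²/V + (r²/4) (σ₁² + σ₂²) + (r² V/4) σ₃²`
      (∃ (δ : ℝ) (T r χ V f' w : ℝ → ℝ), 0 < δ ∧ δ ≤ ε ∧
        SusyHorizon.IsStandardChart δ Δ k γ T r χ
          (fun x => 1 / V x) (fun x => x ^ 2 / 4) (fun x => x ^ 2 * V x / 4) f' w ∧
        SusyHorizon.FormMatches δ J r χ (fun x => x ^ 2 / 4)) ∧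
      (∀ (δ : ℝ) (T r χ V f' w : ℝ → ℝ), 0 < δ → δ ≤ ε →
        SusyHorizon.IsStandardChart δ Δ k γ T r χ
          (fun x => 1 / V x) (fun x => x ^ 2 / 4) (fun x => x ^ 2 * V x / 4) f' w →
        Tendsto r (𝓝[>] 0) (𝓝 0) ∧
        SusyHorizon.IsRegularInRSquared n (4 * SusyHorizon.alphaSq ℓ (Δ 0)) V f' w)) ∧
    -- conversely, a solution of this form has a horizon: the `ρ` chart
    (∀ (x₁ : ℝ) (a c f w : ℝ → ℝ) (α f₀ w₀ : ℝ), 0 < x₁ → 0 < α → 0 < f₀ →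
      SusyHorizon.IsTimelikeSusy ℓ (SusyHorizon.region x₁) (fun p => f (p 0))
        (SusyHorizon.sigma3Form w)
        (SusyHorizon.radialMetric (fun _ => 1) (fun x => a x ^ 2) (fun x => c x ^ 2))
        (SusyHorizon.ext1 (SusyHorizon.sigma3Form fun x => a x ^ 2)) →
      SusyHorizon.IsConical n (α ^ 2) f₀ w₀ a c f w →
      SusyHorizon.HasHorizonAtZero ℓ n x₁
        (fun _ => 1) (fun x => a x ^ 2) (fun x => c x ^ 2) f w) ∧
    -- conversely, a solution of this form has a horizon: the `r` chart
    (∀ (x₁ : ℝ) (V f w : ℝ → ℝ) (V₀ : ℝ), 0 < x₁ →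
      SusyHorizon.IsTimelikeSusy ℓ (SusyHorizon.region x₁) (fun p => f (p 0))
        (SusyHorizon.sigma3Form w)
        (SusyHorizon.radialMetric
          (fun x => 1 / V x) (fun x => x ^ 2 / 4) (fun x => x ^ 2 * V x / 4))
        (SusyHorizon.ext1 (SusyHorizon.sigma3Form fun x => x ^ 2 / 4)) →
      SusyHorizon.IsRegularInRSquared n V₀ V f w →
      SusyHorizon.HasHorizonAtZero ℓ n x₁
        (fun x => 1 / V x) (fun x => x ^ 2 / 4) (fun x => x ^ 2 * V x / 4) f w) := by
  refine ⟨fun ε Δ k γ f om h J hreg hGR hsusy hsym hg => ?_,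
    fun x₁ a c f w α f₀ w₀ hx₁ hα hf₀ hsusy hcon =>
      SusyHorizon.hasHorizonAtZero_of_isConical hn hℓ hx₁ hα hf₀ hsusy hcon,
    fun x₁ V f w V₀ hx₁ hsusy hregr =>
      SusyHorizon.hasHorizonAtZero_of_isRegular hn hℓ hx₁ hsusy hregr⟩
  obtain ⟨η, hη, hηε, D⟩ := SusyHorizon.exists_horizonData hℓ hreg hGR
  have h0 := (hGR.values hℓ).1
  obtain ⟨c1, c2, c3, c4, c5, c6⟩ := hGR.coefficients hℓ rfl rfl
  have hsub : ∀ {x}, x ∈ Ioo 0 η → x ∈ Ioo 0 ε := fun hx => ⟨hx.1, hx.2.trans_le hηε⟩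
  have hdiag := (SusyHorizon.invariant_data hreg h0 hsusy hsym hg).1
  have hk : ∀ x ∈ Ioo 0 η, (fun i => k i x) = ![0, 0, k 2 x] := fun x hx => (hdiag x (hsub hx)).2.1
  have hγ : ∀ x ∈ Ioo 0 η, γ x = Matrix.diagonal ![γ x 0 0, γ x 0 0, γ x 2 2] := fun x hx =>
    (hdiag x (hsub hx)).2.2
  have hJ := SusyHorizon.kahlerForm_eq hn hℓ hreg hGR hsusy hsym hg
  have hJ₁ := fun p (hp : p ∈ SusyHorizon.region η) =>
    (hJ p (SusyHorizon.region_subset hηε hp)).1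
  have hJ₂ := fun x (hx : x ∈ Ioo 0 η) => (hJ _ (SusyHorizon.equator_mem_region (hsub hx))).2
  refine ⟨c1, ?_, fun δ T ρ χ a c f' w hδ _ H hlim => ?_, ?_, fun δ T r χ V f' w hδ _ H => ?_⟩
  · obtain ⟨δ, T, ρ, χ, a, c, f', w, p1, p2, p3⟩ :=
      SusyHorizon.exists_properDistance_chart hn D hk hγ hJ₁ hJ₂
    exact ⟨δ, T, ρ, χ, a, c, f', w, p1, p2.trans hηε, p3⟩
  · exact SusyHorizon.isConical_of_standardChart hn D hk hγ hδ H hlim c2 c3 c4 c5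
  · obtain ⟨δ, T, r, χ, V, f', w, p1, p2, p3⟩ :=
      SusyHorizon.exists_areal_chart hn D hk hγ hJ₁ hJ₂
    exact ⟨δ, T, r, χ, V, f', w, p1, p2.trans hηε, p3⟩
  · rw [← c6]
    exact SusyHorizon.isRegular_of_standardChart hn D hk hγ hδ H
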